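/- Write $\nabla^\perp=(-\partial_2,\partial_1)$ on $\mathbb R^2$, and let $K(x,y)=\frac1{2\pi}\nabla_x^\perp\log|x-y|$. For $\alpha>0$ let $K^\alpha(x,y)=\nabla_x^\perp G^\alpha(|x-y|)$ with $G^\alpha(r)=\frac1{2\pi}\bigl(K_0(r/\alpha)+\log r\bigr)$, where $K_0(r)=\int_0^\infty e^{-r\cosh t}\,dt$ is the modified Bessel function of the second kind of order zero, and set $K^\alpha(x,x)=0$ (the continuous extension). Let $\mathcal G$ be the group of homeomorphisms of $\mathbb R^2$ that preserve Lebesgue measure, and $\mathcal M(\mathbb R^2)$ the space of finite signed Borel (Radon) measures on $\mathbb R^2$ with the total variation norm $\|\cdot\|_{\mathcal M}$. A flow map of the Euler equations with initial vorticity $\omega_0$ is a family $\eta(\cdot,t)\in\mathcal G$, $t\in\mathbb R$, with $\eta(x,0)=x$ and $$\partial_t\eta(x,t)=\int_{\mathbb R^2}K(\eta(x,t),\eta(y,t))\,\omega_0(y)\,dy \qquad(x\in\mathbb R^2,\ t\in\mathbb R).$$ A flow map of the vortex blob method with parameter $\alpha>0$ and initial data $q_0\in\mathcal M(\mathbb R^2)$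 is a family $\eta^\alpha(\cdot,t)\in\mathcal G$, $t\in\mathbb R$, with $\eta^\alpha(x,0)=x$ and $$\partial_t\eta^\alpha(x,t)=\int_{\mathbb R^2}K^\alpha(\eta^\alpha(x,t),\eta^\alpha(y,t))\,dq_0(y) \qquad(x\in\mathbb R^2,\ t\in\mathbb R).$$ Theorem. Let $\omega_0\in L^1(\mathbb R^2)\cap L^\infty(\mathbb R^2)$ and let $\eta$ be the flow map of the Euler equations with initial vorticity $\omega_0$. Let $(q_0^n)_{n\in\mathbb N}$ be a sequence in $\mathcal M(\mathbb R^2)$ such that $q_0^n\rightharpoonup\omega_0$ weakly, i.e. $\int\phi\,dq_0^n\to\int\phi\,\omega_0\,dx$ for every continuous compactly supported $\phi:\mathbb R^2\to\mathbb R$, and $\|q_0^n\|_{\mathcal M}\to\|\omega_0\|_{L^1}$. Then for every $T>0$ there exists a sequence $\alpha_n>0$ with $\alpha_n\to0$ such that for every $n$ the vortex blob method with $\alpha=\alpha_n$ and initial data $q_0^n$ has exactly one flow map $\eta^{\alpha_n}$, and $$\lim_{n\to\infty}\ \sup_{t\in[0,T]}\ \sup_{x\in\mathbb R^2} \bigl|\eta^{\alpha_n}(x,t)-\eta(x,t)\bigr|=0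 .$$ -/

import Mathlib

open MeasureTheory Filter Topology

noncomputable section

/-- The Euclidean plane `ℝ²`. -/
abbrev Plane : Type := EuclideanSpace ℝ (Fin 2)

/-- The perpendicular gradient `∇^⊥ f = (-∂₂ f, ∂₁ f)`. -/
def perpGrad (f : Plane → ℝ) (x : Plane) : Plane :=
  !₂[-(fderiv ℝ f x (EuclideanSpace.single 1 1)), fderiv ℝ f x (EuclideanSpace.single 0 1)]

/-- The Euler (Biot–Savart) kernel `K(x, y) = (1 / 2π) ∇^⊥ log |x - y|`, the gradient being taken
in `x`. On the diagonal the value is `0`; for the integrals below this is a null set. -/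
def eulerKernel (x y : Plane) : Plane :=
  perpGrad (fun z => 1 / (2 * Real.pi) * Real.log ‖z - y‖) x

/-- The modified Bessel function of the second kind of order zero,
`K₀(r) = ∫₀^∞ exp (-r cosh t) dt` for `r > 0`. -/
def besselK0 (r : ℝ) : ℝ :=
  ∫ t in Set.Ioi (0 : ℝ), Real.exp (-(r * Real.cosh t))

/-- The radial profile `G^α(r) = (1 / 2π) (K₀(r / α) + log r)`, `r > 0`. The function
`x ↦ G^α(|x|)` is the Green's function of `(1 - α² Δ) Δ`, that is
`Δ G^α = (1 / (2π α²)) K₀(|x| / α)`. -/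
def blobGreen (α r : ℝ) : ℝ :=
  1 / (2 * Real.pi) * (besselK0 (r / α) + Real.log r)

/-- The kernel `K^α(x, y) = ∇^⊥ G^α(|x - y|)` of the vortex blob method, the gradient being taken
in `x`. A radial function has zero `fderiv` at its centre, so `K^α(x, x) = 0`, which is the
continuous extension of `K^α` to the diagonal. -/
def blobKernel (α : ℝ) (x y : Plane) : Plane :=
  perpGrad (fun z => blobGreen α ‖z - y‖) x

/-- `η` is a flow map of the Euler equations with initial vorticity `ω₀`: a curve of Lebesgue
measure preserving homeomorphisms of the plane, equal to the identity at time zero, with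
`∂ₜ η(x, t) = ∫ K(η(x, t), η(y, t)) ω₀(y) dy` for all `x` and `t`. -/
structure IsEulerFlow (ω₀ : Plane → ℝ) (η : ℝ → Plane ≃ₜ Plane) : Prop where
  measurePreserving : ∀ t, MeasurePreserving (η t) volume volume
  initial : ∀ x, η 0 x = x
  hasDerivAt : ∀ x t,
    HasDerivAt (fun s => η s x) (∫ y, ω₀ y • eulerKernel (η t x) (η t y)) t

/-- `η` is a flow map of the vortex blob method with parameter `α` whose initial datum is the
finite signed Borel measure `q₀`: a curve of Lebesgue measure preserving homeomorphisms of the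
plane, equal to the identity at time zero, with
`∂ₜ η(x, t) = ∫ K^α(η(x, t), η(y, t)) dq₀(y)` for all `x` and `t`. -/
structure IsBlobFlow (α : ℝ) (q₀ : SignedMeasure Plane) (η : ℝ → Plane ≃ₜ Plane) : Prop where
  measurePreserving : ∀ t, MeasurePreserving (η t) volume volume
  initial : ∀ x, η 0 x = x
  hasDerivAt : ∀ x t,
    HasDerivAt (fun s => η s x)
      (q₀.integral (fun y => blobKernel α (η t x) (η t y)) (ContinuousLinearMap.lsmul ℝ ℝ).flip) t

/-- Weak convergence of the finite signed measures `q n` to the measure `ω₀ dx`, tested on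
continuous compactly supported functions. (When the total variations are bounded this is the same
as testing on continuous functions vanishing at infinity.) -/
def WeaklyConvergesTo (q : ℕ → SignedMeasure Plane) (ω₀ : Plane → ℝ) : Prop :=
  ∀ φ : Plane → ℝ, Continuous φ → HasCompactSupport φ →
    Tendsto (fun n => (q n).integral φ (ContinuousLinearMap.lsmul ℝ ℝ)) atTop
      (𝓝 (∫ x, φ x * ω₀ x))

end

/-!
The blob kernel `K^α` is a superposition of Gaussian vortices `exp (-c|x|²) x^⊥`, because `K₀` is a
superposition of Gaussians. Estimating wide vortices by their derivative and narrow ones by their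
size shows that `K^α` is bounded and log-Lipschitz, so that Osgood's lemma gives uniqueness and
stability of the flows. Removing the narrow vortices approximates `K^α` uniformly by smooth
divergence-free kernels. Each step of size `s` of the explicit Euler scheme for such a kernel
decreases volumes by a factor `1 - O(s²)` at most, hence the flows preserve the volume.

As `α → 0` with the vorticity `ω₀` fixed, the blob flows converge to the Euler flow: splitting the
plane at distance `√α`, the velocities induced through `K` and `K^α` by any measure preserving
transport of `ω₀` differ by `O(√α)` only, and the Euler velocity is log-Lipschitz. With `α` fixed,
weak convergence of the vorticities without loss of mass makes their velocities converge uniformly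
along a given flow, and Osgood's lemma makes the flows converge. A diagonal choice of `α` combines
the two limits.
-/

open scoped BoundedContinuousFunction

noncomputable section

/-! ### Log-Lipschitz maps and Osgood's lemma -/

lemma exists_exp_neg_nat_le {ε : ℝ} (hε : 0 < ε) : ∃ N : ℕ, Real.exp (-(N : ℝ)) ≤ ε :=
  ((Real.tendsto_exp_neg_atTop_nhds_zero.comp tendsto_natCast_atTop_atTop).eventually
    (Iic_mem_nhds hε)).exists

/-- The `N`-th affine function in the family describing the log-Lipschitz modulus of continuity:
the infimum over `N` of `logMod N d` is of order `d * (1 + |log d|)` for small `d`. -/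
def logMod (N : ℕ) (d : ℝ) : ℝ := (N + 1) * d + Real.exp (-N)

lemma logMod_nonneg (N : ℕ) {d : ℝ} (hd : 0 ≤ d) : 0 ≤ logMod N d := by
  unfold logMod; positivity

@[gcongr]
lemma logMod_mono (N : ℕ) {d e : ℝ} (h : d ≤ e) : logMod N d ≤ logMod N e := by
  unfold logMod; gcongr

lemma logMod_mul_le (N : ℕ) {d c : ℝ} (hc : 1 ≤ c) : logMod N (c * d) ≤ c * logMod N d := by
  unfold logMod
  nlinarith [Real.exp_pos (-(N : ℝ))]

/-- The map `f` is log-Lipschitz with constant `C`: its modulus of continuity is at most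
`C * logMod N` for every `N`. -/
structure LogLipschitzWith {E F : Type*} [SeminormedAddCommGroup E] [SeminormedAddCommGroup F]
    (C : ℝ) (f : E → F) : Prop where
  nonneg : 0 ≤ C
  norm_sub_le : ∀ N x y, ‖f x - f y‖ ≤ C * logMod N ‖x - y‖

lemma exists_forall_lt_mul_logMod_lt {C : ℝ} (hC : 0 ≤ C) {ε : ℝ} (hε : 0 < ε) :
    ∃ δ > 0, ∃ N, ∀ d < δ, C * logMod N d < ε := by
  obtain ⟨N, hN⟩ := exists_exp_neg_nat_le (ε := ε / (4 * (C + 1))) (by positivity)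
  refine ⟨ε / (4 * (C + 1) * (N + 1)), by positivity, N, fun d hd => ?_⟩
  calc C * logMod N d ≤ C * ((N + 1) * (ε / (4 * (C + 1) * (N + 1))) + ε / (4 * (C + 1))) := by
        unfold logMod; gcongr
    _ ≤ (C + 1) * ((N + 1) * (ε / (4 * (C + 1) * (N + 1))) + ε / (4 * (C + 1))) := by
        gcongr; linarith
    _ = ε / 2 := by field_simp; ring
    _ < ε := half_lt_self hε

lemma LogLipschitzWith.uniformContinuous {E F : Type*} [SeminormedAddCommGroup E]
    [SeminormedAddCommGroup F] {C : ℝ} {f : E → F} (hf : LogLipschitzWith C f) :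
    UniformContinuous f := by
  refine Metric.uniformContinuous_iff.2 fun ε hε => ?_
  obtain ⟨δ, hδ, N, hN⟩ := exists_forall_lt_mul_logMod_lt hf.nonneg hε
  refine ⟨δ, hδ, fun x y hxy => ?_⟩
  rw [dist_eq_norm] at hxy ⊢
  exact (hf.norm_sub_le N x y).trans_lt (hN _ hxy)

lemma tendstoUniformlyOn_zero_iff {ι X E : Type*} [SeminormedAddCommGroup E] {l : Filter ι}
    {F : ι → X → E} {s : Set X} :
    TendstoUniformlyOn F 0 l s ↔ ∀ ε > 0, ∀ᶠ i in l, ∀ x ∈ s, ‖F i x‖ < ε := by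
  simp [Metric.tendstoUniformlyOn_iff]

section Osgood

variable {E : Type*} [NormedAddCommGroup E] [NormedSpace ℝ E] {ι : Type*} {l : Filter ι} {C : ℝ}

/- On a time window of length `1 / (2C)` Grönwall's inequality for the `N`-th affine majorant costs
a factor `exp ((N + 1) / 2)` only, which is beaten by the constant term `exp (-N)` of `logMod`. -/
lemma norm_le_of_norm_deriv_le_logMod (hC : 0 < C) {f f' : ℝ → E} {a b ρ : ℝ}
    (hab : b - a ≤ 1 / (2 * C)) (hf : ∀ t ∈ Set.Icc a b, HasDerivAt f (f' t) t) (N : ℕ)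
    (ha : ‖f a‖ ≤ ρ) (hf' : ∀ t ∈ Set.Icc a b, ‖f' t‖ ≤ C * logMod N ‖f t‖ + C * ρ) :
    ∀ t ∈ Set.Icc a b, ‖f t‖ ≤ (2 * ρ + Real.exp (-N)) * Real.exp ((N + 1) / 2) := by
  intro t ht
  have hρ : 0 ≤ ρ := (norm_nonneg _).trans ha
  have hK : 0 < C * ((N : ℝ) + 1) := by positivity
  have growth := norm_le_gronwallBound_of_norm_deriv_right_le
    (fun s hs => (hf s hs).continuousAt.continuousWithinAt)
    (fun s hs => (hf s (Set.Ico_subset_Icc_self hs)).hasDerivWithinAt) ha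
    (K := C * (N + 1)) (ε := C * (Real.exp (-N) + ρ))
    (fun s hs => (hf' s (Set.Ico_subset_Icc_self hs)).trans_eq (by unfold logMod; ring)) t ht
  have hexp : Real.exp (C * (N + 1) * (t - a)) ≤ Real.exp ((N + 1) / 2) := by
    refine Real.exp_le_exp.2 ?_
    calc C * (N + 1) * (t - a) ≤ C * (N + 1) * (1 / (2 * C)) := by gcongr; linarith [ht.2]
      _ = (N + 1) / 2 := by field_simp
  have hε : C * (Real.exp (-N) + ρ) / (C * (N + 1)) ≤ Real.exp (-N) + ρ := by
    rw [mul_div_mul_left _ _ hC.ne']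
    exact div_le_self (by positivity) (by simp)
  rw [gronwallBound_of_K_ne_0 hK.ne'] at growth
  calc ‖f t‖ ≤ _ := growth
    _ ≤ (ρ + C * (Real.exp (-N) + ρ) / (C * (N + 1))) * Real.exp (C * (N + 1) * (t - a)) := by
      have : 0 ≤ C * (Real.exp (-N) + ρ) / (C * (N + 1)) := by positivity
      linarith
    _ ≤ (ρ + (Real.exp (-N) + ρ)) * Real.exp ((N + 1) / 2) := by gcongr
    _ = _ := by ring

lemma exists_window_bound_lt {ε : ℝ} (hε : 0 < ε) :
    ∃ ρ > 0, ∃ N : ℕ, ρ ≤ ε ∧ (2 * ρ + Real.exp (-N)) * Real.exp ((N + 1) / 2) < ε := by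
  obtain ⟨M, hM⟩ := exists_exp_neg_nat_le (ε := ε / 3) (by positivity)
  set N : ℕ := 2 * M + 1
  have hdecay : Real.exp (-(N : ℝ)) * Real.exp ((N + 1) / 2) ≤ ε / 3 := by
    rw [← Real.exp_add]
    refine le_trans (Real.exp_le_exp.2 (le_of_eq ?_)) hM
    simp only [N]; push_cast; ring
  refine ⟨ε / (6 * Real.exp ((N + 1) / 2)), by positivity, N, ?_, ?_⟩
  · refine div_le_self hε.le ?_
    have := Real.one_le_exp (x := ((N : ℝ) + 1) / 2) (by positivity)
    linarith
  · calc (2 * (ε / (6 * Real.exp ((N + 1) / 2))) + Real.exp (-N)) * Real.exp ((N + 1) / 2)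
        = ε / 3 + Real.exp (-N) * Real.exp ((N + 1) / 2) := by field_simp; ring
      _ < ε := by linarith

lemma tendstoUniformlyOn_zero_of_logMod_Icc_zero (hC : 0 < C) {T : ℝ} {f f' : ι → ℝ → E}
    {δ : ι → ℝ → ℝ} (hδ : TendstoUniformlyOn δ 0 l (Set.Icc 0 T))
    (h0 : Tendsto (fun i => f i 0) l (𝓝 0))
    (hf : ∀ i, ∀ t ∈ Set.Icc 0 T, HasDerivAt (f i) (f' i t) t)
    (hf' : ∀ i, ∀ t ∈ Set.Icc 0 T, ∀ N, ‖f' i t‖ ≤ C * logMod N ‖f i t‖ + δ i t) :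
    TendstoUniformlyOn f 0 l (Set.Icc 0 T) := by
  set h : ℝ := 1 / (2 * C)
  have hh : 0 < h := by positivity
  suffices windows : ∀ k : ℕ, ∀ b ≤ T, b ≤ k * h → TendstoUniformlyOn f 0 l (Set.Icc 0 b) by
    obtain ⟨k, hk⟩ := exists_nat_ge (T / h)
    exact windows k T le_rfl ((div_le_iff₀ hh).1 hk)
  intro k
  induction k with
  | zero =>
    intro b _ hb
    refine tendstoUniformlyOn_zero_iff.2 fun ε hε => ?_
    filter_upwards [(tendsto_zero_iff_norm_tendsto_zero.1 h0).eventually_lt_const hε] with i hi t ht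
    rwa [show t = 0 from le_antisymm (ht.2.trans (by simpa using hb)) ht.1]
  | succ k ih =>
    intro b hbT hb
    refine tendstoUniformlyOn_zero_iff.2 fun ε hε => ?_
    obtain ⟨ρ, hρ, N, hρε, hN⟩ := exists_window_bound_lt hε
    set a : ℝ := b - h
    push_cast at hb
    have before := tendstoUniformlyOn_zero_iff.1 (ih a (by linarith) (by linarith)) ρ hρ
    filter_upwards [before, tendstoUniformlyOn_zero_iff.1 hδ (C * ρ) (by positivity),
      (tendsto_zero_iff_norm_tendsto_zero.1 h0).eventually_lt_const hρ] with i hbefore hi hi0 t ht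
    rcases le_total t a with hta | hat
    · exact (hbefore t ⟨ht.1, hta⟩).trans_le hρε
    have hsub : Set.Icc (max 0 a) b ⊆ Set.Icc 0 T :=
      Set.Icc_subset_Icc (le_max_left _ _) hbT
    have hstart : ‖f i (max 0 a)‖ ≤ ρ := by
      rcases max_choice 0 a with h | h
      · rw [h]; exact hi0.le
      · rw [h]; exact (hbefore a ⟨h ▸ le_max_left _ _, le_rfl⟩).le
    refine lt_of_le_of_lt (norm_le_of_norm_deriv_le_logMod hC ?_ (fun s hs => hf i s (hsub hs)) N
      hstart (fun s hs => (hf' i s (hsub hs) N).trans ?_) t ⟨max_le ht.1 hat, ht.2⟩) hN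
    · linarith [le_max_right 0 a]
    · gcongr
      exact (le_abs_self _).trans (hi s (hsub hs)).le

theorem tendstoUniformlyOn_zero_of_logMod (hC : 0 ≤ C) {T : ℝ} {f f' : ι → ℝ → E}
    {δ : ι → ℝ → ℝ} (hδ : TendstoUniformlyOn δ 0 l (Set.Icc (-T) T))
    (h0 : Tendsto (fun i => f i 0) l (𝓝 0)) (hf : ∀ i t, HasDerivAt (f i) (f' i t) t)
    (hf' : ∀ i t, ∀ N, ‖f' i t‖ ≤ C * logMod N ‖f i t‖ + δ i t) :
    TendstoUniformlyOn f 0 l (Set.Icc (-T) T) := by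
  have hC' : 0 < C + 1 := by linarith
  have hf'' : ∀ i t, ∀ N, ‖f' i t‖ ≤ (C + 1) * logMod N ‖f i t‖ + δ i t := fun i t N => by
    have := logMod_nonneg N (norm_nonneg (f i t))
    linarith [hf' i t N]
  have forward := tendstoUniformlyOn_zero_of_logMod_Icc_zero hC' (f := f)
    (tendstoUniformlyOn_zero_iff.2 fun ε hε =>
      (tendstoUniformlyOn_zero_iff.1 hδ ε hε).mono fun i hi t ht =>
        hi t ⟨by linarith [ht.1, ht.2], ht.2⟩)
    h0 (fun i t _ => hf i t) (fun i t _ => hf'' i t)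
  have backward := tendstoUniformlyOn_zero_of_logMod_Icc_zero hC' (T := T)
    (f := fun i t => f i (-t)) (f' := fun i t => -f' i (-t)) (δ := fun i t => δ i (-t))
    (tendstoUniformlyOn_zero_iff.2 fun ε hε =>
      (tendstoUniformlyOn_zero_iff.1 hδ ε hε).mono fun i hi t ht =>
        hi (-t) ⟨by linarith [ht.2], by linarith [ht.1, ht.2]⟩)
    (by simpa using h0)
    (fun i t _ => by simpa [Function.comp_def] using (hf i (-t)).scomp t (hasDerivAt_neg t))
    (fun i t _ N => by simpa using hf'' i (-t) N)
  refine tendstoUniformlyOn_zero_iff.2 fun ε hε => ?_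
  filter_upwards [tendstoUniformlyOn_zero_iff.1 forward ε hε,
    tendstoUniformlyOn_zero_iff.1 backward ε hε] with i hfwd hbwd t ht
  rcases le_total 0 t with h | h
  · exact hfwd t ⟨h, ht.2⟩
  · simpa using hbwd (-t) ⟨by linarith, by linarith [ht.1]⟩

theorem LogLipschitzWith.integralCurve_unique {F : E → E} (hF : LogLipschitzWith C F)
    {X Y : ℝ → E} (hX : IsIntegralCurve X fun _ => F) (hY : IsIntegralCurve Y fun _ => F)
    (h0 : X 0 = Y 0) : X = Y := by
  funext t
  have hzero := tendstoUniformlyOn_zero_of_logMod (l := (⊤ : Filter Unit)) (T := |t|)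
    (f := fun _ t => X t - Y t) (δ := fun _ => 0) hF.nonneg
    (tendstoUniformlyOn_zero_iff.2 fun ε hε => .of_forall fun _ _ _ => by simpa using hε)
    (by simp [h0]) (fun _ t => (hX t).sub (hY t)) (fun _ t N => by simpa using hF.norm_sub_le N _ _)
  exact sub_eq_zero.1 (tendsto_nhds_unique tendsto_const_nhds
    (hzero.tendsto_at ⟨neg_abs_le t, le_abs_self t⟩))

lemma LogLipschitzWith.uniformCauchySeqOn_of_tendstoUniformly {F : E → E}
    (hF : LogLipschitzWith C F) {G : ι → E → E} (hG : TendstoUniformly G F l) {X : ι → ℝ → E}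
    {X₀ : E} (h0 : ∀ i, X i 0 = X₀) (hX : ∀ i, IsIntegralCurve (X i) fun _ => G i) (T : ℝ) :
    UniformCauchySeqOn X l (Set.Icc (-T) T) := by
  rw [SeminormedAddGroup.uniformCauchySeqOn_iff_tendstoUniformlyOn_zero]
  refine tendstoUniformlyOn_zero_of_logMod hF.nonneg
    (f' := fun p t => -G p.1 (X p.1 t) + G p.2 (X p.2 t))
    (δ := fun p t => ‖G p.1 (X p.1 t) - F (X p.1 t)‖ + ‖G p.2 (X p.2 t) - F (X p.2 t)‖)
    (tendstoUniformlyOn_zero_iff.2 fun ε hε => ?_) (by simpa [h0] using tendsto_const_nhds)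
    (fun p t => (hX p.1 t).neg.add (hX p.2 t)) fun p t N => ?_
  · have half := Metric.tendstoUniformly_iff.1 hG (ε / 2) (half_pos hε)
    filter_upwards [half.prod_mk half] with p hp t _
    have h₁ := hp.1 (X p.1 t)
    have h₂ := hp.2 (X p.2 t)
    rw [dist_eq_norm, norm_sub_rev] at h₁ h₂
    rw [Real.norm_of_nonneg (by positivity)]
    linarith
  · have hF' := hF.norm_sub_le N (X p.2 t) (X p.1 t)
    rw [norm_sub_rev (G p.1 _), show -X p.1 t + X p.2 t = X p.2 t - X p.1 t by abel]
    calc ‖-G p.1 (X p.1 t) + G p.2 (X p.2 t)‖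
        = ‖(F (X p.2 t) - F (X p.1 t)) + (F (X p.1 t) - G p.1 (X p.1 t)) +
            (G p.2 (X p.2 t) - F (X p.2 t))‖ := by congr 1; abel
      _ ≤ _ := norm_add₃_le
      _ ≤ _ := by linarith

theorem LogLipschitzWith.exists_tendsto_integralCurve [CompleteSpace E] [l.NeBot] {F : E → E}
    (hF : LogLipschitzWith C F) {G : ι → E → E} (hG : TendstoUniformly G F l) {X : ι → ℝ → E}
    {X₀ : E} (h0 : ∀ i, X i 0 = X₀) (hX : ∀ i, IsIntegralCurve (X i) fun _ => G i) :
    ∃ Y : ℝ → E, Y 0 = X₀ ∧ IsIntegralCurve Y (fun _ => F) ∧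
      ∀ t, Tendsto (fun i => X i t) l (𝓝 (Y t)) := by
  have cauchy := hF.uniformCauchySeqOn_of_tendstoUniformly hG h0 hX
  choose Y hY using fun t : ℝ =>
    cauchy_map_iff_exists_tendsto.1 ((cauchy |t|).cauchy_map ⟨neg_abs_le t, le_abs_self t⟩)
  refine ⟨Y, tendsto_nhds_unique (hY 0) (by simp [h0]), fun t => ?_, hY⟩
  have hunif : TendstoUniformlyOn X Y l (Set.Ioo (-(|t| + 1)) (|t| + 1)) :=
    ((cauchy (|t| + 1)).tendstoUniformlyOn_of_tendsto fun s _ => hY s).mono Set.Ioo_subset_Icc_self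
  refine hasDerivAt_of_tendstoUniformlyOn (g' := fun s => F (Y s)) isOpen_Ioo ?_
    (.of_forall fun i s _ => hX i s) (fun s _ => hY s) (abs_lt.1 (lt_add_one |t|))
  refine Metric.tendstoUniformlyOn_iff.2 fun ε hε => ?_
  filter_upwards [Metric.tendstoUniformlyOn_iff.1
      (hF.uniformContinuous.comp_tendstoUniformlyOn hunif) (ε / 2) (half_pos hε),
    Metric.tendstoUniformly_iff.1 hG (ε / 2) (half_pos hε)] with i hXi hGi s hs
  calc dist (F (Y s)) (G i (X i s)) ≤ _ := dist_triangle _ (F (X i s)) _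
    _ < ε / 2 + ε / 2 := add_lt_add (hXi s hs) (hGi _)
    _ = ε := add_halves ε

end Osgood

/-! ### Explicit Euler scheme -/

section EulerScheme

variable {E : Type*} [NormedAddCommGroup E] [NormedSpace ℝ E] {G : E → E} {L : NNReal} {M : ℝ}
  {X : ℝ → E}

/-- One step of length `s` of the explicit Euler scheme for the vector field `G`. -/
def eulerStep (G : E → E) (s : ℝ) (Y : E) : E := Y + s • G Y

lemma norm_sub_sub_smul_le_of_isIntegralCurve (hL : LipschitzWith L G) (hM : ∀ Y, ‖G Y‖ ≤ M)
    (hX : IsIntegralCurve X fun _ => G) (a s : ℝ) :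
    ‖X (a + s) - X a - s • G (X a)‖ ≤ L * M * s ^ 2 := by
  have hM0 : 0 ≤ M := (norm_nonneg _).trans (hM 0)
  have hlip : ∀ b, ‖X b - X a‖ ≤ M * |b - a| := fun b => by
    simpa using Convex.norm_image_sub_le_of_norm_hasDerivWithin_le (s := Set.univ)
      (fun x _ => (hX x).hasDerivWithinAt) (fun x _ => hM _) convex_univ (Set.mem_univ a)
      (Set.mem_univ b)
  have hderiv : ∀ x, HasDerivAt (fun r => X r - r • G (X a)) (G (X x) - G (X a)) x := fun x => by
    simpa using (hX x).fun_sub ((hasDerivAt_id x).smul_const (G (X a)))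
  have hbound : ∀ x ∈ Set.uIcc a (a + s), ‖G (X x) - G (X a)‖ ≤ L * (M * |s|) := fun x hx => by
    refine (hL.norm_sub_le _ _).trans ?_
    gcongr
    exact (hlip x).trans
      (mul_le_mul_of_nonneg_left (by simpa using Set.abs_sub_left_of_mem_uIcc hx) hM0)
  calc ‖X (a + s) - X a - s • G (X a)‖
      = ‖X (a + s) - (a + s) • G (X a) - (X a - a • G (X a))‖ := by
        congr 1; rw [add_smul]; abel
    _ ≤ L * (M * |s|) * ‖a + s - a‖ := Convex.norm_image_sub_le_of_norm_hasDerivWithin_le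
        (fun x _ => (hderiv x).hasDerivWithinAt) hbound (convex_uIcc a (a + s))
        Set.left_mem_uIcc Set.right_mem_uIcc
    _ = L * M * s ^ 2 := by rw [add_sub_cancel_left, Real.norm_eq_abs, ← sq_abs s]; ring

lemma norm_iterate_eulerStep_sub_le (hL : LipschitzWith L G) (hM : ∀ Y, ‖G Y‖ ≤ M)
    (hX : IsIntegralCurve X fun _ => G) (s : ℝ) (n : ℕ) :
    ‖(eulerStep G s)^[n] (X 0) - X (n * s)‖ ≤ n * (L * M * s ^ 2) * Real.exp (n * (|s| * L)) := by
  have hM0 : 0 ≤ M := (norm_nonneg _).trans (hM 0)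
  have step : ∀ j : ℕ, ‖(eulerStep G s)^[j + 1] (X 0) - X ((j + 1 : ℕ) * s)‖ ≤
      (1 + |s| * L) * ‖(eulerStep G s)^[j] (X 0) - X (j * s)‖ + L * M * s ^ 2 := fun j => by
    rw [Function.iterate_succ_apply', show ((j + 1 : ℕ) : ℝ) * s = j * s + s by push_cast; ring]
    set Y := (eulerStep G s)^[j] (X 0)
    calc ‖eulerStep G s Y - X (j * s + s)‖
        = ‖(Y - X (j * s)) + s • (G Y - G (X (j * s))) +
            -(X (j * s + s) - X (j * s) - s • G (X (j * s)))‖ := by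
          congr 1; rw [eulerStep, smul_sub]; abel
      _ ≤ _ := norm_add₃_le
      _ ≤ ‖Y - X (j * s)‖ + |s| * (L * ‖Y - X (j * s)‖) + L * M * s ^ 2 := by
          rw [norm_neg, norm_smul, Real.norm_eq_abs]
          gcongr
          · exact hL.norm_sub_le _ _
          · exact norm_sub_sub_smul_le_of_isIntegralCurve hL hM hX _ _
      _ = _ := by ring
  simpa using discrete_gronwall (n₀ := 0)
    (u := fun j => ‖(eulerStep G s)^[j] (X 0) - X (j * s)‖) (c := fun _ => |s| * L)
    (b := fun _ => L * M * s ^ 2) (by simp) (fun j _ => step j) (fun _ _ => by positivity)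
    (fun _ _ => by positivity) n.zero_le

theorem tendsto_iterate_eulerStep (hL : LipschitzWith L G) (hM : ∀ Y, ‖G Y‖ ≤ M)
    (hX : IsIntegralCurve X fun _ => G) (t : ℝ) :
    Tendsto (fun n : ℕ => (eulerStep G (t / n))^[n] (X 0)) atTop (𝓝 (X t)) := by
  have herr : ∀ᶠ n : ℕ in atTop, ‖(eulerStep G (t / n))^[n] (X 0) - X t‖ ≤
      L * M * t ^ 2 * Real.exp (|t| * L) / n := by
    filter_upwards [eventually_gt_atTop 0] with n hn
    have hn' : (0 : ℝ) < n := by exact_mod_cast hn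
    have bound := norm_iterate_eulerStep_sub_le hL hM hX (t / n) n
    rw [mul_div_cancel₀ t hn'.ne', abs_div, abs_of_pos hn'] at bound
    refine bound.trans_eq ?_
    rw [show n * (|t| / n * L) = |t| * L by field_simp]
    field_simp
  rw [tendsto_iff_norm_sub_tendsto_zero]
  exact squeeze_zero' (.of_forall fun _ => norm_nonneg _) herr
    (tendsto_const_nhds.div_atTop tendsto_natCast_atTop_atTop)

end EulerScheme

section GlobalExistence

variable {E : Type*} [NormedAddCommGroup E] [NormedSpace ℝ E] {G : E → E} {L : NNReal} {M : ℝ}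

lemma exists_hasDerivAt_Ioo_of_lipschitzWith [CompleteSpace E] (hL : LipschitzWith L G)
    (hM : ∀ Y, ‖G Y‖ ≤ M) (X₀ : E) {R : ℝ} (hR : 0 ≤ R) :
    ∃ X : ℝ → E, X 0 = X₀ ∧ ∀ t ∈ Set.Ioo (-R) R, HasDerivAt X (G (X t)) t := by
  have hmem : (0 : ℝ) ∈ Set.Icc (-R) R := ⟨by linarith, hR⟩
  have picard : IsPicardLindelof (fun _ => G) (⟨0, hmem⟩ : Set.Icc (-R) R) X₀
      (M.toNNReal * R.toNNReal) 0 M.toNNReal L :=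
    ⟨fun _ _ => hL.lipschitzOnWith, fun _ _ => continuousOn_const,
      fun _ _ Y _ => (hM Y).trans (Real.le_coe_toNNReal M), by simp [hR]⟩
  obtain ⟨X, h0, hX⟩ := picard.exists_eq_forall_mem_Icc_hasDerivWithinAt₀
  exact ⟨X, h0, fun t ht => (hX t ⟨ht.1.le, ht.2.le⟩).hasDerivAt (Icc_mem_nhds ht.1 ht.2)⟩

theorem exists_isIntegralCurve_of_lipschitzWith [CompleteSpace E] (hL : LipschitzWith L G)
    (hM : ∀ Y, ‖G Y‖ ≤ M) (X₀ : E) :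
    ∃ X : ℝ → E, X 0 = X₀ ∧ IsIntegralCurve X fun _ => G := by
  choose X h0 hX using fun n : ℕ => exists_hasDerivAt_Ioo_of_lipschitzWith hL hM X₀ n.cast_nonneg
  have agree : ∀ (m n : ℕ) (t : ℝ), |t| < m → |t| < n → X m t = X n t := fun m n t hm hn => by
    set R : ℝ := min m n
    have htR : |t| < R := lt_min hm hn
    refine ODE_solution_unique_of_mem_Ioo (v := fun _ => G) (s := fun _ => Set.univ) (t₀ := 0)
      (a := -R) (b := R) (K := L) (fun _ _ => hL.lipschitzOnWith) ?_
      (fun s hs => ⟨hX m s (abs_lt.1 ?_), trivial⟩) (fun s hs => ⟨hX n s (abs_lt.1 ?_), trivial⟩)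
      ((h0 m).trans (h0 n).symm) (abs_lt.1 htR)
    · exact abs_lt.1 (by simpa using (abs_nonneg t).trans_lt htR)
    · exact (abs_lt.2 hs).trans_le (min_le_left _ _)
    · exact (abs_lt.2 hs).trans_le (min_le_right _ _)
  have hceil : ∀ t : ℝ, |t| < (⌈|t|⌉₊ + 1 : ℕ) := fun t => by
    push_cast; linarith [Nat.le_ceil |t|]
  refine ⟨fun t => X (⌈|t|⌉₊ + 1) t, h0 _, fun t => ?_⟩
  refine (hX _ t (abs_lt.1 (hceil t))).congr_of_eventuallyEq ?_
  filter_upwards [continuous_abs.continuousAt.eventually_lt_const (hceil t)] with s hs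
  exact agree _ _ s (hceil s) hs

end GlobalExistence

/-! ### Gaussian vortices -/

/-- Rotation of the plane by a right angle, so that `perpGrad f` is `perp` of the gradient. -/
def perp : Plane →L[ℝ] Plane :=
  LinearMap.toContinuousLinearMap
    { toFun := fun x => !₂[-(x 1), x 0]
      map_add' := fun x y => by ext i; fin_cases i <;> simp [add_comm]
      map_smul' := fun c x => by ext i; fin_cases i <;> simp }

lemma perp_apply_zero (x : Plane) : perp x 0 = -(x 1) := rfl

lemma perp_apply_one (x : Plane) : perp x 1 = x 0 := rfl

lemma norm_perp (x : Plane) : ‖perp x‖ = ‖x‖ := by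
  rw [EuclideanSpace.norm_eq, EuclideanSpace.norm_eq]
  simp [Fin.sum_univ_two, perp_apply_zero, perp_apply_one, add_comm]

/-- The trace of a linear map of the plane, i.e. the divergence of the vector field it is the
derivative of. It is bundled as a continuous linear map so that it commutes with integrals. -/
def planeTrace : (Plane →L[ℝ] Plane) →L[ℝ] ℝ :=
  (EuclideanSpace.proj 0 ∘L ContinuousLinearMap.apply ℝ Plane (EuclideanSpace.single 0 1)) +
    (EuclideanSpace.proj 1 ∘L ContinuousLinearMap.apply ℝ Plane (EuclideanSpace.single 1 1))

lemma planeTrace_apply (A : Plane →L[ℝ] Plane) :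
    planeTrace A = A (EuclideanSpace.single 0 1) 0 + A (EuclideanSpace.single 1 1) 1 := rfl

lemma planeTrace_perp : planeTrace perp = 0 := by
  simp [planeTrace_apply, perp_apply_zero, perp_apply_one]

/-- The velocity field `exp (-c|x|²) x^⊥` of a Gaussian vortex, the building block of the kernel
of the vortex blob method. -/
def gaussVortex (c : ℝ) (x : Plane) : Plane := Real.exp (-(c * ‖x‖ ^ 2)) • perp x

/-- The derivative of `gaussVortex c` at `x`. -/
def gaussVortexDeriv (c : ℝ) (x : Plane) : Plane →L[ℝ] Plane :=
  Real.exp (-(c * ‖x‖ ^ 2)) • perp +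
    (Real.exp (-(c * ‖x‖ ^ 2)) • -(c • (2 : ℝ) • innerSL ℝ x)).smulRight (perp x)

lemma norm_gaussVortex (c : ℝ) (x : Plane) :
    ‖gaussVortex c x‖ = Real.exp (-(c * ‖x‖ ^ 2)) * ‖x‖ := by
  rw [gaussVortex, norm_smul, norm_perp, Real.norm_eq_abs, Real.abs_exp]

lemma norm_gaussVortex_le {c : ℝ} (hc : 0 < c) (x : Plane) : ‖gaussVortex c x‖ ≤ (√c)⁻¹ := by
  have hsqrt : 0 < √c := Real.sqrt_pos.2 hc
  have hsq : c * ‖x‖ ^ 2 = (√c * ‖x‖) ^ 2 := by rw [mul_pow, Real.sq_sqrt hc.le]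
  have hexp := Real.add_one_le_exp (c * ‖x‖ ^ 2)
  rw [norm_gaussVortex, Real.exp_neg, inv_mul_eq_div, div_le_iff₀ (Real.exp_pos _),
    inv_mul_eq_div, le_div_iff₀ hsqrt]
  nlinarith [sq_nonneg (√c * ‖x‖ - 1)]

lemma hasFDerivAt_gaussVortex (c : ℝ) (x : Plane) :
    HasFDerivAt (gaussVortex c) (gaussVortexDeriv c x) x := by
  have hnorm : HasFDerivAt (fun y : Plane => ‖y‖ ^ 2) ((2 : ℝ) • innerSL ℝ x) x := by
    have h := (hasStrictFDerivAt_norm_sq x).hasFDerivAt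
    rwa [← Nat.cast_smul_eq_nsmul ℝ, Nat.cast_ofNat] at h
  exact ((hnorm.const_mul c).neg.exp).smul perp.hasFDerivAt

lemma planeTrace_gaussVortexDeriv (c : ℝ) (x : Plane) : planeTrace (gaussVortexDeriv c x) = 0 := by
  rw [gaussVortexDeriv, map_add, map_smul, planeTrace_perp, planeTrace_apply]
  simp only [ContinuousLinearMap.smulRight_apply, FunLike.coe_smul, FunLike.coe_neg, Pi.smul_apply,
    Pi.neg_apply, innerSL_apply_apply, EuclideanSpace.inner_single_right, PiLp.smul_apply,
    smul_eq_mul, perp_apply_zero, perp_apply_one, conj_trivial]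
  ring

lemma norm_gaussVortexDeriv_le {c : ℝ} (hc : 0 ≤ c) (x : Plane) :
    ‖gaussVortexDeriv c x‖ ≤ 2 := by
  refine ContinuousLinearMap.opNorm_le_bound _ (by norm_num) fun v => ?_
  have happly : gaussVortexDeriv c x v = Real.exp (-(c * ‖x‖ ^ 2)) •
      (perp v - (2 * c * inner ℝ x v) • perp x) := by
    simp only [gaussVortexDeriv, _root_.add_apply, FunLike.coe_smul, Pi.smul_apply,
      ContinuousLinearMap.smulRight_apply, FunLike.coe_neg, Pi.neg_apply, innerSL_apply_apply,
      smul_eq_mul]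
    module
  have hexp : Real.exp (-(c * ‖x‖ ^ 2)) * (1 + 2 * (c * ‖x‖ ^ 2)) ≤ 2 := by
    rw [Real.exp_neg, inv_mul_eq_div, div_le_iff₀ (Real.exp_pos _)]
    linarith [Real.add_one_le_exp (c * ‖x‖ ^ 2)]
  calc ‖gaussVortexDeriv c x v‖
      = Real.exp (-(c * ‖x‖ ^ 2)) * ‖perp v - (2 * c * inner ℝ x v) • perp x‖ := by
        rw [happly, norm_smul, Real.norm_of_nonneg (Real.exp_pos _).le]
    _ ≤ Real.exp (-(c * ‖x‖ ^ 2)) * (‖v‖ + 2 * c * (‖x‖ * ‖v‖) * ‖x‖) := by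
        gcongr
        refine (norm_sub_le _ _).trans ?_
        rw [norm_smul, norm_perp, norm_perp, norm_mul, Real.norm_of_nonneg (by positivity)]
        gcongr
        exact norm_inner_le_norm x v
    _ = Real.exp (-(c * ‖x‖ ^ 2)) * (1 + 2 * (c * ‖x‖ ^ 2)) * ‖v‖ := by ring
    _ ≤ 2 * ‖v‖ := by gcongr

lemma norm_gaussVortex_sub_le {c : ℝ} (hc : 0 ≤ c) (a b : Plane) :
    ‖gaussVortex c a - gaussVortex c b‖ ≤ 2 * ‖a - b‖ :=
  convex_univ.norm_image_sub_le_of_norm_hasFDerivWithin_le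
    (fun x _ => (hasFDerivAt_gaussVortex c x).hasFDerivWithinAt)
    (fun x _ => norm_gaussVortexDeriv_le hc x) (Set.mem_univ b) (Set.mem_univ a)

/-! ### The Bessel function as a superposition of Gaussians -/

lemma exp_neg_mul_exp_neg_le {c : ℝ} (hc : 0 < c) (t : ℝ) :
    Real.exp (-t) * Real.exp (-(c * Real.exp (-t))) ≤ 2 / c ^ 2 * Real.exp t := by
  have hquad := Real.quadratic_le_exp_of_nonneg (x := c * Real.exp (-t)) (by positivity)
  rw [← inv_inv (Real.exp t), ← Real.exp_neg, Real.exp_neg (c * _), ← div_eq_mul_inv,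
    div_le_iff₀ (Real.exp_pos _)]
  have hy := Real.exp_pos (-t)
  set y := Real.exp (-t)
  calc y = 2 / c ^ 2 * y⁻¹ * ((c * y) ^ 2 / 2) := by field_simp
    _ ≤ 2 / c ^ 2 * y⁻¹ * Real.exp (c * y) := by gcongr; nlinarith [mul_pos hc hy]

lemma integrable_exp_neg_mul_exp {c : ℝ} (hc : 0 < c) :
    Integrable fun t : ℝ => Real.exp (-t) * Real.exp (-(c * Real.exp (-t))) := by
  have hmeas : Continuous fun t : ℝ => Real.exp (-t) * Real.exp (-(c * Real.exp (-t))) := by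
    fun_prop
  rw [← integrableOn_univ, ← Set.Iic_union_Ioi (a := (0 : ℝ)), integrableOn_union]
  constructor
  · refine Integrable.mono' ((integrableOn_exp_Iic 0).const_mul (2 / c ^ 2))
      hmeas.aestronglyMeasurable (.of_forall fun t => ?_)
    rw [Real.norm_of_nonneg (by positivity)]
    exact exp_neg_mul_exp_neg_le hc t
  · refine Integrable.mono' (integrableOn_exp_neg_Ioi 0)
      hmeas.aestronglyMeasurable (.of_forall fun t => ?_)
    rw [Real.norm_of_nonneg (by positivity)]
    exact mul_le_of_le_one_right (Real.exp_pos _).le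
      (Real.exp_le_one_iff.2 (neg_nonpos.2 (by positivity)))

lemma integral_exp_neg_mul_exp {c : ℝ} (hc : 0 < c) :
    ∫ t : ℝ, Real.exp (-t) * Real.exp (-(c * Real.exp (-t))) = c⁻¹ := by
  have hderiv : ∀ t : ℝ, HasDerivAt (fun s => c⁻¹ * Real.exp (-(c * Real.exp (-s))))
      (Real.exp (-t) * Real.exp (-(c * Real.exp (-t)))) t := by
    intro t
    have h := ((((hasDerivAt_neg t).exp).const_mul c).fun_neg.exp).const_mul c⁻¹
    convert! h using 1
    field_simp
  have hbot : Tendsto (fun s => c⁻¹ * Real.exp (-(c * Real.exp (-s)))) atBot (𝓝 0) := by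
    have h : Tendsto (fun s : ℝ => c * Real.exp (-s)) atBot atTop :=
      (Real.tendsto_exp_atTop.comp tendsto_neg_atBot_atTop).const_mul_atTop hc
    simpa using (Real.tendsto_exp_neg_atTop_nhds_zero.comp h).const_mul c⁻¹
  have htop : Tendsto (fun s => c⁻¹ * Real.exp (-(c * Real.exp (-s)))) atTop (𝓝 c⁻¹) := by
    have h : Tendsto (fun s : ℝ => -(c * Real.exp (-s))) atTop (𝓝 0) := by
      simpa using (Real.tendsto_exp_neg_atTop_nhds_zero.const_mul c).neg
    simpa using ((Real.continuous_exp.tendsto 0).comp h).const_mul c⁻¹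
  simpa using integral_of_hasDerivAt_of_tendsto hderiv (integrable_exp_neg_mul_exp hc) hbot htop

lemma integrable_exp_mul_exp_neg_exp :
    Integrable fun t : ℝ => Real.exp t * Real.exp (-Real.exp t) := by
  simpa using (integrable_exp_neg_mul_exp one_pos).comp_neg

lemma integral_exp_mul_exp_neg_exp :
    ∫ t : ℝ, Real.exp t * Real.exp (-Real.exp t) = 1 := by
  rw [← integral_neg_eq_self (fun t : ℝ => Real.exp t * Real.exp (-Real.exp t)) volume]
  simpa using integral_exp_neg_mul_exp one_pos

lemma exp_neg_exp_le_one (t : ℝ) : Real.exp (-Real.exp t) ≤ 1 :=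
  Real.exp_le_one_iff.2 (neg_nonpos.2 (Real.exp_pos t).le)

lemma integrable_exp_neg_exp_mul {c : ℝ} (hc : 0 < c) :
    Integrable fun t : ℝ => Real.exp (-Real.exp t) * Real.exp (-(c * Real.exp (-t))) := by
  have hmeas : Continuous fun t : ℝ =>
      Real.exp (-Real.exp t) * Real.exp (-(c * Real.exp (-t))) := by fun_prop
  refine Integrable.mono' (integrable_exp_mul_exp_neg_exp.add (integrable_exp_neg_mul_exp hc))
    hmeas.aestronglyMeasurable (.of_forall fun t => ?_)
  rw [Real.norm_of_nonneg (by positivity), Pi.add_apply]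
  rcases le_total 0 t with ht | ht
  · have hle : Real.exp (-(c * Real.exp (-t))) ≤ Real.exp t :=
      (Real.exp_le_one_iff.2 (neg_nonpos.2 (by positivity))).trans (Real.one_le_exp ht)
    refine le_add_of_le_of_nonneg ?_ (by positivity)
    rw [mul_comm]
    exact mul_le_mul_of_nonneg_right hle (Real.exp_pos _).le
  · have hle : Real.exp (-Real.exp t) ≤ Real.exp (-t) :=
      (exp_neg_exp_le_one t).trans (Real.one_le_exp (neg_nonneg.2 ht))
    exact le_add_of_nonneg_of_le (by positivity)
      (mul_le_mul_of_nonneg_right hle (Real.exp_pos _).le)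

/- The translation `t ↦ t - log (s / 2)` turns `s cosh t` into `exp t + (s² / 4) exp (-t)`, which
is affine in `s²`. -/
lemma besselK0_eq {s : ℝ} (hs : 0 < s) :
    besselK0 s = 1 / 2 * ∫ t : ℝ, Real.exp (-Real.exp t) *
      Real.exp (-(s ^ 2 / 4 * Real.exp (-t))) := by
  have heven : ∫ t : ℝ, Real.exp (-(s * Real.cosh t)) = 2 * besselK0 s := by
    simpa only [Real.cosh_abs, besselK0] using
      integral_comp_abs (f := fun t => Real.exp (-(s * Real.cosh t)))
  have hshift (t : ℝ) : s * Real.cosh (t - Real.log (s / 2)) =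
      Real.exp t + s ^ 2 / 4 * Real.exp (-t) := by
    rw [Real.cosh_eq, neg_sub, Real.exp_sub, Real.exp_sub, Real.exp_log (half_pos hs), Real.exp_neg]
    field_simp
    ring
  have htranslate := integral_sub_right_eq_self (μ := volume)
    (fun t : ℝ => Real.exp (-(s * Real.cosh t))) (Real.log (s / 2))
  simp only [hshift, neg_add, Real.exp_add] at htranslate
  linarith

lemma hasDerivAt_besselK0 {s : ℝ} (hs : 0 < s) :
    HasDerivAt besselK0 (-(s / 4 * ∫ t : ℝ, Real.exp (-Real.exp t) *
      (Real.exp (-t) * Real.exp (-(s ^ 2 / 4 * Real.exp (-t)))))) s := by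
  have hev : besselK0 =ᶠ[𝓝 s] fun s => 1 / 2 * ∫ t : ℝ, Real.exp (-Real.exp t) *
      Real.exp (-(s ^ 2 / 4 * Real.exp (-t))) := by
    filter_upwards [Ioi_mem_nhds hs] with r hr using besselK0_eq hr
  refine HasDerivAt.congr_of_eventuallyEq ?_ hev
  have hd := hasDerivAt_integral_of_dominated_loc_of_deriv_le (μ := volume) (x₀ := s)
    (F := fun r t => Real.exp (-Real.exp t) * Real.exp (-(r ^ 2 / 4 * Real.exp (-t))))
    (F' := fun r t => -(r / 2 * (Real.exp (-Real.exp t) *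
      (Real.exp (-t) * Real.exp (-(r ^ 2 / 4 * Real.exp (-t)))))))
    (bound := fun t => s * (Real.exp (-t) * Real.exp (-(s ^ 2 / 16 * Real.exp (-t)))))
    (s := Set.Ioo (s / 2) (2 * s)) (Ioo_mem_nhds (by linarith) (by linarith))
    (.of_forall fun r => (by fun_prop : Continuous _).aestronglyMeasurable)
    (integrable_exp_neg_exp_mul (by positivity))
    (by fun_prop : Continuous _).aestronglyMeasurable
    (.of_forall fun t r hr => ?bound)
    ((integrable_exp_neg_mul_exp (by positivity)).const_mul _)
    (.of_forall fun t r _ => ?deriv)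
  · convert! hd.2.const_mul (1 / 2 : ℝ) using 1
    rw [integral_neg, integral_const_mul]
    ring
  case bound =>
    have hr0 : 0 < r := by linarith [hr.1]
    rw [norm_neg, Real.norm_of_nonneg (by positivity)]
    calc r / 2 * (Real.exp (-Real.exp t) *
          (Real.exp (-t) * Real.exp (-(r ^ 2 / 4 * Real.exp (-t)))))
        ≤ s * (1 * (Real.exp (-t) * Real.exp (-(s ^ 2 / 16 * Real.exp (-t))))) := by
          gcongr ?_ * (?_ * (_ * Real.exp (-(?_ * _))))
          · linarith [hr.2]
          · exact exp_neg_exp_le_one t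
          · nlinarith [hr.1]
      _ = _ := by ring
  case deriv =>
    have h := ((((hasDerivAt_pow 2 r).div_const 4).mul_const (Real.exp (-t))).fun_neg.exp).const_mul
      (Real.exp (-Real.exp t))
    convert! h using 1
    simp only [Nat.cast_ofNat, Nat.add_one_sub_one, pow_one]
    ring

/-! ### The blob kernel as a superposition of Gaussian vortices -/

/-- The weight of the `t`-th Gaussian vortex in the blob kernel. -/
def blobWeight (t : ℝ) : ℝ := (1 - Real.exp (-Real.exp t)) * Real.exp (-t) / (8 * Real.pi)

/-- The inverse square width of the `t`-th Gaussian vortex in the blob kernel. -/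
def blobRate (α t : ℝ) : ℝ := Real.exp (-t) / (4 * α ^ 2)

/-- The blob kernel as a function of the relative position `x - y`, written as a superposition of
Gaussian vortices. It agrees with `blobKernel` by `blobKernel_eq`. -/
def blobField (α : ℝ) (x : Plane) : Plane :=
  (α ^ 2)⁻¹ • ∫ t : ℝ, blobWeight t • gaussVortex (blobRate α t) x

/-- The blob kernel without the Gaussian vortices narrower than `2α exp (-M / 2)`: a smooth
divergence-free approximation. -/
def blobFieldTrunc (α M : ℝ) (x : Plane) : Plane :=
  (α ^ 2)⁻¹ • ∫ t in Set.Ioi (-M), blobWeight t • gaussVortex (blobRate α t) x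

@[fun_prop]
lemma continuous_blobWeight : Continuous blobWeight := by
  unfold blobWeight; fun_prop

@[fun_prop]
lemma continuous_blobRate (α : ℝ) : Continuous (blobRate α) := by
  unfold blobRate; fun_prop

@[fun_prop]
lemma continuous_gaussVortex_blobRate (α : ℝ) (x : Plane) :
    Continuous fun t => gaussVortex (blobRate α t) x := by
  unfold gaussVortex; fun_prop

lemma continuous_gaussVortexDeriv_blobRate (α : ℝ) (x : Plane) :
    Continuous fun t => gaussVortexDeriv (blobRate α t) x := by
  unfold gaussVortexDeriv
  have hsmulRight : Continuous fun L : Plane →L[ℝ] ℝ => L.smulRight (perp x) :=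
    ((ContinuousLinearMap.smulRightL ℝ Plane Plane).flip (perp x)).continuous
  fun_prop

lemma blobWeight_nonneg (t : ℝ) : 0 ≤ blobWeight t := by
  have : 0 ≤ 1 - Real.exp (-Real.exp t) := sub_nonneg.2 (exp_neg_exp_le_one t)
  unfold blobWeight; positivity

lemma blobWeight_le_exp_div (t : ℝ) : blobWeight t ≤ Real.exp (-t) / (8 * Real.pi) := by
  unfold blobWeight
  gcongr
  exact mul_le_of_le_one_left (Real.exp_pos _).le (by linarith [Real.exp_pos (-Real.exp t)])

lemma blobWeight_le_exp (t : ℝ) : blobWeight t ≤ Real.exp (-t) / 8 := by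
  refine (blobWeight_le_exp_div t).trans ?_
  gcongr
  linarith [Real.pi_gt_three]

lemma blobWeight_le_const (t : ℝ) : blobWeight t ≤ 1 / 8 := by
  have hle : 1 - Real.exp (-Real.exp t) ≤ Real.exp t := by
    linarith [Real.add_one_le_exp (-Real.exp t)]
  have hle_one : (1 - Real.exp (-Real.exp t)) * Real.exp (-t) ≤ 1 := by
    calc (1 - Real.exp (-Real.exp t)) * Real.exp (-t) ≤ Real.exp t * Real.exp (-t) := by gcongr
      _ = 1 := by rw [← Real.exp_add, add_neg_cancel, Real.exp_zero]
  unfold blobWeight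
  gcongr
  linarith [Real.pi_gt_three]

lemma blobRate_pos {α : ℝ} (hα : 0 < α) (t : ℝ) : 0 < blobRate α t := by
  unfold blobRate; positivity

lemma inv_sqrt_blobRate {α : ℝ} (hα : 0 < α) (t : ℝ) :
    (√(blobRate α t))⁻¹ = 2 * α * Real.exp (t / 2) := by
  have hsq : blobRate α t = ((2 * α * Real.exp (t / 2))⁻¹) ^ 2 := by
    rw [blobRate, Real.exp_neg, ← add_halves t, Real.exp_add, add_halves]
    field_simp
    norm_num
  rw [hsq, Real.sqrt_sq (by positivity), inv_inv]

lemma norm_gaussVortex_blobRate_le {α : ℝ} (hα : 0 < α) (t : ℝ) (x : Plane) :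
    ‖gaussVortex (blobRate α t) x‖ ≤ 2 * α * Real.exp (t / 2) :=
  inv_sqrt_blobRate hα t ▸ norm_gaussVortex_le (blobRate_pos hα t) x

lemma norm_blobWeight_smul_le_exp_half {α : ℝ} (hα : 0 < α) (t : ℝ) (x : Plane) :
    ‖blobWeight t • gaussVortex (blobRate α t) x‖ ≤ α * Real.exp (t / 2) := by
  rw [norm_smul, Real.norm_of_nonneg (blobWeight_nonneg t)]
  calc blobWeight t * ‖gaussVortex (blobRate α t) x‖ ≤ 1 / 8 * (2 * α * Real.exp (t / 2)) := by
        gcongr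
        exacts [blobWeight_le_const t, norm_gaussVortex_blobRate_le hα t x]
    _ ≤ α * Real.exp (t / 2) := by linarith [mul_pos hα (Real.exp_pos (t / 2))]

lemma norm_blobWeight_smul_le_exp_neg_half {α : ℝ} (hα : 0 < α) (t : ℝ) (x : Plane) :
    ‖blobWeight t • gaussVortex (blobRate α t) x‖ ≤ α * Real.exp (-(1 / 2) * t) := by
  rw [norm_smul, Real.norm_of_nonneg (blobWeight_nonneg t)]
  calc blobWeight t * ‖gaussVortex (blobRate α t) x‖
      ≤ Real.exp (-t) / 8 * (2 * α * Real.exp (t / 2)) := by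
        gcongr
        exacts [blobWeight_le_exp t, norm_gaussVortex_blobRate_le hα t x]
    _ = 1 / 4 * (α * Real.exp (-(1 / 2) * t)) := by
        rw [show -(1 / 2) * t = -t + t / 2 by ring, Real.exp_add]; ring
    _ ≤ α * Real.exp (-(1 / 2) * t) := by linarith [mul_pos hα (Real.exp_pos (-(1 / 2) * t))]

lemma aestronglyMeasurable_blobWeight_smul (α : ℝ) (x : Plane) (μ : Measure ℝ) :
    AEStronglyMeasurable (fun t => blobWeight t • gaussVortex (blobRate α t) x) μ :=
  (by fun_prop : Continuous _).aestronglyMeasurable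

lemma integrableOn_exp_half_Iic (c : ℝ) :
    IntegrableOn (fun t : ℝ => Real.exp (t / 2)) (Set.Iic c) := by
  simpa [div_eq_inv_mul] using integrableOn_exp_mul_Iic (a := 1 / 2) (by norm_num) c

lemma integral_exp_half_Iic (c : ℝ) :
    ∫ t in Set.Iic c, Real.exp (t / 2) = 2 * Real.exp (c / 2) := by
  have h := integral_exp_mul_Iic (a := 1 / 2) (by norm_num) c
  simp only [one_div, ← div_eq_inv_mul] at h
  rw [h, div_inv_eq_mul, mul_comm]

lemma integrable_blobWeight_smul {α : ℝ} (hα : 0 < α) (x : Plane) :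
    Integrable fun t => blobWeight t • gaussVortex (blobRate α t) x := by
  rw [← integrableOn_univ, ← Set.Iic_union_Ioi (a := (0 : ℝ)), integrableOn_union]
  constructor
  · exact Integrable.mono' ((integrableOn_exp_half_Iic 0).const_mul α)
      (aestronglyMeasurable_blobWeight_smul α x _)
      (.of_forall fun t => norm_blobWeight_smul_le_exp_half hα t x)
  · exact Integrable.mono' ((integrableOn_exp_mul_Ioi (a := -(1 / 2)) (by norm_num) 0).const_mul α)
      (aestronglyMeasurable_blobWeight_smul α x _)
      (.of_forall fun t => norm_blobWeight_smul_le_exp_neg_half hα t x)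

lemma norm_blobFieldTrunc_sub_le {α : ℝ} (hα : 0 < α) (M : ℝ) (x : Plane) :
    ‖blobFieldTrunc α M x - blobField α x‖ ≤ 2 * α⁻¹ * Real.exp (-M / 2) := by
  have hint := integrable_blobWeight_smul hα x
  have htail : ‖∫ t in Set.Iic (-M), blobWeight t • gaussVortex (blobRate α t) x‖ ≤
      α * (2 * Real.exp (-M / 2)) := by
    rw [← integral_exp_half_Iic, ← integral_const_mul]
    exact norm_integral_le_of_norm_le ((integrableOn_exp_half_Iic _).const_mul α)
      (.of_forall fun t => norm_blobWeight_smul_le_exp_half hα t x)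
  rw [blobFieldTrunc, blobField,
    ← intervalIntegral.integral_Iic_add_Ioi (b := -M) hint.integrableOn hint.integrableOn,
    ← smul_sub, sub_add_cancel_right, norm_smul, norm_neg, Real.norm_of_nonneg (by positivity)]
  calc (α ^ 2)⁻¹ * _ ≤ (α ^ 2)⁻¹ * (α * (2 * Real.exp (-M / 2))) := by gcongr
    _ = 2 * α⁻¹ * Real.exp (-M / 2) := by field_simp

lemma norm_blobWeight_smul_sub_le {α : ℝ} (hα : 0 < α) (t : ℝ) (a b : Plane) :
    ‖blobWeight t • gaussVortex (blobRate α t) a - blobWeight t • gaussVortex (blobRate α t) b‖ ≤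
      blobWeight t * (2 * ‖a - b‖) := by
  rw [← smul_sub, norm_smul, Real.norm_of_nonneg (blobWeight_nonneg t)]
  exact mul_le_mul_of_nonneg_left (norm_gaussVortex_sub_le (blobRate_pos hα t).le a b)
    (blobWeight_nonneg t)

/- The vortices with `t ≤ -2N` are narrow and are estimated by their size, the others by their
Lipschitz constant; those with `-2N < t ≤ 0` contribute the factor `N` of `logMod N`. -/
lemma norm_integral_blobWeight_smul_sub_le {α : ℝ} (hα : 0 < α) (N : ℕ) (a b : Plane) :
    ‖∫ t, (blobWeight t • gaussVortex (blobRate α t) a -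
      blobWeight t • gaussVortex (blobRate α t) b)‖ ≤ (1 + 4 * α) * logMod N ‖a - b‖ := by
  set f : ℝ → Plane := fun t => blobWeight t • gaussVortex (blobRate α t) a -
    blobWeight t • gaussVortex (blobRate α t) b
  have hf : Integrable f := (integrable_blobWeight_smul hα a).sub (integrable_blobWeight_smul hα b)
  have hN : -(2 * (N : ℝ)) ≤ 0 := by simp
  have narrow : ‖∫ t in Set.Iic (-(2 * (N : ℝ))), f t‖ ≤ 2 * α * (2 * Real.exp (-N)) := by
    rw [show -(N : ℝ) = -(2 * N) / 2 by ring, ← integral_exp_half_Iic, ← integral_const_mul]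
    refine norm_integral_le_of_norm_le ((integrableOn_exp_half_Iic _).const_mul _)
      (.of_forall fun t => (norm_sub_le _ _).trans ?_)
    linarith [norm_blobWeight_smul_le_exp_half hα t a, norm_blobWeight_smul_le_exp_half hα t b]
  have medium : ‖∫ t in Set.Ioc (-(2 * (N : ℝ))) 0, f t‖ ≤ N * ‖a - b‖ := by
    refine (norm_setIntegral_le_of_norm_le_const (C := 1 / 8 * (2 * ‖a - b‖)) measure_Ioc_lt_top
      fun t _ => (norm_blobWeight_smul_sub_le hα t a b).trans ?_).trans ?_
    · gcongr; exact blobWeight_le_const t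
    · rw [Real.volume_real_Ioc_of_le hN]
      nlinarith [norm_nonneg (a - b), mul_nonneg N.cast_nonneg (norm_nonneg (a - b))]
  have wide : ‖∫ t in Set.Ioi (0 : ℝ), f t‖ ≤ ‖a - b‖ := by
    calc ‖∫ t in Set.Ioi (0 : ℝ), f t‖ ≤ ∫ t in Set.Ioi (0 : ℝ), ‖a - b‖ * Real.exp (-t) := by
          refine norm_integral_le_of_norm_le ((integrableOn_exp_neg_Ioi 0).const_mul _)
            (.of_forall fun t => (norm_blobWeight_smul_sub_le hα t a b).trans ?_)
          nlinarith [blobWeight_le_exp t, Real.exp_pos (-t), norm_nonneg (a - b)]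
      _ = ‖a - b‖ := by rw [integral_const_mul, integral_exp_neg_Ioi_zero, mul_one]
  have hsplit : ∫ t, f t = (∫ t in Set.Iic (-(2 * (N : ℝ))), f t) +
      (∫ t in Set.Ioc (-(2 * (N : ℝ))) 0, f t) + ∫ t in Set.Ioi (0 : ℝ), f t := by
    rw [← setIntegral_union (Set.Iic_disjoint_Ioc le_rfl) measurableSet_Ioc hf.integrableOn
      hf.integrableOn, Set.Iic_union_Ioc_eq_Iic hN,
      intervalIntegral.integral_Iic_add_Ioi hf.integrableOn hf.integrableOn]
  calc ‖∫ t, f t‖ ≤ 2 * α * (2 * Real.exp (-N)) + N * ‖a - b‖ + ‖a - b‖ := by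
        rw [hsplit]
        exact norm_add₃_le.trans (by gcongr)
    _ ≤ (1 + 4 * α) * logMod N ‖a - b‖ := by
        have : 0 ≤ 4 * α * ((N + 1) * ‖a - b‖) := by positivity
        unfold logMod
        linarith [Real.exp_pos (-(N : ℝ))]

lemma logLipschitzWith_blobField {α : ℝ} (hα : 0 < α) :
    LogLipschitzWith ((α ^ 2)⁻¹ * (1 + 4 * α)) (blobField α) where
  nonneg := by positivity
  norm_sub_le N a b := by
    rw [blobField, blobField, ← smul_sub, ← integral_sub (integrable_blobWeight_smul hα a)
      (integrable_blobWeight_smul hα b), norm_smul, Real.norm_of_nonneg (by positivity), mul_assoc]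
    gcongr
    exact norm_integral_blobWeight_smul_sub_le hα N a b

lemma norm_blobWeight_smul_gaussVortexDeriv_le {α : ℝ} (hα : 0 < α) (t : ℝ) (x : Plane) :
    ‖blobWeight t • gaussVortexDeriv (blobRate α t) x‖ ≤ Real.exp (-t) := by
  rw [norm_smul, Real.norm_of_nonneg (blobWeight_nonneg t)]
  calc blobWeight t * ‖gaussVortexDeriv (blobRate α t) x‖ ≤ Real.exp (-t) / 8 * 2 := by
        gcongr
        exacts [blobWeight_le_exp t, norm_gaussVortexDeriv_le (blobRate_pos hα t).le x]
    _ ≤ Real.exp (-t) := by linarith [Real.exp_pos (-t)]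

lemma exists_hasFDerivAt_blobFieldTrunc {α : ℝ} (hα : 0 < α) (M : ℝ) (x : Plane) :
    ∃ A : Plane →L[ℝ] Plane, HasFDerivAt (blobFieldTrunc α M) A x ∧
      ‖A‖ ≤ (α ^ 2)⁻¹ * Real.exp M ∧ planeTrace A = 0 := by
  set μ := volume.restrict (Set.Ioi (-M))
  have hexp : Integrable (fun t : ℝ => Real.exp (-t)) μ := integrableOn_exp_neg_Ioi (-M)
  have hle := norm_blobWeight_smul_gaussVortexDeriv_le hα
  have hmeas : AEStronglyMeasurable (fun t => blobWeight t • gaussVortexDeriv (blobRate α t) x) μ :=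
    (continuous_blobWeight.smul (continuous_gaussVortexDeriv_blobRate α x)).aestronglyMeasurable
  have hint : Integrable (fun t => blobWeight t • gaussVortexDeriv (blobRate α t) x) μ :=
    hexp.mono' hmeas (.of_forall fun t => hle t x)
  have hderiv := hasFDerivAt_integral_of_dominated_of_fderiv_le (μ := μ) (x₀ := x) (s := Set.univ)
    (F := fun y t => blobWeight t • gaussVortex (blobRate α t) y)
    (F' := fun y t => blobWeight t • gaussVortexDeriv (blobRate α t) y) univ_mem
    (.of_forall fun y => aestronglyMeasurable_blobWeight_smul α y _)
    (integrable_blobWeight_smul hα x).integrableOn hmeas (.of_forall fun t y _ => hle t y) hexp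
    (.of_forall fun t y _ => (hasFDerivAt_gaussVortex _ y).fun_const_smul _)
  refine ⟨_, hderiv.const_smul ((α ^ 2)⁻¹), ?_, ?_⟩
  · rw [norm_smul, Real.norm_of_nonneg (by positivity)]
    gcongr
    calc _ ≤ ∫ t in Set.Ioi (-M), Real.exp (-t) :=
          norm_integral_le_of_norm_le hexp (.of_forall fun t => hle t x)
      _ = Real.exp M := by rw [integral_exp_neg_Ioi, neg_neg]
  · rw [map_smul, ← ContinuousLinearMap.integral_comp_comm _ hint]
    simp [planeTrace_gaussVortexDeriv]

/-! ### Comparison of the blob kernel with the Euler kernel -/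

/-- The Euler kernel as a function of the relative position `x - y`, with the junk value `0` at the
origin. It agrees with `eulerKernel` by `eulerKernel_eq`. -/
def eulerField (x : Plane) : Plane := (2 * Real.pi * ‖x‖ ^ 2)⁻¹ • perp x

lemma norm_eulerField (x : Plane) : ‖eulerField x‖ = (2 * Real.pi * ‖x‖)⁻¹ := by
  rw [eulerField, norm_smul, norm_perp, Real.norm_of_nonneg (by positivity)]
  rcases eq_or_ne x 0 with rfl | hx
  · simp
  · have : 0 < ‖x‖ := norm_pos_iff.2 hx
    field_simp

lemma exp_neg_blobRate_mul (α r t : ℝ) : Real.exp (-(blobRate α t * r ^ 2)) =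
    Real.exp (-(r ^ 2 / (4 * α ^ 2) * Real.exp (-t))) := by
  unfold blobRate; congr 1; ring

lemma integrable_exp_smul_gaussVortex {α : ℝ} (hα : 0 < α) {x : Plane} (hx : x ≠ 0) :
    Integrable fun t => (Real.exp (-t) / (8 * Real.pi)) • gaussVortex (blobRate α t) x := by
  have h := ((integrable_exp_neg_mul_exp (c := ‖x‖ ^ 2 / (4 * α ^ 2)) (by positivity)).div_const
    (8 * Real.pi)).smul_const (perp x)
  refine h.congr (.of_forall fun t => ?_)
  simp only [gaussVortex, smul_smul, exp_neg_blobRate_mul]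
  ring_nf

lemma integral_exp_mul_exp_blobRate {α r : ℝ} (hα : 0 < α) (hr : 0 < r) :
    ∫ t, Real.exp (-t) / (8 * Real.pi) * Real.exp (-(blobRate α t * r ^ 2)) =
      α ^ 2 * (2 * Real.pi * r ^ 2)⁻¹ := by
  simp_rw [exp_neg_blobRate_mul, div_eq_inv_mul _ (8 * Real.pi), mul_assoc (8 * Real.pi)⁻¹]
  rw [integral_const_mul, integral_exp_neg_mul_exp (by positivity)]
  field_simp
  norm_num

lemma eulerField_eq_integral {α : ℝ} (hα : 0 < α) {x : Plane} (hx : x ≠ 0) :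
    eulerField x = (α ^ 2)⁻¹ •
      ∫ t, (Real.exp (-t) / (8 * Real.pi)) • gaussVortex (blobRate α t) x := by
  simp only [gaussVortex, smul_smul]
  rw [integral_smul_const, integral_exp_mul_exp_blobRate hα (norm_pos_iff.2 hx), eulerField,
    smul_smul, inv_mul_cancel_left₀ (by positivity)]

lemma norm_integral_smul_gaussVortex_le {α : ℝ} (hα : 0 < α) {x : Plane} (hx : x ≠ 0)
    {w : ℝ → ℝ} (hw : ∀ t, 0 ≤ w t) (hw' : ∀ t, w t ≤ Real.exp (-t) / (8 * Real.pi)) :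
    ‖(α ^ 2)⁻¹ • ∫ t, w t • gaussVortex (blobRate α t) x‖ ≤ ‖eulerField x‖ := by
  have hr : 0 < ‖x‖ := norm_pos_iff.2 hx
  have hnorm (t : ℝ) : ‖(Real.exp (-t) / (8 * Real.pi)) • gaussVortex (blobRate α t) x‖ =
      Real.exp (-t) / (8 * Real.pi) * Real.exp (-(blobRate α t * ‖x‖ ^ 2)) * ‖x‖ := by
    rw [norm_smul, norm_gaussVortex, Real.norm_of_nonneg (by positivity), mul_assoc]
  calc ‖(α ^ 2)⁻¹ • ∫ t, w t • gaussVortex (blobRate α t) x‖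
      = (α ^ 2)⁻¹ * ‖∫ t, w t • gaussVortex (blobRate α t) x‖ := by
        rw [norm_smul, Real.norm_of_nonneg (by positivity)]
    _ ≤ (α ^ 2)⁻¹ * ∫ t, ‖(Real.exp (-t) / (8 * Real.pi)) • gaussVortex (blobRate α t) x‖ := by
        gcongr
        refine norm_integral_le_of_norm_le (integrable_exp_smul_gaussVortex hα hx).norm
          (.of_forall fun t => ?_)
        rw [norm_smul, norm_smul, Real.norm_of_nonneg (hw t), Real.norm_of_nonneg (by positivity)]
        gcongr
        exact hw' t
    _ = (α ^ 2)⁻¹ * (α ^ 2 * (2 * Real.pi * ‖x‖ ^ 2)⁻¹ * ‖x‖) := by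
        simp_rw [hnorm]
        rw [integral_mul_const, integral_exp_mul_exp_blobRate hα hr]
    _ = ‖eulerField x‖ := by rw [norm_eulerField]; field_simp

lemma blobField_zero (α : ℝ) : blobField α 0 = 0 := by simp [blobField, gaussVortex]

lemma norm_blobField_le {α : ℝ} (hα : 0 < α) (x : Plane) : ‖blobField α x‖ ≤ ‖eulerField x‖ := by
  rcases eq_or_ne x 0 with rfl | hx
  · simp [blobField_zero]
  · exact norm_integral_smul_gaussVortex_le hα hx blobWeight_nonneg blobWeight_le_exp_div

lemma eulerField_sub_blobField {α : ℝ} (hα : 0 < α) {x : Plane} (hx : x ≠ 0) :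
    eulerField x - blobField α x = (α ^ 2)⁻¹ • ∫ t,
      (Real.exp (-Real.exp t) * (Real.exp (-t) / (8 * Real.pi))) •
        gaussVortex (blobRate α t) x := by
  rw [eulerField_eq_integral hα hx, blobField, ← smul_sub,
    ← integral_sub (integrable_exp_smul_gaussVortex hα hx) (integrable_blobWeight_smul hα x)]
  congr 2
  funext t
  rw [← sub_smul, blobWeight]
  congr 1
  ring

lemma norm_eulerField_sub_blobField_le {α : ℝ} (hα : 0 < α) {x : Plane} (hx : x ≠ 0) :
    ‖eulerField x - blobField α x‖ ≤ ‖eulerField x‖ := by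
  rw [eulerField_sub_blobField hα hx]
  exact norm_integral_smul_gaussVortex_le hα hx (fun t => by positivity) fun t =>
    mul_le_of_le_one_left (by positivity) (exp_neg_exp_le_one t)

lemma exp_neg_blobRate_mul_le {α r : ℝ} (hα : 0 < α) (hr : 0 < r) (t : ℝ) :
    Real.exp (-(blobRate α t * r ^ 2)) ≤ 32 * α ^ 4 * Real.exp t ^ 2 / r ^ 4 := by
  have hpos : 0 < blobRate α t * r ^ 2 := mul_pos (blobRate_pos hα t) (by positivity)
  have hone : (32 * α ^ 4 * Real.exp t ^ 2 / r ^ 4) * ((blobRate α t * r ^ 2) ^ 2 / 2) = 1 := by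
    rw [blobRate, Real.exp_neg]
    field_simp
    norm_num
  rw [Real.exp_neg, inv_le_iff_one_le_mul₀ (Real.exp_pos _), ← hone]
  gcongr
  linarith [Real.quadratic_le_exp_of_nonneg hpos.le]

lemma norm_eulerField_sub_blobField_le_inv_cube {α : ℝ} (hα : 0 < α) {x : Plane} (hx : x ≠ 0) :
    ‖eulerField x - blobField α x‖ ≤ 4 * α ^ 2 / ‖x‖ ^ 3 := by
  have hr : 0 < ‖x‖ := norm_pos_iff.2 hx
  have pointwise (t : ℝ) : ‖(Real.exp (-Real.exp t) * (Real.exp (-t) / (8 * Real.pi))) •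
      gaussVortex (blobRate α t) x‖ ≤
        4 * α ^ 4 / ‖x‖ ^ 3 * (Real.exp t * Real.exp (-Real.exp t)) := by
    rw [norm_smul, norm_gaussVortex, Real.norm_of_nonneg (by positivity)]
    calc Real.exp (-Real.exp t) * (Real.exp (-t) / (8 * Real.pi)) *
          (Real.exp (-(blobRate α t * ‖x‖ ^ 2)) * ‖x‖)
        ≤ Real.exp (-Real.exp t) * (Real.exp (-t) / 8) *
          (32 * α ^ 4 * Real.exp t ^ 2 / ‖x‖ ^ 4 * ‖x‖) := by
          gcongr
          · linarith [Real.pi_gt_three]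
          · exact exp_neg_blobRate_mul_le hα hr t
      _ = 4 * α ^ 4 / ‖x‖ ^ 3 * (Real.exp t * Real.exp (-Real.exp t)) := by
          rw [Real.exp_neg t]
          field_simp
          norm_num
  have hint := norm_integral_le_of_norm_le (integrable_exp_mul_exp_neg_exp.const_mul _)
    (.of_forall pointwise)
  rw [integral_const_mul, integral_exp_mul_exp_neg_exp, mul_one] at hint
  rw [eulerField_sub_blobField hα hx, norm_smul, Real.norm_of_nonneg (by positivity)]
  calc _ ≤ (α ^ 2)⁻¹ * (4 * α ^ 4 / ‖x‖ ^ 3) := by gcongr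
    _ = 4 * α ^ 2 / ‖x‖ ^ 3 := by field_simp

lemma eulerField_eq_smul_perp_inversion (x : Plane) :
    eulerField x = (2 * Real.pi)⁻¹ • perp (EuclideanGeometry.inversion 0 1 x) := by
  simp only [eulerField, EuclideanGeometry.inversion, dist_zero_right, vsub_eq_sub, sub_zero,
    vadd_eq_add, add_zero, map_smul, smul_smul]
  congr 1
  ring

lemma norm_eulerField_sub {a b : Plane} (ha : a ≠ 0) (hb : b ≠ 0) :
    ‖eulerField a - eulerField b‖ = ‖a - b‖ / (2 * Real.pi * (‖a‖ * ‖b‖)) := by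
  have hinv := EuclideanGeometry.dist_inversion_inversion ha hb 1
  rw [dist_eq_norm, dist_zero_right, dist_zero_right, dist_eq_norm, one_pow] at hinv
  rw [eulerField_eq_smul_perp_inversion, eulerField_eq_smul_perp_inversion, ← smul_sub, ← map_sub,
    norm_smul, norm_perp, hinv, Real.norm_of_nonneg (by positivity)]
  field_simp

/-! ### Identification of the kernels -/

lemma perpGrad_of_hasFDerivAt {f : Plane → ℝ} {a : ℝ} {v x : Plane}
    (h : HasFDerivAt f (a • innerSL ℝ v) x) : perpGrad f x = a • perp v := by
  rw [perpGrad, h.fderiv]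
  ext i
  fin_cases i <;>
    simp [perp_apply_zero, perp_apply_one, EuclideanSpace.inner_single_right]

lemma fderiv_eq_zero_of_symm {E F : Type*} [NormedAddCommGroup E] [NormedSpace ℝ E]
    [NormedAddCommGroup F] [NormedSpace ℝ F] {f : E → F} {y : E}
    (hsymm : ∀ v, f (y + v) = f (y - v)) : fderiv ℝ f y = 0 := by
  by_cases hf : DifferentiableAt ℝ f y
  · have hreflect : HasFDerivAt (fun z => f (y + (y - z))) (-fderiv ℝ f y) y := by
      have hinner : HasFDerivAt (fun z : E => y + (y - z)) (-ContinuousLinearMap.id ℝ E) y := by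
        simpa using ((hasFDerivAt_id y).const_sub y).const_add y
      have houter : HasFDerivAt f (fderiv ℝ f y) (y + (y - y)) := by simpa using hf.hasFDerivAt
      simpa [Function.comp_def] using houter.comp y hinner
    have heq : (fun z => f (y + (y - z))) = f := by
      funext z; rw [hsymm, sub_sub_cancel]
    rw [heq] at hreflect
    have htwo : (2 : ℝ) • fderiv ℝ f y = 0 := by
      rw [two_smul, add_eq_zero_iff_eq_neg]
      exact hf.hasFDerivAt.unique hreflect
    exact (smul_eq_zero.1 htwo).resolve_left two_ne_zero
  · exact fderiv_zero_of_not_differentiableAt hf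

lemma perpGrad_radial_self (g : ℝ → ℝ) (y : Plane) :
    perpGrad (fun z => g ‖z - y‖) y = 0 := by
  rw [perpGrad, fderiv_eq_zero_of_symm (f := fun z => g ‖z - y‖) (y := y) (fun v => by simp)]
  ext i
  fin_cases i <;> simp

lemma hasFDerivAt_norm_sub {x y : Plane} (hxy : x - y ≠ 0) :
    HasFDerivAt (fun z : Plane => ‖z - y‖) (‖x - y‖⁻¹ • innerSL ℝ (x - y)) x := by
  have hsq := ((hasFDerivAt_id x).sub_const y).norm_sq
  have hsqrt := hsq.sqrt (by positivity)
  simp only [Real.sqrt_sq (norm_nonneg _)] at hsqrt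
  convert! hsqrt using 1
  ext v
  simp only [one_div, mul_inv_rev, nsmul_eq_mul, Nat.cast_ofNat, ContinuousLinearMap.comp_id,
    map_sub, _root_.smul_apply, _root_.sub_apply, coe_innerSL_apply,
    smul_eq_mul, id_eq]
  field_simp

lemma perpGrad_radial {g : ℝ → ℝ} {g' : ℝ} {x y : Plane} (hxy : x - y ≠ 0)
    (hg : HasDerivAt g g' ‖x - y‖) :
    perpGrad (fun z => g ‖z - y‖) x = (g' / ‖x - y‖) • perp (x - y) := by
  have h := hg.comp_hasFDerivAt x (hasFDerivAt_norm_sub hxy)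
  rw [smul_smul, ← div_eq_mul_inv] at h
  exact perpGrad_of_hasFDerivAt h

lemma eulerKernel_eq (x y : Plane) : eulerKernel x y = eulerField (x - y) := by
  rcases eq_or_ne x y with rfl | hxy
  · rw [eulerKernel, perpGrad_radial_self (fun r => 1 / (2 * Real.pi) * Real.log r)]
    simp [eulerField]
  · have hr : 0 < ‖x - y‖ := norm_pos_iff.2 (sub_ne_zero.2 hxy)
    rw [eulerKernel, perpGrad_radial (g := fun r => 1 / (2 * Real.pi) * Real.log r)
      (sub_ne_zero.2 hxy) ((Real.hasDerivAt_log hr.ne').const_mul _), eulerField]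
    congr 1
    field_simp

/-- The integral appearing in the derivative of the Bessel function and in the difference of the
two kernels. -/
def besselIntegral (s : ℝ) : ℝ :=
  ∫ t : ℝ, Real.exp (-Real.exp t) * (Real.exp (-t) * Real.exp (-(s ^ 2 / 4 * Real.exp (-t))))

lemma hasDerivAt_blobGreen {α r : ℝ} (hα : 0 < α) (hr : 0 < r) :
    HasDerivAt (blobGreen α)
      (1 / (2 * Real.pi) * (-(r / α / 4 * besselIntegral (r / α)) * (1 / α) + r⁻¹)) r :=
  (((hasDerivAt_besselK0 (div_pos hr hα)).comp r ((hasDerivAt_id r).div_const α)).add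
    (Real.hasDerivAt_log hr.ne')).const_mul _

lemma eulerField_sub_blobField_eq_smul_perp {α : ℝ} (hα : 0 < α) {x : Plane} (hx : x ≠ 0) :
    eulerField x - blobField α x =
      ((α ^ 2)⁻¹ * ((8 * Real.pi)⁻¹ * besselIntegral (‖x‖ / α))) • perp x := by
  rw [eulerField_sub_blobField hα hx, besselIntegral, ← integral_const_mul, mul_smul,
    ← integral_smul_const]
  congr 2
  funext t
  rw [gaussVortex, smul_smul, exp_neg_blobRate_mul]
  ring_nf

lemma blobKernel_eq {α : ℝ} (hα : 0 < α) (x y : Plane) :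
    blobKernel α x y = blobField α (x - y) := by
  rcases eq_or_ne x y with rfl | hxy
  · rw [blobKernel, perpGrad_radial_self (blobGreen α), sub_self, blobField_zero]
  have hz : x - y ≠ 0 := sub_ne_zero.2 hxy
  have hr : 0 < ‖x - y‖ := norm_pos_iff.2 hz
  rw [blobKernel, perpGrad_radial hz (hasDerivAt_blobGreen hα hr),
    ← sub_sub_cancel (eulerField (x - y)) (blobField α (x - y)),
    eulerField_sub_blobField_eq_smul_perp hα hz, eulerField, ← sub_smul]
  congr 1
  field_simp
  ring

/-! ### Integration against signed measures -/

section SignedMeasure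

open ContinuousLinearMap VectorMeasure

variable {Λ : Type*} [MeasurableSpace Λ]

instance isFiniteMeasure_variation (q : SignedMeasure Λ) : IsFiniteMeasure q.variation := by
  rw [← q.totalVariation_eq_variation]
  infer_instance

/-- The density `dq / d|q|` of a signed measure with respect to its total variation. -/
def polarSign (q : SignedMeasure Λ) : Λ → ℝ := q.rnDeriv q.variation

lemma measurable_polarSign (q : SignedMeasure Λ) : Measurable (polarSign q) :=
  q.measurable_rnDeriv q.variation

lemma withDensityᵥ_polarSign (q : SignedMeasure Λ) :
    q.variation.withDensityᵥ (polarSign q) = q :=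
  q.withDensityᵥ_rnDeriv_eq _ <| AbsolutelyContinuous.mk fun s hs hqs => by
    rw [Measure.toENNRealVectorMeasure_apply_measurable hs] at hqs
    simpa [hqs] using q.enorm_measure_le_variation s

lemma abs_polarSign (q : SignedMeasure Λ) : ∀ᵐ y ∂q.variation, |polarSign q y| = 1 := by
  have hdens : q.variation = q.variation.withDensity fun y => ‖polarSign q y‖ₑ := by
    conv_lhs => rw [← withDensityᵥ_polarSign q]
    exact Measure.variation_withDensityᵥ (SignedMeasure.integrable_rnDeriv q _)
  have hone : q.variation.withDensity (fun y => ‖polarSign q y‖ₑ) = q.variation.withDensity 1 := by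
    rw [← hdens, withDensity_one]
  filter_upwards [(withDensity_eq_iff_of_sigmaFinite
    (measurable_polarSign q).enorm.aemeasurable aemeasurable_const).1 hone] with y hy
  rw [← Real.norm_eq_abs, ← toReal_enorm, hy]
  rfl

variable {E : Type*} [NormedAddCommGroup E] [NormedSpace ℝ E]

lemma norm_vectorIntegral_le (q : SignedMeasure Λ) (f : Λ → E) :
    ‖∫ᵛ y, f y ∂<•q‖ ≤ ∫ y, ‖f y‖ ∂q.variation :=
  norm_integral_le_integral_norm.trans <| mul_le_of_le_one_left (by positivity) <|
    (opNorm_flip _).trans_le opNorm_lsmul_le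

lemma norm_vectorIntegral_le_of_norm_le {q : SignedMeasure Λ} {f : Λ → E} {c : ℝ}
    (hf : ∀ y, ‖f y‖ ≤ c) : ‖∫ᵛ y, f y ∂<•q‖ ≤ c * q.variation.real Set.univ :=
  calc ‖∫ᵛ y, f y ∂<•q‖ ≤ ∫ y, ‖f y‖ ∂q.variation := norm_vectorIntegral_le q f
    _ ≤ ‖∫ y, ‖f y‖ ∂q.variation‖ := Real.le_norm_self _
    _ ≤ c * q.variation.real Set.univ :=
      norm_integral_le_of_norm_le_const (.of_forall fun y => by simpa using hf y)

lemma vectorIntegral_lsmul_eq_flip (q : SignedMeasure Λ) (f : Λ → ℝ) :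
    ∫ᵛ y, f y ∂•q = ∫ᵛ y, f y ∂<•q := by
  congr 1
  ext
  simp

lemma vectorIntegral_withDensityᵥ {μ : Measure Λ} {g : Λ → ℝ} {f : Λ → E} (hg : Integrable g μ)
    (hf : AEStronglyMeasurable f μ) (hgf : Integrable (fun y => g y • f y) μ) :
    ∫ᵛ y, f y ∂<•μ.withDensityᵥ g = ∫ y, g y • f y ∂μ := by
  have hmeas : ∀ {h : Λ → ℝ}, Integrable h μ → AEMeasurable (fun y => ENNReal.ofReal (h y)) μ :=
    fun hh => hh.aemeasurable.ennreal_ofReal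
  have hpart : ∀ {h : Λ → ℝ}, Integrable h μ → (∀ y, |h y| ≤ |g y|) →
      Integrable (fun y => (ENNReal.ofReal (h y)).toReal • f y) μ := fun {h} hh hle =>
    hgf.mono ((hmeas hh).ennreal_toReal.aestronglyMeasurable.smul hf) <| .of_forall fun y => by
      rw [norm_smul, norm_smul, ENNReal.toReal_ofReal']
      gcongr
      exact (abs_max_le_max_abs_abs.trans (by simp)).trans (hle y)
  have hpos := hpart hg fun y => le_rfl
  have hg' : Integrable (fun y => -g y) μ := hg.neg
  have hneg := hpart hg' fun y => (abs_neg (g y)).le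
  have hfin : ∀ h : Λ → ℝ, ∀ᵐ y ∂μ, ENNReal.ofReal (h y) < ⊤ :=
    fun h => .of_forall fun y => ENNReal.ofReal_lt_top
  have := isFiniteMeasure_withDensity_ofReal hg.2
  have := isFiniteMeasure_withDensity_ofReal hg'.2
  rw [withDensityᵥ_eq_withDensity_pos_part_sub_withDensity_neg_part hg,
    integral_sub_vectorMeasure, integral_toSignedMeasure, integral_toSignedMeasure,
    integral_withDensity_eq_integral_toReal_smul₀ (hmeas hg) (hfin g),
    integral_withDensity_eq_integral_toReal_smul₀ (hmeas hg') (hfin _),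
    ← integral_sub hpos hneg]
  · congr 1 with y
    simp only [ENNReal.toReal_ofReal', ← sub_smul]
    rw [max_zero_sub_max_neg_zero_eq_self]
  · rw [VectorMeasure.Integrable, Measure.variation_toSignedMeasure]
    exact (integrable_withDensity_iff_integrable_smul₀' (hmeas hg) (hfin g)).2 hpos
  · rw [VectorMeasure.Integrable, Measure.variation_toSignedMeasure]
    exact (integrable_withDensity_iff_integrable_smul₀' (hmeas hg') (hfin _)).2 hneg

lemma integrable_polarSign_smul (q : SignedMeasure Λ) {f : Λ → E}
    (hf : Integrable f q.variation) :
    Integrable (fun y => polarSign q y • f y) q.variation := by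
  refine hf.bdd_smul 1 (measurable_polarSign q).aestronglyMeasurable ?_
  filter_upwards [abs_polarSign q] with y hy using hy.le

lemma vectorIntegral_eq_integral_polarSign_smul (q : SignedMeasure Λ) {f : Λ → E}
    (hf : Integrable f q.variation) :
    ∫ᵛ y, f y ∂<•q = ∫ y, polarSign q y • f y ∂q.variation := by
  conv_lhs => rw [← withDensityᵥ_polarSign q]
  exact vectorIntegral_withDensityᵥ (SignedMeasure.integrable_rnDeriv q _) hf.1
    (integrable_polarSign_smul q hf)

end SignedMeasure

/-! ### The Lagrangian vector field -/

section LagrangianField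

variable {E : Type*} [NormedAddCommGroup E]

/-- The map `x ↦ x + X x` with bounded displacement `X`. The differential equations for flow maps
are solved in the Banach space of displacements. -/
def dispMap (X : E →ᵇ E) : C(E, E) := ⟨fun x => x + X x, by fun_prop⟩

@[simp]
lemma dispMap_apply (X : E →ᵇ E) (x : E) : dispMap X x = x + X x := rfl

lemma norm_dispMap_sub_sub_le (X Y : E →ᵇ E) (x y : E) :
    ‖dispMap X x - dispMap X y - (dispMap Y x - dispMap Y y)‖ ≤ 2 * ‖X - Y‖ := by
  have hxy : dispMap X x - dispMap X y - (dispMap Y x - dispMap Y y) =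
      (X - Y) x - (X - Y) y := by
    simp only [dispMap_apply, BoundedContinuousFunction.sub_apply]; abel
  rw [hxy, two_mul]
  exact norm_sub_le_of_le ((X - Y).norm_coe_le_norm x) ((X - Y).norm_coe_le_norm y)

variable [SecondCountableTopology E] {Λ : Type*} [TopologicalSpace Λ] [MeasurableSpace Λ]
  [OpensMeasurableSpace Λ]

lemma integrable_kernel_sub (k : E →ᵇ E) (q : SignedMeasure Λ) (z : C(Λ, E)) (p : E) :
    Integrable (fun y => k (p - z y)) q.variation :=
  Integrable.of_bound (by fun_prop : Continuous fun y => k (p - z y)).aestronglyMeasurable ‖k‖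
    (.of_forall fun _ => k.norm_coe_le_norm _)

variable [NormedSpace ℝ E]

lemma continuous_vectorIntegral_kernel_sub (k : E →ᵇ E) (q : SignedMeasure Λ) (z : C(Λ, E)) :
    Continuous fun p : E => ∫ᵛ y, k (p - z y) ∂<•q :=
  VectorMeasure.continuous_of_dominated (bound := fun _ => ‖k‖)
    (fun p => (integrable_kernel_sub k q z p).aestronglyMeasurable)
    (fun _ => .of_forall fun _ => k.norm_coe_le_norm _) (integrable_const _)
    (.of_forall fun _ => by fun_prop)

/-- The velocity field, in Lagrangian coordinates, induced through the kernel `k` by the vorticity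
`q` on a space of labels `Λ`: the particle `x` sits at `x + X x`, and the vorticity carried by the
label `y` sits at the position of the particle `g y`. -/
def lagrangianField (k : E →ᵇ E) (q : SignedMeasure Λ) (g : C(Λ, E)) (X : E →ᵇ E) : E →ᵇ E :=
  BoundedContinuousFunction.ofNormedAddCommGroup
    (fun x => ∫ᵛ y, k (dispMap X x - dispMap X (g y)) ∂<•q)
    ((continuous_vectorIntegral_kernel_sub k q ((dispMap X).comp g)).comp (dispMap X).continuous)
    (‖k‖ * q.variation.real Set.univ)
    (fun _ => norm_vectorIntegral_le_of_norm_le fun _ => k.norm_coe_le_norm _)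

variable {k k' : E →ᵇ E} {q : SignedMeasure Λ} {g : C(Λ, E)}

lemma lagrangianField_apply (X : E →ᵇ E) (x : E) :
    lagrangianField k q g X x = ∫ᵛ y, k (dispMap X x - dispMap X (g y)) ∂<•q := rfl

lemma norm_lagrangianField_le (X : E →ᵇ E) :
    ‖lagrangianField k q g X‖ ≤ ‖k‖ * q.variation.real Set.univ :=
  BoundedContinuousFunction.norm_ofNormedAddCommGroup_le _ (by positivity) _

lemma norm_lagrangianField_sub_le {X Y : E →ᵇ E} {c : ℝ} (hc : 0 ≤ c)
    (h : ∀ x y, ‖k (dispMap X x - dispMap X y) - k' (dispMap Y x - dispMap Y y)‖ ≤ c) :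
    ‖lagrangianField k q g X - lagrangianField k' q g Y‖ ≤ c * q.variation.real Set.univ := by
  refine (BoundedContinuousFunction.norm_le (by positivity)).2 fun x => ?_
  calc ‖(lagrangianField k q g X - lagrangianField k' q g Y) x‖
      = ‖∫ᵛ y, (k (dispMap X x - dispMap X (g y)) -
          k' (dispMap Y x - dispMap Y (g y))) ∂<•q‖ :=
        congrArg norm (VectorMeasure.integral_fun_sub
          (integrable_kernel_sub k q ((dispMap X).comp g) _)
          (integrable_kernel_sub k' q ((dispMap Y).comp g) _)).symm
    _ ≤ c * q.variation.real Set.univ := norm_vectorIntegral_le_of_norm_le fun y => h x (g y)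

lemma norm_lagrangianField_sub_kernel_le (k k' : E →ᵇ E) (q : SignedMeasure Λ) (g : C(Λ, E))
    (X : E →ᵇ E) :
    ‖lagrangianField k q g X - lagrangianField k' q g X‖ ≤
      ‖k - k'‖ * q.variation.real Set.univ :=
  norm_lagrangianField_sub_le (norm_nonneg _) fun _ _ => (k - k').norm_coe_le_norm _

lemma logLipschitzWith_lagrangianField {C : ℝ} (hk : LogLipschitzWith C k) (q : SignedMeasure Λ)
    (g : C(Λ, E)) :
    LogLipschitzWith (2 * C * q.variation.real Set.univ) (lagrangianField k q g) where
  nonneg := by have := hk.nonneg; positivity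
  norm_sub_le N X Y := by
    have hC := hk.nonneg
    have hmod := logMod_nonneg N (norm_nonneg (X - Y))
    calc ‖lagrangianField k q g X - lagrangianField k q g Y‖
        ≤ C * (2 * logMod N ‖X - Y‖) * q.variation.real Set.univ := by
          refine norm_lagrangianField_sub_le (by positivity) fun x y =>
            (hk.norm_sub_le N _ _).trans ?_
          gcongr
          exact (logMod_mono N (norm_dispMap_sub_sub_le X Y x y)).trans
            (logMod_mul_le N one_le_two)
      _ = 2 * C * q.variation.real Set.univ * logMod N ‖X - Y‖ := by ring

lemma lipschitzWith_lagrangianField {L : ℝ} (hL : 0 ≤ L)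
    (hk : ∀ a b, ‖k a - k b‖ ≤ L * ‖a - b‖) (q : SignedMeasure Λ) (g : C(Λ, E)) :
    LipschitzWith (2 * L * q.variation.real Set.univ).toNNReal (lagrangianField k q g) := by
  refine LipschitzWith.of_dist_le_mul fun X Y => ?_
  rw [dist_eq_norm, dist_eq_norm, Real.coe_toNNReal _ (by positivity)]
  calc ‖lagrangianField k q g X - lagrangianField k q g Y‖
      ≤ L * (2 * ‖X - Y‖) * q.variation.real Set.univ :=
        norm_lagrangianField_sub_le (by positivity) fun x y =>
          (hk _ _).trans (by gcongr; exact norm_dispMap_sub_sub_le X Y x y)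
    _ = 2 * L * q.variation.real Set.univ * ‖X - Y‖ := by ring

end LagrangianField

/-! ### Volume of images under divergence-free flows -/

/-- A differentiable vector field of the plane with divergence zero whose derivative is bounded by
`L`. -/
structure DivergenceFreeWith (L : ℝ) (u : Plane → Plane) : Prop where
  differentiable : Differentiable ℝ u
  norm_fderiv_le : ∀ x, ‖fderiv ℝ u x‖ ≤ L
  planeTrace_fderiv : ∀ x, planeTrace (fderiv ℝ u x) = 0

section DivergenceFree

variable {L : ℝ} {u : Plane → Plane}

lemma DivergenceFreeWith.nonneg (hu : DivergenceFreeWith L u) : 0 ≤ L :=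
  (norm_nonneg _).trans (hu.norm_fderiv_le 0)

lemma DivergenceFreeWith.norm_sub_le (hu : DivergenceFreeWith L u) (a b : Plane) :
    ‖u a - u b‖ ≤ L * ‖a - b‖ :=
  convex_univ.norm_image_sub_le_of_norm_fderiv_le (fun x _ => hu.differentiable x)
    (fun x _ => hu.norm_fderiv_le x) (Set.mem_univ b) (Set.mem_univ a)

lemma DivergenceFreeWith.injective_add_smul (hu : DivergenceFreeWith L u) {s : ℝ}
    (hs : |s| * L < 1) : Function.Injective fun x => x + s • u x := by
  have hsu : LipschitzWith (|s| * L).toNNReal fun x => s • u x :=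
    LipschitzWith.of_dist_le_mul fun x y => by
      rw [dist_eq_norm, dist_eq_norm, ← smul_sub, norm_smul, Real.norm_eq_abs,
        Real.coe_toNNReal _ (mul_nonneg (abs_nonneg s) hu.nonneg), mul_assoc]
      gcongr
      exact hu.norm_sub_le x y
  exact (AntilipschitzWith.id.add_lipschitzWith hsu (by simpa using hs)).injective

lemma det_id_add_smul {A : Plane →L[ℝ] Plane} (hA : planeTrace A = 0) (s : ℝ) :
    (ContinuousLinearMap.id ℝ Plane + s • A).det = 1 + s ^ 2 *
      (A (EuclideanSpace.single 0 1) 0 * A (EuclideanSpace.single 1 1) 1 -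
        A (EuclideanSpace.single 1 1) 0 * A (EuclideanSpace.single 0 1) 1) := by
  rw [planeTrace_apply] at hA
  rw [ContinuousLinearMap.det, ← LinearMap.det_toMatrix (EuclideanSpace.basisFun (Fin 2) ℝ).toBasis,
    Matrix.det_fin_two]
  simp only [ContinuousLinearMap.toLinearMap_add, ContinuousLinearMap.coe_id,
    ContinuousLinearMap.toLinearMap_smul, LinearMap.toMatrix_apply, OrthonormalBasis.coe_toBasis,
    EuclideanSpace.basisFun_apply, LinearMap.add_apply, LinearMap.id_coe, id_eq,
    LinearMap.smul_apply, ContinuousLinearMap.coe_coe, map_add, map_smul, Finsupp.coe_add,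
    Finsupp.coe_smul, Pi.add_apply, OrthonormalBasis.coe_toBasis_repr_apply,
    EuclideanSpace.basisFun_repr, PiLp.single_eq_same, Pi.smul_apply, smul_eq_mul, ne_eq,
    zero_ne_one, not_false_eq_true, PiLp.single_eq_of_ne, zero_add, one_ne_zero]
  linear_combination s * hA

lemma abs_apply_single_le (A : Plane →L[ℝ] Plane) (i j : Fin 2) :
    |A (EuclideanSpace.single i 1) j| ≤ ‖A‖ :=
  (PiLp.norm_apply_le (A (EuclideanSpace.single i 1)) j).trans <|
    A.unit_le_opNorm _ (by simp)

lemma one_sub_le_abs_det_id_add_smul {A : Plane →L[ℝ] Plane} (hA : planeTrace A = 0)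
    (hL : ‖A‖ ≤ L) (s : ℝ) :
    1 - 2 * (s * L) ^ 2 ≤ |(ContinuousLinearMap.id ℝ Plane + s • A).det| := by
  have hentry : ∀ i j i' j' : Fin 2,
      |A (EuclideanSpace.single i 1) j * A (EuclideanSpace.single i' 1) j'| ≤ L ^ 2 := by
    intro i j i' j'
    rw [abs_mul, sq]
    exact mul_le_mul ((abs_apply_single_le A i j).trans hL) ((abs_apply_single_le A i' j').trans hL)
      (abs_nonneg _) ((norm_nonneg _).trans hL)
  have hdiag := abs_le.1 (hentry 0 0 1 1)
  have hanti := abs_le.1 (hentry 1 0 0 1)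
  rw [det_id_add_smul hA]
  refine le_trans ?_ (le_abs_self _)
  nlinarith [sq_nonneg s]

lemma DivergenceFreeWith.volume_image_add_smul_ge (hu : DivergenceFreeWith L u) {s : ℝ}
    (hs : |s| * L < 1) {A : Set Plane} (hA : MeasurableSet A) :
    ENNReal.ofReal (1 - 2 * (s * L) ^ 2) * volume A ≤ volume ((fun x => x + s • u x) '' A) := by
  have hderiv : ∀ x, HasFDerivAt (fun x => x + s • u x)
      (ContinuousLinearMap.id ℝ Plane + s • fderiv ℝ u x) x :=
    fun x => (hasFDerivAt_id x).fun_add ((hu.differentiable x).hasFDerivAt.fun_const_smul s)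
  rw [← lintegral_abs_det_fderiv_eq_addHaar_image volume hA
    (fun x _ => (hderiv x).hasFDerivWithinAt) (hu.injective_add_smul hs).injOn,
    ← setLIntegral_const]
  exact lintegral_mono fun x => ENNReal.ofReal_le_ofReal <|
    one_sub_le_abs_det_id_add_smul (hu.planeTrace_fderiv x) (hu.norm_fderiv_le x) s

lemma volume_le_volume_image_of_tendsto {Y : ℕ → Plane →ᵇ Plane} {X : Plane →ᵇ Plane}
    (hY : Tendsto Y atTop (𝓝 X)) {c : ℕ → ℝ} (hc : Tendsto c atTop (𝓝 1)) {A : Set Plane}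
    (hA : IsCompact A)
    (h : ∀ᶠ n in atTop, ENNReal.ofReal (c n) * volume A ≤ volume (dispMap (Y n) '' A)) :
    volume A ≤ volume (dispMap X '' A) := by
  have hleft : Tendsto (fun n => ENNReal.ofReal (c n) * volume A) atTop (𝓝 (volume A)) := by
    simpa using ENNReal.Tendsto.mul_const (b := volume A) (ENNReal.tendsto_ofReal hc)
      (Or.inr hA.measure_lt_top.ne)
  have hright := (tendsto_measure_cthickening_of_isCompact (μ := volume)
    (hA.image (dispMap X).continuous)).comp (tendsto_iff_norm_sub_tendsto_zero.1 hY)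
  refine le_of_tendsto_of_tendsto hleft hright ?_
  filter_upwards [h] with n hn
  refine hn.trans (measure_mono ?_)
  rintro _ ⟨x, hx, rfl⟩
  refine Metric.mem_cthickening_of_dist_le _ (dispMap X x) _ _ ⟨x, hx, rfl⟩ ?_
  rw [dist_eq_norm, dispMap_apply, dispMap_apply, add_sub_add_left_eq_sub]
  exact (Y n - X).norm_coe_le_norm x

end DivergenceFree

section DivergenceFreeKernel

variable {Λ : Type*} [TopologicalSpace Λ] [MeasurableSpace Λ] [OpensMeasurableSpace Λ]
  {k : Plane →ᵇ Plane} {L : ℝ}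

lemma DivergenceFreeWith.integrable_fderiv_sub (hk : DivergenceFreeWith L k)
    (q : SignedMeasure Λ) (z : C(Λ, Plane)) (p : Plane) :
    Integrable (fun y => fderiv ℝ k (p - z y)) q.variation :=
  Integrable.of_bound
    ((measurable_fderiv ℝ k).comp
      (by fun_prop : Continuous fun y => p - z y).measurable).aestronglyMeasurable
    L (.of_forall fun _ => hk.norm_fderiv_le _)

lemma DivergenceFreeWith.hasFDerivAt_vectorIntegral (hk : DivergenceFreeWith L k)
    (q : SignedMeasure Λ) (z : C(Λ, Plane)) (p : Plane) :
    HasFDerivAt (fun p => ∫ᵛ y, k (p - z y) ∂<•q) (∫ᵛ y, fderiv ℝ k (p - z y) ∂<•q) p := by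
  simp_rw [vectorIntegral_eq_integral_polarSign_smul q (integrable_kernel_sub k q z _),
    vectorIntegral_eq_integral_polarSign_smul q (hk.integrable_fderiv_sub q z p)]
  have hint := fun p => integrable_polarSign_smul q (integrable_kernel_sub k q z p)
  have hderiv : ∀ (y : Λ) (p : Plane), HasFDerivAt (fun p => polarSign q y • k (p - z y))
      (polarSign q y • fderiv ℝ k (p - z y)) p := fun y p =>
    ((hasFDerivAt_comp_sub (z y)).2 (hk.differentiable (p - z y)).hasFDerivAt).fun_const_smul _
  refine hasFDerivAt_integral_of_dominated_of_fderiv_le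
    (F := fun p y => polarSign q y • k (p - z y))
    (F' := fun p y => polarSign q y • fderiv ℝ k (p - z y)) (bound := fun _ => L)
    univ_mem (.of_forall fun p => (hint p).1) (hint p)
    (integrable_polarSign_smul q (hk.integrable_fderiv_sub q z p)).1 ?_ (integrable_const _)
    (.of_forall fun y p _ => hderiv y p)
  filter_upwards [abs_polarSign q] with y hy p _
  rw [norm_smul, Real.norm_eq_abs, hy, one_mul]
  exact hk.norm_fderiv_le _

lemma DivergenceFreeWith.vectorIntegral (hk : DivergenceFreeWith L k) (q : SignedMeasure Λ)
    (z : C(Λ, Plane)) :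
    DivergenceFreeWith (L * q.variation.real Set.univ) fun p => ∫ᵛ y, k (p - z y) ∂<•q where
  differentiable p := (hk.hasFDerivAt_vectorIntegral q z p).differentiableAt
  norm_fderiv_le p := by
    rw [(hk.hasFDerivAt_vectorIntegral q z p).fderiv]
    exact norm_vectorIntegral_le_of_norm_le fun y => hk.norm_fderiv_le _
  planeTrace_fderiv p := by
    have hint := hk.integrable_fderiv_sub q z p
    rw [(hk.hasFDerivAt_vectorIntegral q z p).fderiv,
      vectorIntegral_eq_integral_polarSign_smul q hint,
      ← planeTrace.integral_comp_comm (integrable_polarSign_smul q hint)]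
    simp only [map_smul, hk.planeTrace_fderiv, smul_zero, integral_zero]

variable {q : SignedMeasure Λ} {g : C(Λ, Plane)}

lemma dispMap_eulerStep_lagrangianField (s : ℝ) (Y : Plane →ᵇ Plane) :
    dispMap (eulerStep (lagrangianField k q g) s Y) =
      (fun p => p + s • ∫ᵛ y, k (p - dispMap Y (g y)) ∂<•q) ∘ dispMap Y := by
  funext x
  simp only [eulerStep, dispMap_apply, BoundedContinuousFunction.add_apply,
    BoundedContinuousFunction.smul_apply, Function.comp_apply, lagrangianField_apply, add_assoc]

lemma DivergenceFreeWith.volume_image_iterate_eulerStep_ge (hk : DivergenceFreeWith L k) {s : ℝ}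
    (hs : |s| * (L * q.variation.real Set.univ) < 1) (n : ℕ) {A : Set Plane} (hA : IsCompact A) :
    ENNReal.ofReal (1 - 2 * (s * (L * q.variation.real Set.univ)) ^ 2) ^ n * volume A ≤
      volume (dispMap ((eulerStep (lagrangianField k q g) s)^[n] 0) '' A) := by
  induction n with
  | zero =>
    have hid : (dispMap (0 : Plane →ᵇ Plane) : Plane → Plane) = id :=
      funext fun x => add_zero x
    simp [hid]
  | succ n ih =>
    rw [Function.iterate_succ_apply']
    set Y := (eulerStep (lagrangianField k q g) s)^[n] 0
    rw [dispMap_eulerStep_lagrangianField, Set.image_comp, pow_succ', mul_assoc]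
    refine le_trans (by gcongr) ((hk.vectorIntegral q ((dispMap Y).comp g)).volume_image_add_smul_ge
      hs (hA.image (dispMap Y).continuous).measurableSet)

lemma one_sub_div_le_pow {a : ℝ} {n : ℕ} (hn : 0 < n) (ha : a ≤ n) :
    1 - a / n ≤ (1 - a / n ^ 2) ^ n := by
  have hn' : (1 : ℝ) ≤ n := by exact_mod_cast hn
  have ha' : a / (n : ℝ) ^ 2 ≤ 1 := by
    rw [div_le_one (by positivity)]
    nlinarith
  calc 1 - a / n = 1 + n * -(a / n ^ 2) := by field_simp; ring
    _ ≤ (1 + -(a / n ^ 2)) ^ n := one_add_mul_le_pow (by linarith) n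
    _ = (1 - a / n ^ 2) ^ n := by rw [← sub_eq_add_neg]

lemma DivergenceFreeWith.volume_le_volume_image (hk : DivergenceFreeWith L k)
    {X : ℝ → Plane →ᵇ Plane} (h0 : X 0 = 0)
    (hX : IsIntegralCurve X fun _ => lagrangianField k q g) (t : ℝ) {A : Set Plane}
    (hA : IsCompact A) : volume A ≤ volume (dispMap (X t) '' A) := by
  have hscheme := tendsto_iterate_eulerStep
    (lipschitzWith_lagrangianField hk.nonneg hk.norm_sub_le q g) norm_lagrangianField_le hX t
  rw [h0] at hscheme
  set m := L * q.variation.real Set.univ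
  have hcast := tendsto_natCast_atTop_atTop (R := ℝ)
  have hc : Tendsto (fun n : ℕ => 1 - 2 * (t * m) ^ 2 / (n : ℝ)) atTop (𝓝 1) := by
    simpa using (tendsto_const_nhds.div_atTop hcast).const_sub (1 : ℝ)
  refine volume_le_volume_image_of_tendsto hscheme hc hA ?_
  filter_upwards [hcast.eventually_gt_atTop (|t| * m), eventually_gt_atTop 0,
    hcast.eventually_ge_atTop (2 * (t * m) ^ 2)] with n hstep hn hlarge
  have hn' : (0 : ℝ) < n := by exact_mod_cast hn
  have hs : |t / n| * m < 1 := by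
    rwa [abs_div, abs_of_pos hn', div_mul_eq_mul_div, div_lt_one hn']
  refine le_trans ?_ (hk.volume_image_iterate_eulerStep_ge hs n hA)
  gcongr
  have hsq : 2 * (t / n * m) ^ 2 = 2 * (t * m) ^ 2 / (n : ℝ) ^ 2 := by field_simp
  rw [hsq, ← ENNReal.ofReal_pow]
  · exact ENNReal.ofReal_le_ofReal (one_sub_div_le_pow hn hlarge)
  · rw [sub_nonneg, div_le_one (by positivity)]
    nlinarith [(by exact_mod_cast hn : (1 : ℝ) ≤ n)]

end DivergenceFreeKernel

/-! ### Flows of admissible kernels -/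

lemma hasDerivAt_boundedContinuousFunction_apply {Y E : Type*} [TopologicalSpace Y]
    [NormedAddCommGroup E] [NormedSpace ℝ E] {X : ℝ → Y →ᵇ E} {V : Y →ᵇ E} {t : ℝ}
    (hX : HasDerivAt X V t) (x : Y) : HasDerivAt (fun s => X s x) (V x) t :=
  (BoundedContinuousFunction.evalCLM ℝ x (β := E)).hasFDerivAt.comp_hasDerivAt t hX

lemma hasDerivAt_of_continuous_of_hasDerivAt_apply {Y E : Type*} [TopologicalSpace Y]
    [NormedAddCommGroup E] [NormedSpace ℝ E] [CompleteSpace E] {X V : ℝ → Y →ᵇ E}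
    (hV : Continuous V) (h : ∀ t x, HasDerivAt (fun s => X s x) (V t x) t) (t : ℝ) :
    HasDerivAt X (V t) t := by
  have hprimitive : ∀ t, HasDerivAt (fun t => X 0 + ∫ s in (0 : ℝ)..t, V s) (V t) t := fun t =>
    (intervalIntegral.integral_hasDerivAt_right (hV.intervalIntegrable 0 t)
      (hV.stronglyMeasurableAtFilter _ _) hV.continuousAt).const_add _
  have heq : X = fun t => X 0 + ∫ s in (0 : ℝ)..t, V s := by
    funext t
    ext1 x
    have hdiff : ∀ r, HasDerivAt (fun r => X r x - (X 0 + ∫ s in (0 : ℝ)..r, V s) x) 0 r :=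
      fun r => by
        simpa only [sub_self] using
          (h r x).fun_sub (hasDerivAt_boundedContinuousFunction_apply (hprimitive r) x)
    have hconst := is_const_of_deriv_eq_zero (fun r => (hdiff r).differentiableAt)
      (fun r => (hdiff r).deriv) t 0
    simpa [sub_eq_zero] using hconst
  rw [heq]
  exact hprimitive t

lemma exists_lipschitzWith_dispMap_eq {E : Type*} [NormedAddCommGroup E] [NormedSpace ℝ E]
    {ζ v : ℝ → E → E} {M : ℝ} (hcont : ∀ t, Continuous (ζ t)) (h0 : ∀ x, ζ 0 x = x)
    (hζ : ∀ x t, HasDerivAt (fun s => ζ s x) (v t x) t) (hM : ∀ t x, ‖v t x‖ ≤ M) :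
    ∃ X : ℝ → E →ᵇ E, X 0 = 0 ∧ LipschitzWith M.toNNReal X ∧ ∀ t x, dispMap (X t) x = ζ t x := by
  have hlip : ∀ x s t, ‖ζ t x - ζ s x‖ ≤ M * |t - s| := fun x s t => by
    simpa using convex_univ.norm_image_sub_le_of_norm_hasDerivWithin_le
      (fun r _ => (hζ x r).hasDerivWithinAt) (fun r _ => hM r x) (Set.mem_univ s) (Set.mem_univ t)
  refine ⟨fun t => BoundedContinuousFunction.ofNormedAddCommGroup (fun x => ζ t x - x)
    ((hcont t).sub continuous_id) (M * |t|) fun x => by simpa [h0] using hlip x 0 t, ?_, ?_, ?_⟩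
  · ext1 x
    exact sub_eq_zero.2 (h0 x)
  · have hM0 : 0 ≤ M := (norm_nonneg _).trans (hM 0 0)
    refine LipschitzWith.of_dist_le_mul fun t s => ?_
    rw [Real.coe_toNNReal _ hM0,
      BoundedContinuousFunction.dist_le (mul_nonneg hM0 dist_nonneg)]
    intro x
    simpa [dist_eq_norm] using hlip x s t
  · exact fun t x => add_sub_cancel x (ζ t x)

lemma measurePreserving_of_le_measure_image {Y : Type*} [TopologicalSpace Y] [MeasurableSpace Y]
    [BorelSpace Y] {μ : Measure Y} [μ.Regular] {h : Y ≃ₜ Y}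
    (hle : ∀ A, IsCompact A → μ A ≤ μ (h '' A))
    (hle_symm : ∀ A, IsCompact A → μ A ≤ μ (h.symm '' A)) : MeasurePreserving h μ μ := by
  refine ⟨h.measurable, ?_⟩
  have : (μ.map h).Regular := Measure.Regular.map h
  refine Measure.OuterRegular.ext_isOpen fun U hU => ?_
  rw [hU.measure_eq_iSup_isCompact, hU.measure_eq_iSup_isCompact]
  refine iSup_congr fun A => iSup_congr fun _ => iSup_congr fun hA => ?_
  rw [h.measurableEmbedding.map_apply, ← h.image_symm]
  refine le_antisymm ?_ (hle_symm A hA)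
  have himage := hle _ (hA.image h.symm.continuous)
  rwa [← Set.image_comp, h.self_comp_symm, Set.image_id] at himage

section LagrangianFlow

variable {E : Type*} [NormedAddCommGroup E] [NormedSpace ℝ E] [SecondCountableTopology E]
  {Λ : Type*} [TopologicalSpace Λ] [MeasurableSpace Λ] [OpensMeasurableSpace Λ]
  {k : E →ᵇ E} {q : SignedMeasure Λ} {g : C(Λ, E)}

lemma hasDerivAt_dispMap_of_isIntegralCurve {X : ℝ → E →ᵇ E}
    (hX : IsIntegralCurve X fun _ => lagrangianField k q g) (x : E) (t : ℝ) :
    HasDerivAt (fun s => dispMap (X s) x)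
      (∫ᵛ y, k (dispMap (X t) x - dispMap (X t) (g y)) ∂<•q) t :=
  (hasDerivAt_boundedContinuousFunction_apply (hX t) x).const_add x

lemma isIntegralCurve_lagrangianField_of_hasDerivAt_dispMap [CompleteSpace E] {X : ℝ → E →ᵇ E}
    (hfield : Continuous (lagrangianField k q g)) (hX : Continuous X)
    (h : ∀ x t, HasDerivAt (fun s => dispMap (X s) x)
      (∫ᵛ y, k (dispMap (X t) x - dispMap (X t) (g y)) ∂<•q) t) :
    IsIntegralCurve X fun _ => lagrangianField k q g := by
  refine hasDerivAt_of_continuous_of_hasDerivAt_apply (hfield.comp hX) fun t x => ?_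
  simpa only [dispMap_apply, add_sub_cancel_left, lagrangianField_apply] using (h x t).sub_const x

lemma tendstoUniformly_lagrangianField {ι : Type*} {l : Filter ι} {kn : ι → E →ᵇ E}
    (hkn : Tendsto kn l (𝓝 k)) :
    TendstoUniformly (fun i => lagrangianField (kn i) q g) (lagrangianField k q g) l := by
  have hbound : Tendsto (fun i => ‖k - kn i‖ * q.variation.real Set.univ) l (𝓝 0) := by
    simpa using ((tendsto_const_nhds (x := k)).sub hkn).norm.mul_const (q.variation.real Set.univ)
  refine Metric.tendstoUniformly_iff.2 fun ε hε => ?_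
  filter_upwards [hbound.eventually_lt_const hε] with i hi X
  rw [dist_eq_norm]
  exact (norm_lagrangianField_sub_kernel_le k (kn i) q g X).trans_lt hi

lemma lagrangianField_add_compContinuous (Y Z : E →ᵇ E) :
    lagrangianField k q g (Y + Z.compContinuous (dispMap Y)) =
      (lagrangianField k q ((dispMap Y).comp g) Z).compContinuous (dispMap Y) := by
  ext1 x
  simp only [BoundedContinuousFunction.compContinuous_apply, lagrangianField_apply,
    dispMap_apply, BoundedContinuousFunction.add_apply, ContinuousMap.comp_apply, add_assoc]

lemma dispMap_add_of_isIntegralCurve {C : ℝ} (hk : LogLipschitzWith C k) {X Z : ℝ → E →ᵇ E}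
    {s : ℝ} (hX : IsIntegralCurve X fun _ => lagrangianField k q g)
    (hZ : IsIntegralCurve Z fun _ => lagrangianField k q ((dispMap (X s)).comp g))
    (hZ0 : Z 0 = 0) (t : ℝ) :
    dispMap (X (s + t)) = (dispMap (Z t)).comp (dispMap (X s)) := by
  have heq : (fun t => X (s + t)) = fun t => X s + (Z t).compContinuous (dispMap (X s)) := by
    refine (logLipschitzWith_lagrangianField hk q g).integralCurve_unique
      (fun t => (hX (s + t)).comp_const_add s t) (fun t => ?_) ?_
    · beta_reduce
      rw [lagrangianField_add_compContinuous]
      exact ((BoundedContinuousFunction.compContinuousCLM (𝕜 := ℝ) (β := E)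
        (dispMap (X s))).hasFDerivAt.comp_hasDerivAt t (hZ t)).const_add (X s)
    · ext1 x
      simp [hZ0]
  ext1 x
  simp [congrFun heq t, add_assoc]

end LagrangianFlow

/-- A bounded log-Lipschitz kernel that is a uniform limit of divergence-free kernels with bounded
derivative. These are the kernels for which flow maps are constructed. -/
structure AdmissibleKernel (k : Plane →ᵇ Plane) : Prop where
  exists_logLipschitzWith : ∃ C, LogLipschitzWith C k
  exists_tendsto : ∃ kn : ℕ → Plane →ᵇ Plane,
    Tendsto kn atTop (𝓝 k) ∧ ∀ n, ∃ L, DivergenceFreeWith L (kn n)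

namespace AdmissibleKernel

variable {Λ : Type*} [TopologicalSpace Λ] [MeasurableSpace Λ] [OpensMeasurableSpace Λ]
  {k : Plane →ᵇ Plane} {q : SignedMeasure Λ} {g : C(Λ, Plane)}

lemma exists_isIntegralCurve (hk : AdmissibleKernel k) (q : SignedMeasure Λ) (g : C(Λ, Plane)) :
    ∃ X : ℝ → Plane →ᵇ Plane, X 0 = 0 ∧ IsIntegralCurve X (fun _ => lagrangianField k q g) ∧
      ∀ t A, IsCompact A → volume A ≤ volume (dispMap (X t) '' A) := by
  obtain ⟨C, hC⟩ := hk.exists_logLipschitzWith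
  obtain ⟨kn, hkn, hdiv⟩ := hk.exists_tendsto
  choose L hL using hdiv
  choose X hX0 hX using fun n => exists_isIntegralCurve_of_lipschitzWith
    (lipschitzWith_lagrangianField (hL n).nonneg (hL n).norm_sub_le q g)
    norm_lagrangianField_le 0
  obtain ⟨Y, hY0, hY, hlim⟩ :=
    (logLipschitzWith_lagrangianField hC q g).exists_tendsto_integralCurve
      (tendstoUniformly_lagrangianField hkn) hX0 hX
  refine ⟨Y, hY0, hY, fun t A hA => ?_⟩
  refine volume_le_volume_image_of_tendsto (hlim t) (c := fun _ => 1) tendsto_const_nhds hA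
    (.of_forall fun n => ?_)
  simpa using (hL n).volume_le_volume_image (hX0 n) (hX n) t hA

/-- The displacement, as a function of time, of the flow of an admissible kernel. -/
def displacement (hk : AdmissibleKernel k) (q : SignedMeasure Λ) (g : C(Λ, Plane)) :
    ℝ → Plane →ᵇ Plane :=
  (hk.exists_isIntegralCurve q g).choose

lemma displacement_zero (hk : AdmissibleKernel k) : hk.displacement q g 0 = 0 :=
  (hk.exists_isIntegralCurve q g).choose_spec.1

lemma isIntegralCurve_displacement (hk : AdmissibleKernel k) :
    IsIntegralCurve (hk.displacement q g) fun _ => lagrangianField k q g :=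
  (hk.exists_isIntegralCurve q g).choose_spec.2.1

lemma volume_le_volume_image_displacement (hk : AdmissibleKernel k) (t : ℝ) {A : Set Plane}
    (hA : IsCompact A) : volume A ≤ volume (dispMap (hk.displacement q g t) '' A) :=
  (hk.exists_isIntegralCurve q g).choose_spec.2.2 t A hA

lemma eq_displacement (hk : AdmissibleKernel k) {X : ℝ → Plane →ᵇ Plane} (hX0 : X 0 = 0)
    (hX : IsIntegralCurve X fun _ => lagrangianField k q g) : X = hk.displacement q g := by
  obtain ⟨C, hC⟩ := hk.exists_logLipschitzWith
  exact (logLipschitzWith_lagrangianField hC q g).integralCurve_unique hX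
    hk.isIntegralCurve_displacement (hX0.trans hk.displacement_zero.symm)

lemma dispMap_displacement_neg_comp (hk : AdmissibleKernel k) (s : ℝ) :
    (dispMap (hk.displacement q ((dispMap (hk.displacement q g s)).comp g) (-s))).comp
      (dispMap (hk.displacement q g s)) = ContinuousMap.id Plane := by
  obtain ⟨C, hC⟩ := hk.exists_logLipschitzWith
  rw [← dispMap_add_of_isIntegralCurve hC hk.isIntegralCurve_displacement
    hk.isIntegralCurve_displacement hk.displacement_zero, add_neg_cancel, hk.displacement_zero]
  ext1 x
  simp

lemma dispMap_displacement_comp_neg (hk : AdmissibleKernel k) (s : ℝ) :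
    (dispMap (hk.displacement q g s)).comp
      (dispMap (hk.displacement q ((dispMap (hk.displacement q g s)).comp g) (-s))) =
        ContinuousMap.id Plane := by
  have h := hk.dispMap_displacement_neg_comp (q := q)
    (g := (dispMap (hk.displacement q g s)).comp g) (-s)
  rwa [neg_neg, ← ContinuousMap.comp_assoc, hk.dispMap_displacement_neg_comp,
    ContinuousMap.id_comp] at h

/-- The flow of an admissible kernel for a vorticity with labels `g`. The inverse at time `t` is
the flow at time `-t` for the vorticity transported up to time `t`. -/
def flow (hk : AdmissibleKernel k) (q : SignedMeasure Λ) (g : C(Λ, Plane)) (t : ℝ) :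
    Plane ≃ₜ Plane where
  toFun := dispMap (hk.displacement q g t)
  invFun := dispMap (hk.displacement q ((dispMap (hk.displacement q g t)).comp g) (-t))
  left_inv x := DFunLike.congr_fun (hk.dispMap_displacement_neg_comp t) x
  right_inv x := DFunLike.congr_fun (hk.dispMap_displacement_comp_neg t) x
  continuous_toFun := (dispMap _).continuous
  continuous_invFun := (dispMap _).continuous

lemma measurePreserving_flow (hk : AdmissibleKernel k) (t : ℝ) :
    MeasurePreserving (hk.flow q g t) volume volume :=
  measurePreserving_of_le_measure_image
    (fun _ hA => hk.volume_le_volume_image_displacement t hA)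
    (fun _ hA => hk.volume_le_volume_image_displacement (-t) hA)

lemma eq_flow (hk : AdmissibleKernel k) {ζ : ℝ → Plane ≃ₜ Plane} (h0 : ∀ x, ζ 0 x = x)
    (hζ : ∀ x t, HasDerivAt (fun s => ζ s x) (∫ᵛ y, k (ζ t x - ζ t (g y)) ∂<•q) t) :
    ζ = hk.flow q g := by
  obtain ⟨C, hC⟩ := hk.exists_logLipschitzWith
  obtain ⟨X, hX0, hXlip, hXζ⟩ := exists_lipschitzWith_dispMap_eq (fun t => (ζ t).continuous) h0 hζ
    fun t x => norm_vectorIntegral_le_of_norm_le fun y => k.norm_coe_le_norm _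
  have hfield := (logLipschitzWith_lagrangianField hC q g).uniformContinuous.continuous
  have hX : IsIntegralCurve X fun _ => lagrangianField k q g :=
    isIntegralCurve_lagrangianField_of_hasDerivAt_dispMap hfield hXlip.continuous
      (by simpa only [hXζ] using hζ)
  funext t
  ext1 x
  rw [← hXζ, hk.eq_displacement hX0 hX]
  rfl

end AdmissibleKernel

lemma tendsto_blobField_cocompact {α : ℝ} (hα : 0 < α) :
    Tendsto (blobField α) (cocompact Plane) (𝓝 0) := by
  have hnorm : Tendsto (fun x : Plane => (2 * Real.pi * ‖x‖)⁻¹) (cocompact Plane) (𝓝 0) :=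
    tendsto_inv_atTop_zero.comp
      ((tendsto_norm_cocompact_atTop (E := Plane)).const_mul_atTop Real.two_pi_pos)
  exact squeeze_zero_norm (fun x => norm_eulerField x ▸ norm_blobField_le hα x) hnorm

/-- The blob field as a bounded continuous function. -/
def blobMap {α : ℝ} (hα : 0 < α) : Plane →ᵇ Plane :=
  ZeroAtInftyContinuousMap.toBCF
    ⟨⟨blobField α, (logLipschitzWith_blobField hα).uniformContinuous.continuous⟩,
      tendsto_blobField_cocompact hα⟩

lemma exists_divergenceFreeWith_norm_sub_blobMap_le {α : ℝ} (hα : 0 < α) (M : ℝ) :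
    ∃ (k : Plane →ᵇ Plane) (L : ℝ), DivergenceFreeWith L k ∧
      ‖k - blobMap hα‖ ≤ 2 * α⁻¹ * Real.exp (-M / 2) := by
  choose A hA hAM htrace using exists_hasFDerivAt_blobFieldTrunc hα M
  have hsub := norm_blobFieldTrunc_sub_le hα M
  refine ⟨BoundedContinuousFunction.ofNormedAddCommGroup (blobFieldTrunc α M)
    (continuous_iff_continuousAt.2 fun x => (hA x).continuousAt)
    (2 * α⁻¹ * Real.exp (-M / 2) + ‖blobMap hα‖) fun x => ?_, _,
    ⟨fun x => (hA x).differentiableAt, fun x => (hA x).fderiv ▸ hAM x,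
      fun x => (hA x).fderiv ▸ htrace x⟩,
    (BoundedContinuousFunction.norm_le (by positivity)).2 hsub⟩
  exact (norm_le_norm_sub_add _ (blobField α x)).trans
    (add_le_add (hsub x) ((blobMap hα).norm_coe_le_norm x))

lemma admissibleKernel_blobMap {α : ℝ} (hα : 0 < α) : AdmissibleKernel (blobMap hα) where
  exists_logLipschitzWith := ⟨_, logLipschitzWith_blobField hα⟩
  exists_tendsto := by
    choose k L hL hk using fun n : ℕ => exists_divergenceFreeWith_norm_sub_blobMap_le hα n
    have hlim : Tendsto (fun n : ℕ => 2 * α⁻¹ * Real.exp (-n / 2)) atTop (𝓝 0) := by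
      simpa [neg_div] using (Real.tendsto_exp_neg_atTop_nhds_zero.comp
        (tendsto_natCast_atTop_atTop.atTop_div_const two_pos)).const_mul (2 * α⁻¹)
    exact ⟨k, tendsto_iff_norm_sub_tendsto_zero.2
      (squeeze_zero (fun _ => norm_nonneg _) hk hlim), fun n => ⟨L n, hL n⟩⟩

/-- The displacement, as a function of time, of the flow of the vortex blob method. -/
def blobDisplacement {α : ℝ} (hα : 0 < α) (q : SignedMeasure Plane) : ℝ → Plane →ᵇ Plane :=
  (admissibleKernel_blobMap hα).displacement q (ContinuousMap.id Plane)

lemma IsBlobFlow.eq_flow {α : ℝ} (hα : 0 < α) {q : SignedMeasure Plane}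
    {ζ : ℝ → Plane ≃ₜ Plane} (h : IsBlobFlow α q ζ) :
    ζ = (admissibleKernel_blobMap hα).flow q (ContinuousMap.id Plane) :=
  (admissibleKernel_blobMap hα).eq_flow h.initial fun x t => by
    have hderiv := h.hasDerivAt x t
    simp only [blobKernel_eq hα] at hderiv
    exact hderiv

lemma isBlobFlow_flow {α : ℝ} (hα : 0 < α) (q : SignedMeasure Plane) :
    IsBlobFlow α q ((admissibleKernel_blobMap hα).flow q (ContinuousMap.id Plane)) where
  measurePreserving := (admissibleKernel_blobMap hα).measurePreserving_flow
  initial x := by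
    change x + (admissibleKernel_blobMap hα).displacement q (ContinuousMap.id Plane) 0 x = x
    simp [AdmissibleKernel.displacement_zero]
  hasDerivAt x t := by
    simp only [blobKernel_eq hα]
    exact hasDerivAt_dispMap_of_isIntegralCurve
      (admissibleKernel_blobMap hα).isIntegralCurve_displacement x t

theorem existsUnique_isBlobFlow {α : ℝ} (hα : 0 < α) (q : SignedMeasure Plane) :
    ∃! ζ : ℝ → Plane ≃ₜ Plane, IsBlobFlow α q ζ :=
  ⟨_, isBlobFlow_flow hα q, fun _ h => h.eq_flow hα⟩

lemma IsBlobFlow.eq_dispMap {α : ℝ} (hα : 0 < α) {q : SignedMeasure Plane}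
    {ζ : ℝ → Plane ≃ₜ Plane} (h : IsBlobFlow α q ζ) (t : ℝ) (x : Plane) :
    ζ t x = dispMap (blobDisplacement hα q t) x := by
  rw [h.eq_flow hα]
  rfl

/-! ### Radial integrals -/

lemma lintegral_fun_norm {E : Type*} [NormedAddCommGroup E] [NormedSpace ℝ E]
    [FiniteDimensional ℝ E] [Nontrivial E] [MeasurableSpace E] [BorelSpace E] (μ : Measure E)
    [μ.IsAddHaarMeasure] {f : ℝ → ENNReal} (hf : Measurable f) :
    ∫⁻ x, f ‖x‖ ∂μ = Module.finrank ℝ E * μ (Metric.ball 0 1) *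
      ∫⁻ r in Set.Ioi (0 : ℝ), ENNReal.ofReal (r ^ (Module.finrank ℝ E - 1)) * f r :=
  calc ∫⁻ x, f ‖x‖ ∂μ
      = ∫⁻ x : ({0}ᶜ : Set E), f ‖x.1‖ ∂(μ.comap (↑)) := by
        rw [lintegral_subtype_comap (measurableSet_singleton _).compl fun x => f ‖x‖,
          restrict_compl_singleton]
    _ = ∫⁻ x, f x.2 ∂μ.toSphere.prod (.volumeIoiPow (Module.finrank ℝ E - 1)) := by
        simpa using μ.measurePreserving_homeomorphUnitSphereProd.lintegral_comp_emb
          (Homeomorph.measurableEmbedding _) (f ∘ Subtype.val ∘ Prod.snd)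
    _ = μ.toSphere Set.univ *
          ∫⁻ r : Set.Ioi (0 : ℝ), f r ∂.volumeIoiPow (Module.finrank ℝ E - 1) := by
        rw [lintegral_prod (fun x : Metric.sphere (0 : E) 1 × Set.Ioi (0 : ℝ) => f x.2)
          (by fun_prop)]
        simp only [lintegral_const, mul_comm]
    _ = _ := by
        rw [μ.toSphere_apply_univ, Measure.volumeIoiPow,
          lintegral_withDensity_eq_lintegral_mul _ (by fun_prop) (by fun_prop),
          ← lintegral_subtype_comap measurableSet_Ioi]
        rfl

lemma setLIntegral_norm_preimage {f : ℝ → ENNReal} (hf : Measurable f) {A : Set ℝ}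
    (hA : MeasurableSet A) :
    ∫⁻ z in norm ⁻¹' A, f ‖z‖ ∂(volume : Measure Plane) =
      ENNReal.ofReal (2 * Real.pi) * ∫⁻ r in A ∩ Set.Ioi 0, ENNReal.ofReal r * f r := by
  have hradial (z : Plane) :
      (norm ⁻¹' A).indicator (fun z : Plane => f ‖z‖) z = A.indicator f ‖z‖ := rfl
  rw [← lintegral_indicator (measurable_norm hA), lintegral_congr hradial,
    lintegral_fun_norm volume (hf.indicator hA), ← setLIntegral_indicator hA]
  congr 1
  · simp [EuclideanSpace.volume_ball_fin_two, ENNReal.ofReal_mul]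
  · refine lintegral_congr fun r => ?_
    by_cases hr : r ∈ A <;> simp [hr]

lemma enorm_eulerField (z : Plane) : ‖eulerField z‖ₑ = ENNReal.ofReal (2 * Real.pi * ‖z‖)⁻¹ := by
  rw [← ofReal_norm, norm_eulerField]

lemma lintegral_ball_enorm_eulerField (R : ℝ) :
    ∫⁻ z in Metric.ball (0 : Plane) R, ‖eulerField z‖ₑ = ENNReal.ofReal R := by
  have hball : Metric.ball (0 : Plane) R = norm ⁻¹' Set.Iio R := by ext; simp
  have hcancel : ∀ r ∈ Set.Iio R ∩ Set.Ioi (0 : ℝ),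
      ENNReal.ofReal r * ENNReal.ofReal (2 * Real.pi * r)⁻¹ =
        ENNReal.ofReal (2 * Real.pi)⁻¹ := fun r hr => by
    have hr0 : 0 < r := hr.2
    rw [← ENNReal.ofReal_mul hr0.le]
    congr 1
    field_simp
  simp_rw [enorm_eulerField, hball]
  rw [setLIntegral_norm_preimage (f := fun r => ENNReal.ofReal (2 * Real.pi * r)⁻¹) (by fun_prop)
      measurableSet_Iio,
    setLIntegral_congr_fun (measurableSet_Iio.inter measurableSet_Ioi) hcancel,
    setLIntegral_const, Set.inter_comm, Set.Ioi_inter_Iio, Real.volume_Ioo, sub_zero, ← mul_assoc,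
    ← ENNReal.ofReal_mul Real.two_pi_pos.le, mul_inv_cancel₀ Real.two_pi_pos.ne',
    ENNReal.ofReal_one, one_mul]

lemma lintegral_Ico_ofReal_inv {a b : ℝ} (ha : 0 < a) (hab : a ≤ b) :
    ∫⁻ r in Set.Ico a b, ENNReal.ofReal r⁻¹ = ENNReal.ofReal (Real.log (b / a)) := by
  have hinteg : IntervalIntegrable (fun r : ℝ => r⁻¹) volume a b :=
    intervalIntegrable_inv_iff.2 (Or.inr fun h => by
      rw [Set.uIcc_of_le hab] at h; exact ha.not_ge h.1)
  rw [restrict_Ico_eq_restrict_Ioc, ← ofReal_integral_eq_lintegral_ofReal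
      ((intervalIntegrable_iff_integrableOn_Ioc_of_le hab).1 hinteg)
      ((ae_restrict_mem measurableSet_Ioc).mono fun r hr => inv_nonneg.2 (ha.trans hr.1).le),
    ← intervalIntegral.integral_of_le hab, integral_inv_of_pos ha (ha.trans_le hab)]

lemma lintegral_annulus_inv_sq_norm {a b : ℝ} (ha : 0 < a) (hab : a ≤ b) :
    ∫⁻ z in norm ⁻¹' Set.Ico a b, ENNReal.ofReal (2 * Real.pi * ‖z‖ ^ 2)⁻¹
      ∂(volume : Measure Plane) = ENNReal.ofReal (Real.log (b / a)) := by
  have hpos : Set.Ico a b ∩ Set.Ioi 0 = Set.Ico a b :=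
    Set.inter_eq_left.2 fun r hr => ha.trans_le hr.1
  have hcancel : ∀ r ∈ Set.Ico a b,
      ENNReal.ofReal r * ENNReal.ofReal (2 * Real.pi * r ^ 2)⁻¹ =
        ENNReal.ofReal (2 * Real.pi)⁻¹ * ENNReal.ofReal r⁻¹ := fun r hr => by
    have hr0 : 0 < r := ha.trans_le hr.1
    rw [← ENNReal.ofReal_mul hr0.le, ← ENNReal.ofReal_mul (by positivity)]
    congr 1
    field_simp
  rw [setLIntegral_norm_preimage (f := fun r => ENNReal.ofReal (2 * Real.pi * r ^ 2)⁻¹)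
      (by fun_prop) measurableSet_Ico, hpos, setLIntegral_congr_fun measurableSet_Ico hcancel,
    lintegral_const_mul' _ _ ENNReal.ofReal_ne_top, lintegral_Ico_ofReal_inv ha hab, ← mul_assoc,
    ← ENNReal.ofReal_mul Real.two_pi_pos.le, mul_inv_cancel₀ Real.two_pi_pos.ne',
    ENNReal.ofReal_one, one_mul]

/-- A majorant for the increments of the Euler kernel over distances at most `D`: the kernel itself
near the origin, `D` times the size of its derivative away from it. -/
def eulerMajorant (N : ℕ) (D : ℝ) (z : Plane) : ℝ :=
  if ‖z‖ < Real.exp (-N) then (2 * Real.pi * ‖z‖)⁻¹ else D * (2 * Real.pi * ‖z‖ ^ 2)⁻¹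

lemma eulerMajorant_nonneg (N : ℕ) {D : ℝ} (hD : 0 ≤ D) (z : Plane) : 0 ≤ eulerMajorant N D z := by
  unfold eulerMajorant; split_ifs <;> positivity

lemma measurable_eulerMajorant (N : ℕ) (D : ℝ) : Measurable (eulerMajorant N D) :=
  Measurable.ite (measurableSet_lt measurable_norm measurable_const) (by fun_prop) (by fun_prop)

lemma norm_eulerField_le_eulerMajorant {N : ℕ} {D : ℝ} {z : Plane}
    (h : ‖z‖ < Real.exp (-N) ∨ ‖z‖ ≤ D) : ‖eulerField z‖ ≤ eulerMajorant N D z := by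
  rw [norm_eulerField, eulerMajorant]
  split_ifs with hnear
  · rfl
  · have hz : 0 < ‖z‖ := (Real.exp_pos _).trans_le (not_lt.1 hnear)
    calc (2 * Real.pi * ‖z‖)⁻¹ = ‖z‖ * (2 * Real.pi * ‖z‖ ^ 2)⁻¹ := by field_simp
      _ ≤ D * (2 * Real.pi * ‖z‖ ^ 2)⁻¹ := by gcongr; exact h.resolve_left hnear

lemma norm_eulerField_sub_le_of_far {N : ℕ} {D : ℝ} {a b : Plane} (hD : ‖a - b‖ ≤ D)
    (hfar : Real.exp (-N) ≤ ‖b‖) (hb : D < ‖b‖) :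
    ‖eulerField a - eulerField b‖ ≤ eulerMajorant N D a + eulerMajorant N D b := by
  have hD0 : 0 ≤ D := (norm_nonneg _).trans hD
  have hb0 : 0 < ‖b‖ := hD0.trans_lt hb
  have ha : a ≠ 0 := by rintro rfl; rw [zero_sub, norm_neg] at hD; exact hD.not_gt hb
  rw [norm_eulerField_sub ha (norm_pos_iff.1 hb0)]
  by_cases hnear : ‖a‖ < Real.exp (-N)
  · calc ‖a - b‖ / (2 * Real.pi * (‖a‖ * ‖b‖)) ≤ ‖b‖ / (2 * Real.pi * (‖a‖ * ‖b‖)) := by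
          gcongr; exact hD.trans hb.le
      _ = eulerMajorant N D a := by rw [eulerMajorant, if_pos hnear]; field_simp
      _ ≤ _ := le_add_of_nonneg_right (eulerMajorant_nonneg N hD0 b)
  · rw [eulerMajorant, if_neg hnear, eulerMajorant, if_neg hfar.not_gt]
    calc ‖a - b‖ / (2 * Real.pi * (‖a‖ * ‖b‖))
        ≤ D / (2 * Real.pi) * (‖a‖⁻¹ * ‖b‖⁻¹) := by
          rw [div_mul_eq_div_div, ← mul_inv, ← div_eq_mul_inv]; gcongr
      _ ≤ D / (2 * Real.pi) * (‖a‖⁻¹ ^ 2 + ‖b‖⁻¹ ^ 2) := by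
          gcongr
          nlinarith [sq_nonneg (‖a‖⁻¹ - ‖b‖⁻¹), sq_nonneg (‖a‖⁻¹ + ‖b‖⁻¹)]
      _ = _ := by field_simp

lemma norm_eulerField_sub_le_eulerMajorant (N : ℕ) {D : ℝ} {a b : Plane} (hD : ‖a - b‖ ≤ D) :
    ‖eulerField a - eulerField b‖ ≤ eulerMajorant N D a + eulerMajorant N D b := by
  by_cases ha : ‖a‖ < Real.exp (-N) ∨ ‖a‖ ≤ D
  · by_cases hb : ‖b‖ < Real.exp (-N) ∨ ‖b‖ ≤ D
    · exact (norm_sub_le _ _).trans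
        (add_le_add (norm_eulerField_le_eulerMajorant ha) (norm_eulerField_le_eulerMajorant hb))
    · push Not at hb
      exact norm_eulerField_sub_le_of_far hD hb.1 hb.2
  · push Not at ha
    rw [norm_sub_rev, add_comm]
    exact norm_eulerField_sub_le_of_far (norm_sub_rev a b ▸ hD) ha.1 ha.2

lemma lintegral_ball_eulerMajorant_le (N : ℕ) {D : ℝ} (hD : 0 ≤ D) :
    ∫⁻ z in Metric.ball (0 : Plane) 1, ENNReal.ofReal (eulerMajorant N D z) ≤
      ENNReal.ofReal (logMod N D) := by
  have hle : Real.exp (-(N : ℝ)) ≤ 1 := Real.exp_le_one_iff.2 (by simp)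
  have hcover : Metric.ball (0 : Plane) 1 ⊆
      Metric.ball 0 (Real.exp (-N)) ∪ norm ⁻¹' Set.Ico (Real.exp (-N)) 1 := fun z hz => by
    rw [mem_ball_zero_iff] at hz
    exact (lt_or_ge ‖z‖ (Real.exp (-N))).imp mem_ball_zero_iff.2 fun h => ⟨h, hz⟩
  have hnear : ∫⁻ z in Metric.ball (0 : Plane) (Real.exp (-N)),
      ENNReal.ofReal (eulerMajorant N D z) = ENNReal.ofReal (Real.exp (-N)) := by
    rw [← lintegral_ball_enorm_eulerField]
    refine setLIntegral_congr_fun measurableSet_ball fun z hz => ?_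
    simp only [enorm_eulerField, eulerMajorant, if_pos (mem_ball_zero_iff.1 hz)]
  have hfar : ∫⁻ z in norm ⁻¹' Set.Ico (Real.exp (-N)) 1,
      ENNReal.ofReal (eulerMajorant N D z) ∂(volume : Measure Plane) =
        ENNReal.ofReal (D * N) := by
    have hannulus := lintegral_annulus_inv_sq_norm (Real.exp_pos (-N)) hle
    rw [one_div, ← Real.exp_neg, Real.log_exp, neg_neg] at hannulus
    rw [ENNReal.ofReal_mul hD, ← hannulus, ← lintegral_const_mul' _ _ ENNReal.ofReal_ne_top]
    refine setLIntegral_congr_fun (measurable_norm (α := Plane) measurableSet_Ico) fun z hz => ?_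
    simp only [eulerMajorant, if_neg hz.1.not_gt, ENNReal.ofReal_mul hD]
  calc ∫⁻ z in Metric.ball (0 : Plane) 1, ENNReal.ofReal (eulerMajorant N D z)
      ≤ ENNReal.ofReal (Real.exp (-N)) + ENNReal.ofReal (D * N) := by
        rw [← hnear, ← hfar]
        exact (lintegral_mono_set hcover).trans (lintegral_union_le _ _ _)
    _ ≤ ENNReal.ofReal (logMod N D) := by
        rw [← ENNReal.ofReal_add (by positivity) (by positivity)]
        refine ENNReal.ofReal_le_ofReal ?_
        unfold logMod
        linarith

lemma eulerMajorant_le_logMod {N : ℕ} {D : ℝ} (hD : 0 ≤ D) {z : Plane} (hz : 1 ≤ ‖z‖) :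
    eulerMajorant N D z ≤ logMod N D := by
  have hle : Real.exp (-(N : ℝ)) ≤ 1 := Real.exp_le_one_iff.2 (by simp)
  have hone : 1 ≤ 2 * Real.pi * ‖z‖ ^ 2 :=
    one_le_mul_of_one_le_of_one_le (by linarith [Real.pi_gt_three]) (one_le_pow₀ hz)
  calc eulerMajorant N D z = D * (2 * Real.pi * ‖z‖ ^ 2)⁻¹ := if_neg (hle.trans hz).not_gt
    _ ≤ D := mul_le_of_le_one_right hD (inv_le_one_of_one_le₀ hone)
    _ ≤ logMod N D := by unfold logMod; nlinarith [Real.exp_pos (-(N : ℝ)), N.cast_nonneg (α := ℝ)]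

/-! ### Velocity of a bounded integrable vorticity transported by measure preserving maps -/

lemma lintegral_comp_sub_mul_enorm_le {Ω G E : Type*} [MeasurableSpace Ω] {ν : Measure Ω}
    [MeasurableSpace G] [AddGroup G] [MeasurableAdd G] [MeasurableNeg G] {μ : Measure G}
    [μ.IsAddLeftInvariant] [μ.IsNegInvariant] [NormedAddCommGroup E] {ω : Ω → E}
    (hω : AEStronglyMeasurable ω ν) {φ : Ω → G} (hφ : MeasurePreserving φ ν μ) {f : G → ENNReal}
    (hf : Measurable f) {S : Set G} (hS : MeasurableSet S) {b : ENNReal} (hb : ∀ z ∉ S, f z ≤ b)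
    (p : G) :
    ∫⁻ y, f (p - φ y) * ‖ω y‖ₑ ∂ν ≤
      (∫⁻ z in S, f z ∂μ) * eLpNorm ω ⊤ ν + b * eLpNorm ω 1 ν := by
  have hsplit (z : G) : f z ≤ S.indicator f z + b := by
    by_cases hz : z ∈ S
    · simp [hz]
    · simpa [hz] using hb z hz
  have hmeas : Measurable fun z => S.indicator f (p - z) := by
    simpa only [sub_eq_add_neg, Function.comp_def] using
      (hf.indicator hS).comp (measurable_neg.const_add p)
  have hnear : ∫⁻ y, S.indicator f (p - φ y) * ‖ω y‖ₑ ∂ν ≤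
      (∫⁻ z in S, f z ∂μ) * eLpNorm ω ⊤ ν :=
    calc ∫⁻ y, S.indicator f (p - φ y) * ‖ω y‖ₑ ∂ν
        ≤ ∫⁻ y, S.indicator f (p - φ y) * eLpNorm ω ⊤ ν ∂ν := by
          refine lintegral_mono_ae ?_
          filter_upwards [enorm_ae_le_eLpNormEssSup ω ν] with y hy
          rw [eLpNorm_exponent_top]
          gcongr
      _ = (∫⁻ z in S, f z ∂μ) * eLpNorm ω ⊤ ν := by
          have hcomp : Measurable fun y => S.indicator f (p - φ y) := hmeas.comp hφ.measurable
          rw [lintegral_mul_const _ hcomp, hφ.lintegral_comp hmeas,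
            lintegral_sub_left_eq_self, lintegral_indicator hS]
  calc ∫⁻ y, f (p - φ y) * ‖ω y‖ₑ ∂ν
      ≤ ∫⁻ y, S.indicator f (p - φ y) * ‖ω y‖ₑ + b * ‖ω y‖ₑ ∂ν := by
        refine lintegral_mono fun y => ?_
        rw [← add_mul]
        gcongr
        exact hsplit _
    _ = (∫⁻ y, S.indicator f (p - φ y) * ‖ω y‖ₑ ∂ν) + b * eLpNorm ω 1 ν := by
        rw [lintegral_add_right' _ (hω.enorm.const_mul b), lintegral_const_mul'' _ hω.enorm,
          eLpNorm_one_eq_lintegral_enorm]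
    _ ≤ _ := by gcongr

lemma norm_integral_le_of_lintegral_enorm_le {Ω E : Type*} [MeasurableSpace Ω] {μ : Measure Ω}
    [NormedAddCommGroup E] [NormedSpace ℝ E] {f : Ω → E} {C : ℝ} (hC : 0 ≤ C)
    (hf : ∫⁻ y, ‖f y‖ₑ ∂μ ≤ ENNReal.ofReal C) : ‖∫ y, f y ∂μ‖ ≤ C :=
  (ENNReal.ofReal_le_ofReal_iff hC).1
    (ofReal_norm (∫ y, f y ∂μ) ▸ (enorm_integral_le_lintegral_enorm f).trans hf)

/-- The constant `‖ω‖_∞ + ‖ω‖_1` in the estimates for the velocity of the vorticity `ω`: the first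
term accounts for the singularity of the Euler kernel, the second for the rest of the plane. -/
def vortConst (ω : Plane → ℝ) : ℝ := (eLpNorm ω ⊤ volume).toReal + (eLpNorm ω 1 volume).toReal

lemma vortConst_nonneg (ω : Plane → ℝ) : 0 ≤ vortConst ω := by unfold vortConst; positivity

section TransportedVorticity

variable {ω : Plane → ℝ} {φ ψ : Plane → Plane}

lemma lintegral_comp_sub_mul_enorm_le_vortConst (hω₁ : MemLp ω 1 volume) (hω₂ : MemLp ω ⊤ volume)
    (hφ : MeasurePreserving φ volume volume) {f : Plane → ENNReal} (hf : Measurable f)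
    {S : Set Plane} (hS : MeasurableSet S) {c : ℝ} (hc : 0 ≤ c)
    (hfS : ∫⁻ z in S, f z ≤ ENNReal.ofReal c) (hfc : ∀ z ∉ S, f z ≤ ENNReal.ofReal c)
    (p : Plane) : ∫⁻ y, f (p - φ y) * ‖ω y‖ₑ ≤ ENNReal.ofReal (vortConst ω * c) :=
  calc ∫⁻ y, f (p - φ y) * ‖ω y‖ₑ
      ≤ (∫⁻ z in S, f z) * eLpNorm ω ⊤ volume + ENNReal.ofReal c * eLpNorm ω 1 volume :=
        lintegral_comp_sub_mul_enorm_le hω₁.1 hφ hf hS hfc p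
    _ ≤ ENNReal.ofReal c * (eLpNorm ω ⊤ volume + eLpNorm ω 1 volume) := by
        rw [mul_add]; gcongr
    _ = ENNReal.ofReal (vortConst ω * c) := by
        rw [vortConst, mul_comm _ c, ENNReal.ofReal_mul hc,
          ← ENNReal.toReal_add hω₂.eLpNorm_ne_top hω₁.eLpNorm_ne_top,
          ENNReal.ofReal_toReal (ENNReal.add_ne_top.2 ⟨hω₂.eLpNorm_ne_top, hω₁.eLpNorm_ne_top⟩)]

lemma measurable_eulerField : Measurable eulerField := by
  unfold eulerField
  exact ((measurable_const.mul (measurable_norm.pow_const 2)).inv).smul perp.continuous.measurable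

lemma lintegral_enorm_smul_eulerField_le (hω₁ : MemLp ω 1 volume) (hω₂ : MemLp ω ⊤ volume)
    (hφ : MeasurePreserving φ volume volume) (p : Plane) :
    ∫⁻ y, ‖ω y • eulerField (p - φ y)‖ₑ ≤ ENNReal.ofReal (vortConst ω) := by
  have hfar : ∀ z ∉ Metric.ball (0 : Plane) 1, ‖eulerField z‖ₑ ≤ ENNReal.ofReal 1 := fun z hz => by
    rw [mem_ball_zero_iff, not_lt] at hz
    rw [enorm_eulerField]
    exact ENNReal.ofReal_le_ofReal (inv_le_one_of_one_le₀
      (one_le_mul_of_one_le_of_one_le (by linarith [Real.pi_gt_three]) hz))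
  simpa [enorm_smul, mul_comm] using
    lintegral_comp_sub_mul_enorm_le_vortConst hω₁ hω₂ hφ measurable_eulerField.enorm
      measurableSet_ball zero_le_one (lintegral_ball_enorm_eulerField 1).le hfar p

lemma integrable_smul_eulerField (hω₁ : MemLp ω 1 volume) (hω₂ : MemLp ω ⊤ volume)
    (hφ : MeasurePreserving φ volume volume) (p : Plane) :
    Integrable fun y => ω y • eulerField (p - φ y) :=
  ⟨hω₁.1.smul (measurable_eulerField.comp (hφ.measurable.const_sub p)).aestronglyMeasurable,
    (lintegral_enorm_smul_eulerField_le hω₁ hω₂ hφ p).trans_lt ENNReal.ofReal_lt_top⟩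

lemma norm_integral_smul_eulerField_le (hω₁ : MemLp ω 1 volume) (hω₂ : MemLp ω ⊤ volume)
    (hφ : MeasurePreserving φ volume volume) (p : Plane) :
    ‖∫ y, ω y • eulerField (p - φ y)‖ ≤ vortConst ω :=
  norm_integral_le_of_lintegral_enorm_le (vortConst_nonneg ω)
    (lintegral_enorm_smul_eulerField_le hω₁ hω₂ hφ p)

lemma lintegral_eulerMajorant_mul_enorm_le (hω₁ : MemLp ω 1 volume) (hω₂ : MemLp ω ⊤ volume)
    (hφ : MeasurePreserving φ volume volume) (p : Plane) (N : ℕ) {D : ℝ} (hD : 0 ≤ D) :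
    ∫⁻ y, ENNReal.ofReal (eulerMajorant N D (p - φ y)) * ‖ω y‖ₑ ≤
      ENNReal.ofReal (vortConst ω * logMod N D) :=
  lintegral_comp_sub_mul_enorm_le_vortConst hω₁ hω₂ hφ
    (measurable_eulerMajorant N D).ennreal_ofReal measurableSet_ball (logMod_nonneg N hD)
    (lintegral_ball_eulerMajorant_le N hD)
    (fun _ hz => ENNReal.ofReal_le_ofReal
      (eulerMajorant_le_logMod hD (not_lt.1 (mem_ball_zero_iff.not.1 hz)))) p

lemma norm_integral_smul_eulerField_sub_le (hω₁ : MemLp ω 1 volume) (hω₂ : MemLp ω ⊤ volume)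
    (hφ : MeasurePreserving φ volume volume) (hψ : MeasurePreserving ψ volume volume)
    {p p' : Plane} {D : ℝ} (hD : ∀ y, ‖p - φ y - (p' - ψ y)‖ ≤ D) (N : ℕ) :
    ‖(∫ y, ω y • eulerField (p - φ y)) - ∫ y, ω y • eulerField (p' - ψ y)‖ ≤
      2 * vortConst ω * logMod N D := by
  have hD0 : 0 ≤ D := (norm_nonneg _).trans (hD 0)
  have hC : 0 ≤ vortConst ω * logMod N D :=
    mul_nonneg (vortConst_nonneg ω) (logMod_nonneg N hD0)
  have hmeas : Measurable fun y => ENNReal.ofReal (eulerMajorant N D (p' - ψ y)) :=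
    ((measurable_eulerMajorant N D).comp (hψ.measurable.const_sub p')).ennreal_ofReal
  rw [← integral_sub (integrable_smul_eulerField hω₁ hω₂ hφ p)
    (integrable_smul_eulerField hω₁ hω₂ hψ p'), mul_assoc, two_mul]
  refine norm_integral_le_of_lintegral_enorm_le (add_nonneg hC hC) ?_
  calc ∫⁻ y, ‖ω y • eulerField (p - φ y) - ω y • eulerField (p' - ψ y)‖ₑ
      ≤ ∫⁻ y, ENNReal.ofReal (eulerMajorant N D (p - φ y)) * ‖ω y‖ₑ +
          ENNReal.ofReal (eulerMajorant N D (p' - ψ y)) * ‖ω y‖ₑ := by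
        refine lintegral_mono fun y => ?_
        rw [← smul_sub, enorm_smul, mul_comm, ← add_mul,
          ← ENNReal.ofReal_add (eulerMajorant_nonneg N hD0 _) (eulerMajorant_nonneg N hD0 _),
          ← ofReal_norm (eulerField _ - _)]
        gcongr
        exact norm_eulerField_sub_le_eulerMajorant N (hD y)
    _ = (∫⁻ y, ENNReal.ofReal (eulerMajorant N D (p - φ y)) * ‖ω y‖ₑ) +
          ∫⁻ y, ENNReal.ofReal (eulerMajorant N D (p' - ψ y)) * ‖ω y‖ₑ :=
        lintegral_add_right' _ (hmeas.aemeasurable.mul hω₁.1.enorm)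
    _ ≤ ENNReal.ofReal (vortConst ω * logMod N D + vortConst ω * logMod N D) := by
        rw [ENNReal.ofReal_add hC hC]
        exact add_le_add (lintegral_eulerMajorant_mul_enorm_le hω₁ hω₂ hφ p N hD0)
          (lintegral_eulerMajorant_mul_enorm_le hω₁ hω₂ hψ p' N hD0)

lemma integrable_smul_blobField (hω₁ : MemLp ω 1 volume) (hφ : Measurable φ) (p : Plane) {α : ℝ}
    (hα : 0 < α) : Integrable fun y => ω y • blobField α (p - φ y) :=
  (memLp_one_iff_integrable.1 hω₁).smul_of_top_left <| memLp_top_of_bound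
    ((blobMap hα).continuous.measurable.comp (hφ.const_sub p)).aestronglyMeasurable
    ‖blobMap hα‖ (.of_forall fun _ => (blobMap hα).norm_coe_le_norm _)

lemma norm_eulerField_sub_blobField_le_sqrt {α : ℝ} (hα : 0 < α) {z : Plane}
    (hz : Real.sqrt α ≤ ‖z‖) : ‖eulerField z - blobField α z‖ ≤ 4 * Real.sqrt α := by
  have hsqrt : 0 < Real.sqrt α := Real.sqrt_pos.2 hα
  calc ‖eulerField z - blobField α z‖ ≤ 4 * α ^ 2 / ‖z‖ ^ 3 :=
        norm_eulerField_sub_blobField_le_inv_cube hα (norm_pos_iff.1 (hsqrt.trans_le hz))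
    _ ≤ 4 * α ^ 2 / Real.sqrt α ^ 3 := by gcongr
    _ = 4 * Real.sqrt α := by
        rw [div_eq_iff (by positivity)]
        nth_rewrite 1 [← Real.sq_sqrt hα.le]
        ring

lemma norm_integral_smul_blobField_sub_le (hω₁ : MemLp ω 1 volume) (hω₂ : MemLp ω ⊤ volume)
    (hφ : MeasurePreserving φ volume volume) (p : Plane) {α : ℝ} (hα : 0 < α) :
    ‖(∫ y, ω y • blobField α (p - φ y)) - ∫ y, ω y • eulerField (p - φ y)‖ ≤
      vortConst ω * (4 * Real.sqrt α) := by
  have hmeas : Measurable fun z => ‖eulerField z - blobField α z‖ₑ :=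
    (measurable_eulerField.sub (blobMap hα).continuous.measurable).enorm
  have hnear (z : Plane) : ‖eulerField z - blobField α z‖ₑ ≤ ‖eulerField z‖ₑ := by
    rcases eq_or_ne z 0 with rfl | hz
    · simp [blobField_zero, eulerField]
    · exact enorm_le_iff_norm_le.2 (norm_eulerField_sub_blobField_le hα hz)
  have hball : ∫⁻ z in Metric.ball 0 (Real.sqrt α), ‖eulerField z - blobField α z‖ₑ ≤
      ENNReal.ofReal (4 * Real.sqrt α) :=
    ((lintegral_mono hnear).trans_eq (lintegral_ball_enorm_eulerField _)).trans
      (ENNReal.ofReal_le_ofReal (by linarith [Real.sqrt_nonneg α]))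
  have hfar : ∀ z ∉ Metric.ball (0 : Plane) (Real.sqrt α),
      ‖eulerField z - blobField α z‖ₑ ≤ ENNReal.ofReal (4 * Real.sqrt α) := fun z hz => by
    rw [mem_ball_zero_iff, not_lt] at hz
    rw [← ofReal_norm]
    exact ENNReal.ofReal_le_ofReal (norm_eulerField_sub_blobField_le_sqrt hα hz)
  rw [norm_sub_rev, ← integral_sub (integrable_smul_eulerField hω₁ hω₂ hφ p)
    (integrable_smul_blobField hω₁ hφ.measurable p hα)]
  refine norm_integral_le_of_lintegral_enorm_le
    (mul_nonneg (vortConst_nonneg ω) (by positivity)) ?_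
  simpa only [← smul_sub, enorm_smul, mul_comm ‖ω _‖ₑ] using
    lintegral_comp_sub_mul_enorm_le_vortConst hω₁ hω₂ hφ hmeas measurableSet_ball (by positivity)
      hball hfar p

end TransportedVorticity

/-! ### Blob flows of a bounded integrable vorticity -/

namespace IsEulerFlow

variable {ω : Plane → ℝ} {η : ℝ → Plane ≃ₜ Plane}

lemma logLipschitzWith_integral_smul_eulerField (hη : IsEulerFlow ω η) (hω₁ : MemLp ω 1 volume)
    (hω₂ : MemLp ω ⊤ volume) (t : ℝ) :
    LogLipschitzWith (2 * vortConst ω) fun p => ∫ y, ω y • eulerField (p - η t y) where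
  nonneg := mul_nonneg zero_le_two (vortConst_nonneg ω)
  norm_sub_le N p p' := norm_integral_smul_eulerField_sub_le hω₁ hω₂ (hη.measurePreserving t)
    (hη.measurePreserving t) (fun y => by rw [sub_sub_sub_cancel_right]) N

/-- The velocity of the Euler flow `η` in Lagrangian coordinates: its value at `x` is the velocity
of the particle `η t x`. -/
def velocity (hη : IsEulerFlow ω η) (hω₁ : MemLp ω 1 volume) (hω₂ : MemLp ω ⊤ volume) (t : ℝ) :
    Plane →ᵇ Plane :=
  .ofNormedAddCommGroup (fun x => ∫ y, ω y • eulerField (η t x - η t y))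
    ((hη.logLipschitzWith_integral_smul_eulerField hω₁ hω₂ t).uniformContinuous.continuous.comp
      (η t).continuous) (vortConst ω)
    fun x => norm_integral_smul_eulerField_le hω₁ hω₂ (hη.measurePreserving t) (η t x)

lemma norm_velocity_le (hη : IsEulerFlow ω η) (hω₁ : MemLp ω 1 volume) (hω₂ : MemLp ω ⊤ volume)
    (t : ℝ) (x : Plane) : ‖hη.velocity hω₁ hω₂ t x‖ ≤ vortConst ω :=
  norm_integral_smul_eulerField_le hω₁ hω₂ (hη.measurePreserving t) (η t x)

lemma hasDerivAt_velocity (hη : IsEulerFlow ω η) (hω₁ : MemLp ω 1 volume)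
    (hω₂ : MemLp ω ⊤ volume) (x : Plane) (t : ℝ) :
    HasDerivAt (fun s => η s x) (hη.velocity hω₁ hω₂ t x) t := by
  have hderiv := hη.hasDerivAt x t
  simp only [eulerKernel_eq] at hderiv
  exact hderiv

lemma norm_integral_smul_eulerField_sub_velocity_le (hη : IsEulerFlow ω η)
    (hω₁ : MemLp ω 1 volume) (hω₂ : MemLp ω ⊤ volume) {X Y : Plane →ᵇ Plane} {t : ℝ}
    (hX : ∀ x, dispMap X x = η t x) (hY : MeasurePreserving (dispMap Y) volume volume) (x : Plane)
    (N : ℕ) :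
    ‖(∫ y, ω y • eulerField (dispMap Y x - dispMap Y y)) - hη.velocity hω₁ hω₂ t x‖ ≤
      4 * vortConst ω * logMod N ‖Y - X‖ :=
  have hC := vortConst_nonneg ω
  calc ‖(∫ y, ω y • eulerField (dispMap Y x - dispMap Y y)) - hη.velocity hω₁ hω₂ t x‖
      ≤ 2 * vortConst ω * logMod N (2 * ‖Y - X‖) :=
        norm_integral_smul_eulerField_sub_le hω₁ hω₂ hY (hη.measurePreserving t)
          (fun y => by simpa only [hX] using norm_dispMap_sub_sub_le Y X x y) N
    _ ≤ 2 * vortConst ω * (2 * logMod N ‖Y - X‖) := by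
        gcongr; exact logMod_mul_le N one_le_two
    _ = 4 * vortConst ω * logMod N ‖Y - X‖ := by ring

lemma continuous_velocity (hη : IsEulerFlow ω η) (hω₁ : MemLp ω 1 volume)
    (hω₂ : MemLp ω ⊤ volume) {X : ℝ → Plane →ᵇ Plane} (hXcont : Continuous X)
    (hX : ∀ t x, dispMap (X t) x = η t x) : Continuous (hη.velocity hω₁ hω₂) := by
  have hmod (s t : ℝ) (N : ℕ) : ‖hη.velocity hω₁ hω₂ s - hη.velocity hω₁ hω₂ t‖ ≤
      4 * vortConst ω * logMod N ‖X s - X t‖ := by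
    have hC := vortConst_nonneg ω
    have hflow : ⇑(dispMap (X s)) = η s := funext (hX s)
    have hnonneg := logMod_nonneg N (norm_nonneg (X s - X t))
    refine (BoundedContinuousFunction.norm_le (by positivity)).2 fun x => ?_
    have h := hη.norm_integral_smul_eulerField_sub_velocity_le hω₁ hω₂ (hX t)
      (hflow ▸ hη.measurePreserving s) x N
    rwa [hflow] at h
  refine continuous_iff_continuousAt.2 fun t => Metric.tendsto_nhds.2 fun ε hε => ?_
  obtain ⟨δ, hδ, N, hN⟩ :=
    exists_forall_lt_mul_logMod_lt (mul_nonneg zero_le_four (vortConst_nonneg ω)) hε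
  filter_upwards [Metric.tendsto_nhds.1 (hXcont.tendsto t) δ hδ] with s hs
  rw [dist_eq_norm] at hs ⊢
  exact (hmod s t N).trans_lt (hN _ hs)

lemma exists_displacement (hη : IsEulerFlow ω η) (hω₁ : MemLp ω 1 volume)
    (hω₂ : MemLp ω ⊤ volume) :
    ∃ X : ℝ → Plane →ᵇ Plane, X 0 = 0 ∧ (∀ t x, dispMap (X t) x = η t x) ∧
      ∀ t, HasDerivAt X (hη.velocity hω₁ hω₂ t) t := by
  obtain ⟨X, hX0, hXlip, hX⟩ := exists_lipschitzWith_dispMap_eq (fun t => (η t).continuous)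
    hη.initial (hη.hasDerivAt_velocity hω₁ hω₂) (hη.norm_velocity_le hω₁ hω₂)
  have hXapp (t : ℝ) (x : Plane) : X t x = η t x - x := by
    rw [← hX, dispMap_apply, add_sub_cancel_left]
  refine ⟨X, hX0, hX, hasDerivAt_of_continuous_of_hasDerivAt_apply
    (hη.continuous_velocity hω₁ hω₂ hXlip.continuous hX) fun t x => ?_⟩
  simpa only [hXapp] using (hη.hasDerivAt_velocity hω₁ hω₂ x t).sub_const x

lemma norm_lagrangianField_blobMap_sub_velocity_le (hη : IsEulerFlow ω η)
    (hω₁ : MemLp ω 1 volume) (hω₂ : MemLp ω ⊤ volume) {α : ℝ} (hα : 0 < α)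
    {X Y : Plane →ᵇ Plane} {t : ℝ} (hX : ∀ x, dispMap X x = η t x)
    (hY : MeasurePreserving (dispMap Y) volume volume) (N : ℕ) :
    ‖lagrangianField (blobMap hα) (volume.withDensityᵥ ω) (ContinuousMap.id Plane) Y -
        hη.velocity hω₁ hω₂ t‖ ≤
      4 * vortConst ω * logMod N ‖Y - X‖ + vortConst ω * (4 * Real.sqrt α) := by
  have hC := vortConst_nonneg ω
  have hmod := logMod_nonneg N (norm_nonneg (Y - X))
  have hblob (x : Plane) : lagrangianField (blobMap hα) (volume.withDensityᵥ ω)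
      (ContinuousMap.id Plane) Y x = ∫ y, ω y • blobField α (dispMap Y x - dispMap Y y) :=
    vectorIntegral_withDensityᵥ (memLp_one_iff_integrable.1 hω₁)
      ((blobMap hα).continuous.comp (by fun_prop)).aestronglyMeasurable
      (integrable_smul_blobField hω₁ hY.measurable _ hα)
  refine (BoundedContinuousFunction.norm_le (by positivity)).2 fun x => ?_
  rw [BoundedContinuousFunction.sub_apply, hblob, add_comm]
  exact (norm_sub_le_norm_sub_add_norm_sub _ _ _).trans (add_le_add
    (norm_integral_smul_blobField_sub_le hω₁ hω₂ hY _ hα)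
    (hη.norm_integral_smul_eulerField_sub_velocity_le hω₁ hω₂ hX hY x N))

theorem exists_tendstoUniformlyOn_blobDisplacement (hη : IsEulerFlow ω η)
    (hω₁ : MemLp ω 1 volume) (hω₂ : MemLp ω ⊤ volume) (T : ℝ) :
    ∃ X : ℝ → Plane →ᵇ Plane, (∀ t x, dispMap (X t) x = η t x) ∧
      ∀ {ι : Type} {l : Filter ι} {α : ι → ℝ} (hα : ∀ i, 0 < α i), Tendsto α l (𝓝 0) →
        TendstoUniformlyOn (fun i => blobDisplacement (hα i) (volume.withDensityᵥ ω)) X l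
          (Set.Icc (-T) T) := by
  obtain ⟨X, hX0, hX, hXderiv⟩ := hη.exists_displacement hω₁ hω₂
  refine ⟨X, hX, fun {ι l α} hα hlim => ?_⟩
  set Y := fun i => blobDisplacement (hα i) (volume.withDensityᵥ ω)
  have hYmeas (i : ι) (t : ℝ) : MeasurePreserving (dispMap (Y i t)) volume volume :=
    (admissibleKernel_blobMap (hα i)).measurePreserving_flow t
  have hsmall : Tendsto (fun i => vortConst ω * (4 * Real.sqrt (α i))) l (𝓝 0) := by
    simpa using (hlim.sqrt.const_mul 4).const_mul (vortConst ω)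
  have hosgood := tendstoUniformlyOn_zero_of_logMod (T := T) (f := fun i t => Y i t - X t)
    (mul_nonneg zero_le_four (vortConst_nonneg ω)) (hsmall.tendstoUniformlyOn_const _)
    (by simpa [Y, blobDisplacement, hX0, AdmissibleKernel.displacement_zero] using
      tendsto_const_nhds)
    (fun i t => ((admissibleKernel_blobMap (hα i)).isIntegralCurve_displacement t).sub (hXderiv t))
    (fun i t => hη.norm_lagrangianField_blobMap_sub_velocity_le hω₁ hω₂ (hα i) (hX t) (hYmeas i t))
  simpa [Metric.tendstoUniformlyOn_iff, dist_eq_norm, norm_sub_rev] using hosgood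

end IsEulerFlow

/-! ### Weak convergence without loss of mass -/

section Mass

variable {Λ : Type*} [MeasurableSpace Λ] {q : SignedMeasure Λ}

lemma variation_real_univ_sub_vectorIntegral {f : Λ → ℝ} (hf : Integrable f q.variation) :
    q.variation.real Set.univ - ∫ᵛ y, f y ∂<•q =
      ∫ y, (1 - polarSign q y * f y) ∂q.variation := by
  rw [vectorIntegral_eq_integral_polarSign_smul q hf]
  simp_rw [← smul_eq_mul]
  rw [integral_sub (integrable_const 1) (integrable_polarSign_smul q hf), integral_const,
    smul_eq_mul, mul_one]

lemma vectorIntegral_comp_comm {E F : Type*} [NormedAddCommGroup E] [NormedSpace ℝ E]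
    [CompleteSpace E] [NormedAddCommGroup F] [NormedSpace ℝ F] [CompleteSpace F] (A : E →L[ℝ] F)
    {f : Λ → E} (hf : Integrable f q.variation) :
    ∫ᵛ y, A (f y) ∂<•q = A (∫ᵛ y, f y ∂<•q) := by
  rw [vectorIntegral_eq_integral_polarSign_smul q hf,
    vectorIntegral_eq_integral_polarSign_smul q (A.integrable_comp hf),
    ← A.integral_comp_comm (integrable_polarSign_smul q hf)]
  simp only [map_smul]

lemma norm_vectorIntegral_sub_abs_smul_le {E : Type*} [NormedAddCommGroup E] [NormedSpace ℝ E]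
    {f : Λ → ℝ} (hf : Integrable f q.variation) (hf1 : ∀ y, |f y| ≤ 1) {u : Λ → E}
    (hu : Integrable u q.variation) {c : ℝ} (hc : ∀ y, ‖u y‖ ≤ c) :
    ‖(∫ᵛ y, u y ∂<•q) - ∫ᵛ y, |f y| • u y ∂<•q‖ ≤
      c * (q.variation.real Set.univ - ∫ᵛ y, f y ∂<•q) := by
  have hfu : Integrable (fun y => |f y| • u y) q.variation :=
    hu.bdd_smul 1 hf.abs.aestronglyMeasurable (.of_forall fun y => by simpa using hf1 y)
  rw [← VectorMeasure.integral_fun_sub hu hfu, variation_real_univ_sub_vectorIntegral hf,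
    ← integral_const_mul]
  refine (norm_vectorIntegral_le q _).trans (integral_mono_ae (hu.sub hfu).norm
    (((integrable_const 1).sub (integrable_polarSign_smul q hf)).const_mul c) ?_)
  filter_upwards [abs_polarSign q] with y hy
  have hle : polarSign q y * f y ≤ |f y| := by
    simpa [abs_mul, hy] using le_abs_self (polarSign q y * f y)
  calc ‖u y - |f y| • u y‖ = (1 - |f y|) * ‖u y‖ := by
        rw [← norm_smul_of_nonneg (sub_nonneg.2 (hf1 y)), sub_smul, one_smul]
    _ ≤ (1 - |f y|) * c := mul_le_mul_of_nonneg_left (hc y) (sub_nonneg.2 (hf1 y))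
    _ ≤ (1 - polarSign q y * f y) * c := by
        gcongr
        exact (norm_nonneg _).trans (hc y)
    _ = c * (1 - polarSign q y * f y) := mul_comm _ _

lemma one_sub_mul_clamp_le_abs_sub {s a : ℝ} (hs : |s| = 1) :
    1 - s * max (-1) (min 1 a) ≤ |s - a| := by
  rcases eq_or_eq_neg_of_abs_eq hs with rfl | rfl <;>
    rcases max_cases (-1) (min 1 a) with ⟨h, _⟩ | ⟨h, _⟩ <;>
    rcases min_cases 1 a with ⟨h', _⟩ | ⟨h', _⟩ <;>
    rw [h] <;> grind

variable [PseudoMetricSpace Λ] [ProperSpace Λ] [BorelSpace Λ]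

lemma exists_hasCompactSupport_variation_sub_le (q : SignedMeasure Λ) {ε : ℝ} (hε : 0 < ε) :
    ∃ φ : Λ →ᵇ ℝ, HasCompactSupport φ ∧ ‖φ‖ ≤ 1 ∧
      q.variation.real Set.univ - ∫ᵛ y, φ y ∂<•q ≤ ε := by
  obtain ⟨a, hac, hle, hcont, haint⟩ :=
    (SignedMeasure.integrable_rnDeriv q q.variation).exists_hasCompactSupport_integral_sub_le hε
  have hbound (y : Λ) : ‖max (-1) (min 1 (a y))‖ ≤ 1 := by
    rw [Real.norm_eq_abs, abs_le]
    exact ⟨le_max_left _ _, max_le (by norm_num) (min_le_left _ _)⟩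
  set φ : Λ →ᵇ ℝ := .ofNormedAddCommGroup (fun y => max (-1) (min 1 (a y))) (by fun_prop) 1 hbound
  have hφ : Integrable φ q.variation := φ.integrable _
  refine ⟨φ, hac.comp_left (g := fun r => max (-1) (min 1 r)) (by norm_num),
    BoundedContinuousFunction.norm_ofNormedAddCommGroup_le _ zero_le_one _, ?_⟩
  rw [variation_real_univ_sub_vectorIntegral hφ]
  refine (integral_mono_ae ((integrable_const 1).sub (integrable_polarSign_smul q hφ))
    ((SignedMeasure.integrable_rnDeriv q _).sub haint).norm ?_).trans hle
  filter_upwards [abs_polarSign q] with y hy using one_sub_mul_clamp_le_abs_sub hy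

end Mass

section Convergence

variable {Λ : Type*} [PseudoMetricSpace Λ] [MeasurableSpace Λ]

/-- The signed measures `q n` converge to `q'` when tested on continuous compactly supported
functions, and their total masses converge to the total mass of `q'`: no mass is lost at infinity
or by cancellation. -/
structure ConvergesWithMass (q : ℕ → SignedMeasure Λ) (q' : SignedMeasure Λ) : Prop where
  tendsto_vectorIntegral : ∀ φ : Λ → ℝ, Continuous φ → HasCompactSupport φ →
    Tendsto (fun n => ∫ᵛ y, φ y ∂<•q n) atTop (𝓝 (∫ᵛ y, φ y ∂<•q'))
  tendsto_mass :
    Tendsto (fun n => (q n).variation.real Set.univ) atTop (𝓝 (q'.variation.real Set.univ))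

namespace ConvergesWithMass

variable {q : ℕ → SignedMeasure Λ} {q' : SignedMeasure Λ}

lemma exists_mass_le (h : ConvergesWithMass q q') :
    ∃ M, q'.variation.real Set.univ ≤ M ∧ ∀ n, (q n).variation.real Set.univ ≤ M := by
  obtain ⟨M, hM⟩ := h.tendsto_mass.bddAbove_range
  have hle (n : ℕ) := hM (Set.mem_range_self n)
  exact ⟨M, le_of_tendsto' h.tendsto_mass hle, hle⟩

variable [ProperSpace Λ] [BorelSpace Λ] {E : Type*} [NormedAddCommGroup E] [NormedSpace ℝ E]

lemma tendsto_vectorIntegral_of_hasCompactSupport [FiniteDimensional ℝ E]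
    (h : ConvergesWithMass q q') {f : Λ → E} (hf : Continuous f) (hfc : HasCompactSupport f) :
    Tendsto (fun n => ∫ᵛ y, f y ∂<•q n) atTop (𝓝 (∫ᵛ y, f y ∂<•q')) := by
  have := FiniteDimensional.complete ℝ E
  let b := Module.finBasis ℝ E
  rw [b.equivFunL.toHomeomorph.isInducing.tendsto_nhds_iff, tendsto_pi_nhds]
  intro i
  let coord : E →L[ℝ] ℝ := .comp (.proj i) (b.equivFunL : E →L[ℝ] Fin _ → ℝ)
  have hcoord (p : SignedMeasure Λ) : b.equivFunL (∫ᵛ y, f y ∂<•p) i = ∫ᵛ y, coord (f y) ∂<•p :=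
    (vectorIntegral_comp_comm coord (hf.integrable_of_hasCompactSupport hfc)).symm
  simp only [Function.comp_apply, ContinuousLinearEquiv.coe_toHomeomorph, hcoord]
  exact h.tendsto_vectorIntegral _ (coord.continuous.comp hf) (hfc.comp_left (map_zero coord))

lemma tendstoUniformlyOn_of_isCompact [FiniteDimensional ℝ E] (h : ConvergesWithMass q q')
    {S : Set (Λ →ᵇ E)} (hS : IsCompact S) (hSc : ∀ f ∈ S, HasCompactSupport f) :
    TendstoUniformlyOn (fun n (f : Λ →ᵇ E) => ∫ᵛ y, f y ∂<•q n) (fun f => ∫ᵛ y, f y ∂<•q')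
      atTop S := by
  obtain ⟨M, hM', hM⟩ := h.exists_mass_le
  have hM0 : 0 ≤ M := measureReal_nonneg.trans hM'
  have hint (p : SignedMeasure Λ) (f : Λ →ᵇ E) : Integrable f p.variation :=
    .of_bound f.continuous.aestronglyMeasurable ‖f‖ (.of_forall f.norm_coe_le_norm)
  have hlip {p : SignedMeasure Λ} (hp : p.variation.real Set.univ ≤ M) (f f₀ : Λ →ᵇ E) :
      dist (∫ᵛ y, f y ∂<•p) (∫ᵛ y, f₀ y ∂<•p) ≤ dist f f₀ * M := by
    rw [dist_eq_norm, dist_eq_norm, ← VectorMeasure.integral_fun_sub (hint p f) (hint p f₀)]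
    exact (norm_vectorIntegral_le_of_norm_le (f - f₀).norm_coe_le_norm).trans (by gcongr)
  rw [← tendstoLocallyUniformlyOn_iff_tendstoUniformlyOn_of_compact hS,
    Metric.tendstoLocallyUniformlyOn_iff]
  intro ε hε f₀ hf₀
  refine ⟨_, inter_mem_nhdsWithin S (Metric.ball_mem_nhds f₀ (ε := ε / (4 * (M + 1)))
    (by positivity)), ?_⟩
  have hpt := h.tendsto_vectorIntegral_of_hasCompactSupport f₀.continuous (hSc f₀ hf₀)
  filter_upwards [Metric.tendsto_nhds.1 hpt (ε / 4) (by positivity)] with n hn f hf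
  have hclose : dist f f₀ * M ≤ ε / 4 :=
    calc dist f f₀ * M ≤ ε / (4 * (M + 1)) * (M + 1) := by
          gcongr
          exacts [(Metric.mem_ball.1 hf.2).le, (lt_add_one M).le]
      _ = ε / 4 := by field_simp
  have htri := dist_triangle4 (∫ᵛ y, f y ∂<•q') (∫ᵛ y, f₀ y ∂<•q') (∫ᵛ y, f₀ y ∂<•q n)
    (∫ᵛ y, f y ∂<•q n)
  rw [dist_comm (∫ᵛ y, f₀ y ∂<•q') (∫ᵛ y, f₀ y ∂<•q n),
    dist_comm (∫ᵛ y, f₀ y ∂<•q n) (∫ᵛ y, f y ∂<•q n)] at htri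
  linarith [hlip hM' f f₀, hlip (hM n) f f₀]

end ConvergesWithMass

end Convergence

section TruncatedKernel

open scoped Pointwise

variable {Λ E : Type*} [TopologicalSpace Λ] [NormedAddCommGroup E] [NormedSpace ℝ E]

/-- The contribution to the velocity at the point `z`, per unit of vorticity on the label `y`, when
the particle `x` sits at `x + X x`; the labels are cut off by the weight `|φ|`. -/
def truncatedKernel (φ : Λ →ᵇ ℝ) (k : E →ᵇ E) (g : C(Λ, E)) (z : E) (X : E →ᵇ E) : Λ →ᵇ E :=
  .ofNormedAddCommGroup (fun y => |φ y| • k (z - dispMap X (g y))) (by fun_prop) (‖φ‖ * ‖k‖)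
    fun y => by
      rw [norm_smul, Real.norm_eq_abs, abs_abs]
      exact mul_le_mul (φ.norm_coe_le_norm y) (k.norm_coe_le_norm _) (norm_nonneg _)
        (norm_nonneg _)

variable {φ : Λ →ᵇ ℝ} {k : E →ᵇ E} {g : C(Λ, E)}

lemma truncatedKernel_apply (z : E) (X : E →ᵇ E) (y : Λ) :
    truncatedKernel φ k g z X y = |φ y| • k (z - dispMap X (g y)) := rfl

lemma hasCompactSupport_truncatedKernel (hφ : HasCompactSupport φ) (z : E) (X : E →ᵇ E) :
    HasCompactSupport (truncatedKernel φ k g z X) :=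
  (hφ.comp_left (g := fun r : ℝ => |r|) abs_zero).smul_right

lemma continuous_truncatedKernel (hk : UniformContinuous k) (hφ : ‖φ‖ ≤ 1) :
    Continuous fun p : E × (E →ᵇ E) => truncatedKernel φ k g p.1 p.2 := by
  refine continuous_iff_continuousAt.2 fun p₀ => Metric.tendsto_nhds.2 fun ε hε => ?_
  obtain ⟨δ, hδ, hkδ⟩ := Metric.uniformContinuous_iff.1 hk (ε / 2) (half_pos hε)
  filter_upwards [Metric.ball_mem_nhds p₀ (half_pos hδ)] with p hp
  rw [Metric.mem_ball, Prod.dist_eq, max_lt_iff] at hp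
  refine lt_of_le_of_lt ((BoundedContinuousFunction.dist_le (half_pos hε).le).2 fun y => ?_)
    (half_lt_self hε)
  have hclose : dist (p.1 - dispMap p.2 (g y)) (p₀.1 - dispMap p₀.2 (g y)) < δ :=
    calc dist (p.1 - dispMap p.2 (g y)) (p₀.1 - dispMap p₀.2 (g y))
        ≤ dist p.1 p₀.1 + dist (dispMap p.2 (g y)) (dispMap p₀.2 (g y)) := dist_sub_sub_le _ _ _ _
      _ = dist p.1 p₀.1 + dist (p.2 (g y)) (p₀.2 (g y)) := by
          simp only [dispMap_apply, dist_add_left]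
      _ < δ / 2 + δ / 2 :=
          add_lt_add_of_lt_of_le hp.1 ((BoundedContinuousFunction.dist_coe_le_dist _).trans hp.2.le)
      _ = δ := add_halves δ
  calc dist (truncatedKernel φ k g p.1 p.2 y) (truncatedKernel φ k g p₀.1 p₀.2 y)
      = |φ y| * dist (k (p.1 - dispMap p.2 (g y))) (k (p₀.1 - dispMap p₀.2 (g y))) := by
        rw [truncatedKernel_apply, truncatedKernel_apply, dist_smul₀, Real.norm_eq_abs, abs_abs]
    _ ≤ 1 * (ε / 2) :=
        mul_le_mul ((φ.norm_coe_le_norm y).trans hφ) (hkδ hclose).le dist_nonneg zero_le_one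
    _ = ε / 2 := one_mul _

variable {P : Type*} [TopologicalSpace P] [CompactSpace P] {X : P → E →ᵇ E}

lemma tendsto_truncatedKernel_cocompact (hk : Tendsto k (cocompact E) (𝓝 0))
    (hφc : HasCompactSupport φ) (hφ : ‖φ‖ ≤ 1) (hX : Continuous X) :
    Tendsto (fun p : E × P => truncatedKernel φ k g p.1 (X p.2)) (cocompact (E × P)) (𝓝 0) := by
  refine Metric.tendsto_nhds.2 fun ε hε => ?_
  obtain ⟨A, hA, hAk⟩ := mem_cocompact.1 (Metric.tendsto_nhds.1 hk (ε / 2) (half_pos hε))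
  have hpos : Continuous fun v : Λ × P => dispMap (X v.2) (g v.1) := by
    simp only [dispMap_apply]; fun_prop
  set B := (fun v : Λ × P => dispMap (X v.2) (g v.1)) '' (tsupport φ ×ˢ Set.univ)
  have hB : IsCompact B := (hφc.isCompact.prod isCompact_univ).image hpos
  refine mem_cocompact.2 ⟨(A + B) ×ˢ Set.univ, (hA.add hB).prod isCompact_univ, fun p hp => ?_⟩
  refine lt_of_le_of_lt ((BoundedContinuousFunction.dist_le (half_pos hε).le).2 fun y => ?_)
    (half_lt_self hε)
  rw [truncatedKernel_apply, BoundedContinuousFunction.coe_zero, Pi.zero_apply, dist_zero_right,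
    norm_smul, Real.norm_eq_abs, abs_abs]
  rcases eq_or_ne (φ y) 0 with hy | hy
  · simpa [hy] using (half_pos hε).le
  have hfar : p.1 - dispMap (X p.2) (g y) ∉ A := fun hmem => hp
    ⟨⟨_, hmem, _, ⟨(y, p.2), ⟨subset_tsupport _ hy, trivial⟩, rfl⟩, sub_add_cancel _ _⟩, trivial⟩
  have hsmall : ‖k (p.1 - dispMap (X p.2) (g y))‖ ≤ ε / 2 := by
    simpa using (show dist _ _ < _ from hAk hfar).le
  exact (mul_le_of_le_one_left (norm_nonneg _) ((φ.norm_coe_le_norm y).trans hφ)).trans hsmall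

lemma isCompact_insert_range_truncatedKernel (huc : UniformContinuous k)
    (hk : Tendsto k (cocompact E) (𝓝 0)) (hφc : HasCompactSupport φ) (hφ : ‖φ‖ ≤ 1)
    (hX : Continuous X) :
    IsCompact (insert 0 (Set.range fun p : E × P => truncatedKernel φ k g p.1 (X p.2))) :=
  (tendsto_truncatedKernel_cocompact hk hφc hφ hX).isCompact_insert_range_of_cocompact
    ((continuous_truncatedKernel huc hφ).comp
      (by fun_prop : Continuous fun p : E × P => (p.1, X p.2)))

end TruncatedKernel

namespace ConvergesWithMass

variable {Λ : Type*} [PseudoMetricSpace Λ] [ProperSpace Λ] [MeasurableSpace Λ] [BorelSpace Λ]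
  {q : ℕ → SignedMeasure Λ} {q' : SignedMeasure Λ}

/- The labels outside a large compact set carry little vorticity, uniformly in `n`. The velocities
induced by the other labels are the integrals of the truncated kernels, which form a relatively
compact family because `k` vanishes at infinity. -/
theorem tendstoUniformly_lagrangianField {E : Type*} [NormedAddCommGroup E] [NormedSpace ℝ E]
    [FiniteDimensional ℝ E] (h : ConvergesWithMass q q') {k : E →ᵇ E} (huc : UniformContinuous k)
    (hk : Tendsto k (cocompact E) (𝓝 0)) (g : C(Λ, E)) {P : Type*} [TopologicalSpace P]
    [CompactSpace P] {X : P → E →ᵇ E} (hX : Continuous X) :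
    TendstoUniformly (fun n p => lagrangianField k (q n) g (X p))
      (fun p => lagrangianField k q' g (X p)) atTop := by
  refine Metric.tendstoUniformly_iff.2 fun ε hε => ?_
  set e := ε / (8 * (‖k‖ + 1))
  have he : 0 < e := by positivity
  have hke : ‖k‖ * e ≤ ε / 8 :=
    calc ‖k‖ * e ≤ (‖k‖ + 1) * e := by gcongr; linarith
      _ = ε / 8 := by simp only [e]; field_simp
  obtain ⟨φ, hφc, hφ, hmass⟩ := exists_hasCompactSupport_variation_sub_le q' he
  have hφ1 (y : Λ) : |φ y| ≤ 1 := (φ.norm_coe_le_norm y).trans hφ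
  have hmass_n : ∀ᶠ n in atTop, (q n).variation.real Set.univ - ∫ᵛ y, φ y ∂<•q n < 2 * e :=
    (h.tendsto_mass.sub (h.tendsto_vectorIntegral φ φ.continuous hφc)).eventually_lt_const
      (by linarith)
  have hcompact := isCompact_insert_range_truncatedKernel (g := g) huc hk hφc hφ hX
  have htrunc := Metric.tendstoUniformlyOn_iff.1 (h.tendstoUniformlyOn_of_isCompact hcompact (by
    rintro f (rfl | ⟨p, rfl⟩)
    exacts [.zero, hasCompactSupport_truncatedKernel hφc _ _])) (ε / 2) (half_pos hε)
  filter_upwards [hmass_n, htrunc] with n hn hunif p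
  have htail (q : SignedMeasure Λ) (z : E) :
      dist (∫ᵛ y, k (z - dispMap (X p) (g y)) ∂<•q)
        (∫ᵛ y, truncatedKernel φ k g z (X p) y ∂<•q) ≤
        ‖k‖ * (q.variation.real Set.univ - ∫ᵛ y, φ y ∂<•q) := by
    rw [dist_eq_norm]
    exact norm_vectorIntegral_sub_abs_smul_le
      (.of_bound φ.continuous.aestronglyMeasurable 1 (.of_forall hφ1)) hφ1
      (integrable_kernel_sub k q ((dispMap (X p)).comp g) z) fun y => k.norm_coe_le_norm _
  refine lt_of_le_of_lt ((BoundedContinuousFunction.dist_le (C := 7 / 8 * ε) (by positivity)).2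
    fun x => ?_) (by linarith)
  have hmid := hunif _ (.inr ⟨(dispMap (X p) x, p), rfl⟩)
  have htail_n := (htail (q n) (dispMap (X p) x)).trans
    (mul_le_mul_of_nonneg_left hn.le (norm_nonneg k))
  have htail' := (htail q' (dispMap (X p) x)).trans
    (mul_le_mul_of_nonneg_left hmass (norm_nonneg k))
  rw [dist_comm] at htail_n
  exact (dist_triangle4 _ _ _ _).trans ((add_le_add_three htail' hmid.le htail_n).trans
    (by linarith))

theorem tendstoUniformlyOn_displacement (h : ConvergesWithMass q q') {k : Plane →ᵇ Plane}
    (hk : AdmissibleKernel k) (hk0 : Tendsto k (cocompact Plane) (𝓝 0)) (g : C(Λ, Plane)) (T : ℝ) :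
    TendstoUniformlyOn (fun n => hk.displacement (q n) g) (hk.displacement q' g) atTop
      (Set.Icc (-T) T) := by
  obtain ⟨C, hC⟩ := hk.exists_logLipschitzWith
  obtain ⟨M, -, hM⟩ := h.exists_mass_le
  have hC0 := hC.nonneg
  have hM0 : 0 ≤ M := measureReal_nonneg.trans (hM 0)
  set X := hk.displacement q' g
  have hX : Continuous X :=
    continuous_iff_continuousAt.2 fun t => (hk.isIntegralCurve_displacement t).continuousAt
  have hfield := h.tendstoUniformly_lagrangianField hC.uniformContinuous hk0 g
    (hX.comp (continuous_subtype_val (p := (· ∈ Set.Icc (-T) T))))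
  have hosgood := tendstoUniformlyOn_zero_of_logMod (l := atTop) (T := T) (C := 2 * C * M)
    (f := fun n t => hk.displacement (q n) g t - X t)
    (δ := fun n t => ‖lagrangianField k (q n) g (X t) - lagrangianField k q' g (X t)‖)
    (by positivity) ?_ (by simp [X, hk.displacement_zero])
    (fun n t => (hk.isIntegralCurve_displacement t).sub (hk.isIntegralCurve_displacement t))
    fun n t N => ?_
  · simpa [Metric.tendstoUniformlyOn_iff, dist_eq_norm, norm_sub_rev] using hosgood
  · simpa [Metric.tendstoUniformlyOn_iff, Metric.tendstoUniformly_iff, dist_eq_norm, norm_sub_rev]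
      using hfield
  · set Y := hk.displacement (q n) g t
    have hmod := logMod_nonneg N (norm_nonneg (Y - X t))
    calc ‖lagrangianField k (q n) g Y - lagrangianField k q' g (X t)‖
        ≤ ‖lagrangianField k (q n) g Y - lagrangianField k (q n) g (X t)‖ +
          ‖lagrangianField k (q n) g (X t) - lagrangianField k q' g (X t)‖ :=
          norm_sub_le_norm_sub_add_norm_sub _ _ _
      _ ≤ 2 * C * M * logMod N ‖Y - X t‖ +
          ‖lagrangianField k (q n) g (X t) - lagrangianField k q' g (X t)‖ := by
          gcongr
          refine ((logLipschitzWith_lagrangianField hC (q n) g).norm_sub_le N Y (X t)).trans ?_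
          gcongr
          exact hM n

end ConvergesWithMass

lemma WeaklyConvergesTo.convergesWithMass {q : ℕ → SignedMeasure Plane} {ω : Plane → ℝ}
    (hω : MemLp ω 1 volume) (hweak : WeaklyConvergesTo q ω)
    (hmass : Tendsto (fun n => (q n).totalVariation Set.univ) atTop (𝓝 (eLpNorm ω 1 volume))) :
    ConvergesWithMass q (volume.withDensityᵥ ω) where
  tendsto_vectorIntegral φ hφ hφc := by
    have hωint := memLp_one_iff_integrable.1 hω
    obtain ⟨c, hc⟩ := hφc.exists_bound_of_continuous hφ
    have hint : Integrable (fun y => ω y • φ y) volume :=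
      hωint.mul_bdd (c := c) hφ.aestronglyMeasurable (.of_forall hc)
    rw [vectorIntegral_withDensityᵥ hωint hφ.aestronglyMeasurable hint]
    simpa only [vectorIntegral_lsmul_eq_flip, smul_eq_mul, mul_comm] using hweak φ hφ hφc
  tendsto_mass := by
    have hlim : (volume.withDensityᵥ ω).variation Set.univ = eLpNorm ω 1 volume := by
      rw [Measure.variation_withDensityᵥ (memLp_one_iff_integrable.1 hω), withDensity_apply _ .univ,
        setLIntegral_univ, eLpNorm_one_eq_lintegral_enorm]
    refine (ENNReal.tendsto_toReal (measure_ne_top _ _)).comp ?_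
    simpa only [hlim, SignedMeasure.totalVariation_eq_variation] using hmass

lemma exists_tendsto_atTop_forall_eventually {p : ℕ → ℕ → Prop} (h : ∀ j, ∀ᶠ n in atTop, p j n) :
    ∃ K : ℕ → ℕ, Tendsto K atTop atTop ∧ ∀ᶠ n in atTop, p (K n) n := by
  choose N hN using fun j => eventually_atTop.1 (h j)
  let K n := Nat.findGreatest (fun j => N j ≤ n) n
  have hK : Tendsto K atTop atTop := tendsto_atTop.2 fun j => by
    filter_upwards [eventually_ge_atTop j, eventually_ge_atTop (N j)] with n hj hn
    exact Nat.le_findGreatest hj hn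
  refine ⟨K, hK, ?_⟩
  filter_upwards [hK.eventually_ne_atTop 0] with n hn
  exact hN _ n (Nat.findGreatest_of_ne_zero (P := fun j => N j ≤ n) rfl hn)

lemma exists_tendstoUniformlyOn_diagonal {Y β : Type*} [PseudoMetricSpace β]
    {F : ℕ → ℕ → Y → β} {f : ℕ → Y → β} {f₀ : Y → β} {s : Set Y}
    (hF : ∀ j, TendstoUniformlyOn (F j) (f j) atTop s) (hf : TendstoUniformlyOn f f₀ atTop s) :
    ∃ K : ℕ → ℕ, Tendsto K atTop atTop ∧
      TendstoUniformlyOn (fun n => F (K n) n) f₀ atTop s := by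
  obtain ⟨K, hK, hclose⟩ := exists_tendsto_atTop_forall_eventually fun j =>
    Metric.tendstoUniformlyOn_iff.1 (hF j) (1 / (j + 1)) Nat.one_div_pos_of_nat
  refine ⟨K, hK, Metric.tendstoUniformlyOn_iff.2 fun ε hε => ?_⟩
  filter_upwards [hclose, hK.eventually (Metric.tendstoUniformlyOn_iff.1 hf (ε / 2) (half_pos hε)),
    (tendsto_one_div_add_atTop_nhds_zero_nat.comp hK).eventually_lt_const (half_pos hε)]
    with n hFn hfn hsmall y hy
  calc dist (f₀ y) (F (K n) n y) ≤ dist (f₀ y) (f (K n) y) + dist (f (K n) y) (F (K n) n y) :=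
        dist_triangle _ _ _
    _ < ε / 2 + ε / 2 := add_lt_add (hfn y hy) ((hFn y hy).trans hsmall)
    _ = ε := add_halves ε

lemma tendsto_iSup_enorm_dispMap_sub {E ι S : Type*} [NormedAddCommGroup E] {l : Filter ι}
    {Y : ι → S → E →ᵇ E} {X : S → E →ᵇ E} {s : Set S} (h : TendstoUniformlyOn Y X l s) :
    Tendsto (fun i => ⨆ t ∈ s, ⨆ x, ‖dispMap (Y i t) x - dispMap (X t) x‖ₑ) l (𝓝 0) := by
  refine ENNReal.tendsto_nhds_zero.2 fun ε hε => ?_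
  obtain ⟨δ, hδ, hδε⟩ := ENNReal.lt_iff_exists_nnreal_btwn.1 hε
  filter_upwards [Metric.tendstoUniformlyOn_iff.1 h δ (by exact_mod_cast hδ)] with i hi
  refine iSup₂_le fun t ht => iSup_le fun x => le_trans ?_ hδε.le
  rw [dispMap_apply, dispMap_apply, add_sub_add_left_eq_sub, enorm_le_coe, ← NNReal.coe_le_coe,
    coe_nnnorm, ← dist_eq_norm, dist_comm]
  exact (BoundedContinuousFunction.dist_coe_le_dist x).trans (hi t ht).le

end

theorem mainTheorem2 (ω₀ : Plane → ℝ)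
    (hω₁ : MemLp ω₀ 1 volume) (hω₂ : MemLp ω₀ ⊤ volume)
    (η : ℝ → Plane ≃ₜ Plane) (hη : IsEulerFlow ω₀ η)
    (q₀ : ℕ → SignedMeasure Plane)
    (hweak : WeaklyConvergesTo q₀ ω₀)
    (hvar : Tendsto (fun n => (q₀ n).totalVariation Set.univ) atTop (𝓝 (eLpNorm ω₀ 1 volume)))
    (T : ℝ) (hT : 0 < T) :
    ∃ α : ℕ → ℝ, (∀ n, 0 < α n) ∧ Tendsto α atTop (𝓝 0) ∧
      (∀ n, ∃! ζ : ℝ → Plane ≃ₜ Plane, IsBlobFlow (α n) (q₀ n) ζ) ∧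
      ∀ ηα : ℕ → ℝ → Plane ≃ₜ Plane, (∀ n, IsBlobFlow (α n) (q₀ n) (ηα n)) →
        Tendsto (fun n => ⨆ t ∈ Set.Icc (0 : ℝ) T, ⨆ x : Plane, ‖ηα n t x - η t x‖ₑ)
          atTop (𝓝 0) := by
  let a : ℕ → ℝ := fun j => 1 / (j + 1)
  have ha (j : ℕ) : 0 < a j := Nat.one_div_pos_of_nat
  have ha0 : Tendsto a atTop (𝓝 0) := tendsto_one_div_add_atTop_nhds_zero_nat
  have hq := hweak.convergesWithMass hω₁ hvar
  obtain ⟨X, hX, hlim⟩ := hη.exists_tendstoUniformlyOn_blobDisplacement hω₁ hω₂ T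
  obtain ⟨K, hK, hdiag⟩ := exists_tendstoUniformlyOn_diagonal
    (fun j => hq.tendstoUniformlyOn_displacement (admissibleKernel_blobMap (ha j))
      (tendsto_blobField_cocompact (ha j)) (ContinuousMap.id Plane) T) (hlim ha ha0)
  refine ⟨a ∘ K, fun n => ha (K n), ha0.comp hK, fun n => existsUnique_isBlobFlow (ha (K n)) (q₀ n),
    fun ηα hηα => ?_⟩
  have hblob (n : ℕ) (t : ℝ) (x : Plane) :
      ηα n t x = dispMap (blobDisplacement (ha (K n)) (q₀ n) t) x :=
    (hηα n).eq_dispMap (ha (K n)) t x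
  simp only [hblob, ← hX]
  exact tendsto_iSup_enorm_dispMap_sub
    (hdiag.mono (Set.Icc_subset_Icc_left (neg_nonpos.2 hT.le)))
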